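/- For a smooth function $g:\mathbb R^2\to\mathbb R$ and $x\in\mathbb R^2$ put $g_x(y)=g(y)-x\cdot y$. A saddle of $\nabla g_x$ is a zero of $\nabla g_x$ at which the Hessian of $g_x$ has a negative and a positive eigenvalue. The bifurcation locus $\mathcal B(g)\subset\mathbb R^2$ is the set of all $x$ for which $\nabla g_x$ has a saddle-to-saddle separatrix, i.e. there are two distinct saddles $s_1\ne s_2$ of $\nabla g_x$ and a solution $\gamma:\mathbb R\to\mathbb R^2$ of $\dot\gamma=\nabla g_x(\gamma)$ with $\gamma(t)\to s_1$ as $t\to-\infty$ and $\gamma(t)\to s_2$ as $t\to+\infty$. Let $f(y_1,y_2)=\frac13y_1^3-y_1y_2^2$ be the generating function of the elliptic umbilic. **Lemma.** For every $R_0>0$ there are $k\in\mathbb N$ and $\varepsilon>0$ such that the following holds for every compactly supported $C^\infty$ function $f':\mathbb R^2\to\mathbb R$ all of whose derivatives of order $0,\dots,k$ are bounded in norm by $\varepsilon$ on $\mathbb R^2$, and for every closed disc $D=\{|x|\le R\}$ with $R\ge R_0$ (in particular for every such disc that contains the support of $f'$): outside $D$, the bifurcation locus of $\tilde f=f+f'$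 is diffeomorphic to that of $f$. Precisely, there is a $C^\infty$ diffeomorphism $\Phi:\mathbb R^2\to\mathbb R^2$ with $\Phi(D)=D$ and $$\Phi\bigl(\mathcal B(f)\setminus D\bigr)=\mathcal B(f+f')\setminus D .$$ -/

import Mathlib

open Filter Topology
open scoped Manifold ContDiff

/-- The Euclidean plane (used both for the fibre variable `y` and the base variable `x`). -/
abbrev Plane : Type := EuclideanSpace ℝ (Fin 2)

/-- The generating function of the elliptic umbilic, normalised so that its gradient is
`(y₁² - y₂², -2 y₁ y₂)`. -/
noncomputable def ellipticUmbilic (y : Plane) : ℝ :=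
  (1 / 3) * y 0 ^ 3 - y 0 * y 1 ^ 2

/-- The function `f_x(y) = f(y) - x · y`. -/
noncomputable def tilt (f : Plane → ℝ) (x : Plane) : Plane → ℝ :=
  fun y => f y - inner ℝ x y

/-- `s` is a saddle of the vector field `∇g`: a zero of `∇g` at which the linearisation of `∇g`
(the Hessian of `g`) has a negative and a positive eigenvalue. -/
def IsSaddle (g : Plane → ℝ) (s : Plane) : Prop :=
  gradient g s = 0 ∧
    (∃ a : ℝ, a < 0 ∧
      Module.End.HasEigenvalue (fderiv ℝ (gradient g) s : Plane →ₗ[ℝ] Plane) a) ∧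
    (∃ b : ℝ, 0 < b ∧
      Module.End.HasEigenvalue (fderiv ℝ (gradient g) s : Plane →ₗ[ℝ] Plane) b)

/-- `γ` is a gradient line of `g` from `p` to `q`: an integral curve of `∇g`, defined for all
times, that tends to `p` at `-∞` and to `q` at `+∞`. -/
def IsGradientLine (g : Plane → ℝ) (γ : ℝ → Plane) (p q : Plane) : Prop :=
  (∀ t : ℝ, HasDerivAt γ (gradient g (γ t)) t) ∧
    Tendsto γ atBot (𝓝 p) ∧ Tendsto γ atTop (𝓝 q)

/-- The bifurcation locus of `f`: the set of all `x` for which `∇f_x` has a saddle-to-saddle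
separatrix, i.e. a gradient line of `f_x` joining two distinct saddles. -/
def bifurcationLocus (f : Plane → ℝ) : Set Plane :=
  {x | ∃ s₁ s₂ : Plane, s₁ ≠ s₂ ∧ IsSaddle (tilt f x) s₁ ∧ IsSaddle (tilt f x) s₂ ∧
    ∃ γ : ℝ → Plane, IsGradientLine (tilt f x) γ s₁ s₂}

/-! Identify the plane with ℂ. Then `∇f` is `conj z ^ 2`, and the gradient field of `f + f'` tilted
by `x` is `conj z ^ 2 - x + p z`, with `p` small in C¹. Substituting `z ↦ l u z`, `x ↦ l² u x` with
`l = √‖x‖` and `u ^ 3 = 1` preserves this form. It reduces everything to `‖x‖ = 1`, with a rescaled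
`p` that is still small because `‖x‖` is bounded below.

A priori step (`IsConnection.confined`, `IsConnection.near_modelOrbit`). Along a connection from
`s₁` to `s₂` the field is nearly `conj ((z - s₁)(z - s₂))`, so the integral of `(z - s₁)(z - s₂) dz`
moves in a narrow cone around the positive reals. Its total increment is `4/3 c³` with `c = (s₁ -
s₂)/2`, so `c` is near a cube root of unity `u`. The orbit stays near the segment between the
saddles, and a Riccati comparison shows that, rotated by `u⁻¹` and shifted in time, it is close to
the model orbit `-tanh t`.

Existence and uniqueness (`exists_smooth_fixedPoint`, `exists_connection_iff`). The linearisation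
along `-tanh` splits. The real direction is contracting, with a one-dimensional kernel removed by
fixing the time origin; the imaginary direction is expanding, with a one-dimensional cokernel that
determines the imaginary part `b` of the parameter. A contraction argument yields exactly one orbit
near the model for each cube root and each radius, with `b` smooth in the radius. An orbit near the
model does converge to two zeros (`isConnection_of_near_modelOrbit`), and all zeros are saddles for
such `x`. So outside a disc the locus consists of three curves, each a polar graph near a ray
through a cube root of unity.

Conclusion (`exists_diffeomorph_rays`). A rotation of each circle by a small angle depending on the
point carries the three rays to the three curves and preserves norms. Doing this for `f'` and for
`0` and composing gives `Φ`. -/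

open scoped BoundedContinuousFunction ComplexConjugate

set_option linter.unusedSectionVars false

/-! ### Smoothness of superposition operators on bounded continuous functions. -/

section Superposition

universe u

variable {α : Type*} [TopologicalSpace α]
  {E G : Type u} [NormedAddCommGroup E] [NormedSpace ℝ E] [ProperSpace E]
  [NormedAddCommGroup G] [NormedSpace ℝ G]

theorem exists_bound_comp_bounded {F : E → G} (hF : Continuous F) (u : α →ᵇ E) :
    ∃ C, ∀ t, ‖F (u t)‖ ≤ C := by
  obtain ⟨C, hC⟩ := (isCompact_closedBall (0 : E) ‖u‖).exists_bound_of_continuousOn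
    hF.continuousOn
  exact ⟨C, fun t => hC _ (by simpa using u.norm_coe_le_norm t)⟩

/-- The superposition operator `u ↦ F ∘ u` on bounded continuous functions. -/
noncomputable def superposition (F : E → G) (hF : Continuous F) (u : α →ᵇ E) : α →ᵇ G :=
  BoundedContinuousFunction.ofNormedAddCommGroup (fun t => F (u t)) (hF.comp u.continuous)
    (exists_bound_comp_bounded hF u).choose (exists_bound_comp_bounded hF u).choose_spec

@[simp]
theorem superposition_apply (F : E → G) (hF : Continuous F) (u : α →ᵇ E) (t : α) :
    superposition F hF u t = F (u t) := rfl

/-- Pointwise application of bounded continuous families of linear maps. -/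
noncomputable def pointwiseApply :
    (α →ᵇ (E →L[ℝ] G)) →L[ℝ] (α →ᵇ E) →L[ℝ] (α →ᵇ G) :=
  LinearMap.mkContinuous₂
    (LinearMap.mk₂ ℝ (fun (A : α →ᵇ (E →L[ℝ] G)) (h : α →ᵇ E) =>
      BoundedContinuousFunction.ofNormedAddCommGroup (fun t => A t (h t))
        (A.continuous.clm_apply h.continuous) (‖A‖ * ‖h‖)
        (fun t => (A t).le_of_opNorm_le_of_le (A.norm_coe_le_norm t) (h.norm_coe_le_norm t)))
      (fun _ _ _ => by ext; simp) (fun _ _ _ => by ext; simp)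
      (fun _ _ _ => by ext; simp) (fun _ _ _ => by ext; simp)) 1
    (fun A h => by
      rw [one_mul]
      exact BoundedContinuousFunction.norm_ofNormedAddCommGroup_le _ (by positivity) fun t =>
        (A t).le_of_opNorm_le_of_le (A.norm_coe_le_norm t) (h.norm_coe_le_norm t))

@[simp]
theorem pointwiseApply_apply (A : α →ᵇ (E →L[ℝ] G)) (h : α →ᵇ E) (t : α) :
    pointwiseApply A h t = A t (h t) := rfl

/-- The values of `u` and of small perturbations of it lie in a fixed ball, compact because `E` is
proper. Uniform continuity of `F'` there makes the mean value estimate uniform in `t`. -/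
theorem hasFDerivAt_superposition {F : E → G} {F' : E → E →L[ℝ] G}
    (hF : ∀ y, HasFDerivAt F (F' y) y) (hF' : Continuous F') (hc : Continuous F) (u : α →ᵇ E) :
    HasFDerivAt (superposition F hc) (pointwiseApply (superposition F' hF' u)) u := by
  rw [hasFDerivAt_iff_isLittleO_nhds_zero, Asymptotics.isLittleO_iff]
  intro c hcpos
  have huc := (isCompact_closedBall (0 : E) (‖u‖ + 1)).uniformContinuousOn_of_continuous
    hF'.continuousOn
  obtain ⟨δ, hδ, hδ'⟩ := Metric.uniformContinuousOn_iff_le.1 huc c hcpos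
  filter_upwards [Metric.ball_mem_nhds (0 : α →ᵇ E) (lt_min hδ one_pos)] with h hh
  rw [mem_ball_zero_iff, lt_min_iff] at hh
  refine (BoundedContinuousFunction.norm_le (by positivity)).2 fun t => ?_
  have hu := u.norm_coe_le_norm t
  have ht := h.norm_coe_le_norm t
  have key := (convex_segment (𝕜 := ℝ) (u t) (u t + h t)).norm_image_sub_le_of_norm_hasFDerivWithin_le'
    (f := F) (f' := F') (φ := F' (u t)) (C := c)
    (fun y _ => (hF y).hasFDerivWithinAt) ?_ (left_mem_segment ℝ _ _) (right_mem_segment ℝ _ _)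
  · simp only [add_sub_cancel_left] at key
    simp only [BoundedContinuousFunction.coe_sub, Pi.sub_apply, superposition_apply,
      BoundedContinuousFunction.coe_add, Pi.add_apply, pointwiseApply_apply]
    exact key.trans (by gcongr)
  · intro y hy
    have hyu : ‖y - u t‖ ≤ ‖h t‖ := by
      have := norm_sub_le_of_mem_segment hy
      simpa using this
    have hy1 : ‖y‖ ≤ ‖u‖ + 1 := by
      have := norm_le_norm_add_norm_sub' y (u t)
      linarith
    rw [← dist_eq_norm]
    refine hδ' y (by simpa using hy1) (u t) (by simp; linarith) ?_
    rw [dist_eq_norm]; linarith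

/-- The derivative is again a superposition operator, that of `fderiv ℝ F`, followed by the
continuous linear map `pointwiseApply`; hence induction. The codomain becomes `E →L[ℝ] G` at each
step, which is why `G` is generalised and shares a universe with `E`. -/
theorem contDiff_nat_superposition (n : ℕ) {F : E → G} (hF : ContDiff ℝ n F) (hc : Continuous F) :
    ContDiff ℝ n (superposition (α := α) F hc) := by
  induction n generalizing G with
  | zero =>
    refine contDiff_zero.2 (continuous_iff_continuousAt.2 fun u => ?_)
    rw [Metric.continuousAt_iff]
    intro c hcpos
    have huc := (isCompact_closedBall (0 : E) (‖u‖ + 1)).uniformContinuousOn_of_continuous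
      hc.continuousOn
    obtain ⟨δ, hδ, hδ'⟩ := Metric.uniformContinuousOn_iff_le.1 huc (c / 2) (by positivity)
    refine ⟨min δ 1, lt_min hδ one_pos, fun {v} hv => ?_⟩
    rw [lt_min_iff] at hv
    refine lt_of_le_of_lt ((BoundedContinuousFunction.dist_le (by positivity)).2 fun t => ?_)
      (half_lt_self hcpos)
    have h1 := u.norm_coe_le_norm t
    have h2 := BoundedContinuousFunction.dist_coe_le_dist (f := v) (g := u) t
    have h3 := norm_le_norm_add_norm_sub' (v t) (u t)
    rw [← dist_eq_norm] at h3
    exact hδ' _ (by simp; linarith) _ (by simp; linarith) (by linarith)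
  | succ n ih =>
    have hd : Differentiable ℝ F := hF.differentiable (by simp)
    have hF' : ContDiff ℝ n (fderiv ℝ F) := hF.fderiv_right (by simp)
    have hder := fun u : α →ᵇ E =>
      hasFDerivAt_superposition (fun y => (hd y).hasFDerivAt) hF'.continuous hc u
    rw [Nat.cast_add, Nat.cast_one, contDiff_succ_iff_hasFDerivAt]
    have hp : ContDiff ℝ n (pointwiseApply : (α →ᵇ (E →L[ℝ] G)) →L[ℝ] _) :=
      ContinuousLinearMap.contDiff _
    exact ⟨fun u => pointwiseApply (superposition _ hF'.continuous u),
      hp.comp (ih hF' hF'.continuous), hder⟩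

theorem contDiff_superposition {F : E → G} (hF : ContDiff ℝ ∞ F) (hc : Continuous F) :
    ContDiff ℝ ∞ (superposition (α := α) F hc) :=
  contDiff_infty.2 fun n => contDiff_nat_superposition n (hF.of_le (mod_cast le_top)) hc

end Superposition

/-! ### Fixed points of uniform contractions and their dependence on a parameter. -/

section UniformContraction

variable {X : Type*} [NormedAddCommGroup X] [NormedSpace ℝ X] [CompleteSpace X]

/-- Smooth dependence of the fixed point of a uniform contraction on a parameter. -/
theorem contDiffAt_fixedPoint {T : ℝ × X → X} {z : ℝ → X} {U : Set ℝ} (hU : IsOpen U) {ρ : ℝ}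
    (hT : ∀ s ∈ U, ∀ x ∈ Metric.ball (0 : X) ρ, ContDiffAt ℝ ∞ T (s, x))
    (hlip : ∀ s ∈ U, ∀ x ∈ Metric.ball (0 : X) ρ, ∀ y ∈ Metric.ball (0 : X) ρ,
      ‖T (s, x) - T (s, y)‖ ≤ 1 / 2 * ‖x - y‖)
    (hz : ∀ s ∈ U, z s ∈ Metric.ball (0 : X) ρ ∧ T (s, z s) = z s) {s₀ : ℝ} (hs₀ : s₀ ∈ U) :
    ContDiffAt ℝ ∞ z s₀ := by
  set f : ℝ × X → X := fun p => p.2 - T p with hf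
  have hf0 : f (s₀, z s₀) = 0 := by simp [hf, (hz s₀ hs₀).2]
  have hTd := hT s₀ hs₀ _ (hz s₀ hs₀).1
  have cdf : ContDiffAt ℝ ∞ f (s₀, z s₀) := contDiffAt_snd.sub hTd
  have hTf : HasFDerivAt T (fderiv ℝ T (s₀, z s₀)) (s₀, z s₀) :=
    (hTd.differentiableAt (by simp)).hasFDerivAt
  set A : X →L[ℝ] X := (fderiv ℝ T (s₀, z s₀)).comp (.inr ℝ ℝ X) with hA
  have hTA : HasFDerivAt (fun x => T (s₀, x)) A (z s₀) :=
    hTf.comp (z s₀) (hasFDerivAt_prodMk_right s₀ (z s₀))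
  have hAn : ‖A‖ ≤ 1 / 2 := by
    refine hTA.le_of_lip' (by norm_num) ?_
    filter_upwards [Metric.isOpen_ball.mem_nhds (hz s₀ hs₀).1] with x hx
    exact hlip s₀ hs₀ x hx _ (hz s₀ hs₀).1
  have hfA : fderiv ℝ f (s₀, z s₀) ∘L .inr ℝ ℝ X = 1 - A := by
    have : HasFDerivAt f (ContinuousLinearMap.snd ℝ ℝ X - fderiv ℝ T (s₀, z s₀)) (s₀, z s₀) :=
      hasFDerivAt_snd.sub hTf
    rw [this.fderiv]
    ext x; simp [hA]
  have hinv : (fderiv ℝ f (s₀, z s₀) ∘L .inr ℝ ℝ X).IsInvertible := by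
    rw [hfA]
    have hu : IsUnit (1 - A) := isUnit_one_sub_of_norm_lt_one (by linarith)
    obtain ⟨e, he⟩ := hu
    exact ⟨ContinuousLinearEquiv.unitsEquiv ℝ X e, by rw [← he]; rfl⟩
  have hψ := cdf.contDiffAt_implicitFunction (by simp) hinv
  -- No continuity of `z` is assumed: the implicit function stays in the ball near `s₀` and consists
  -- of fixed points, so uniqueness for the contraction identifies it with `z`.
  refine hψ.congr_of_eventuallyEq ?_
  have h0 := cdf.implicitFunction_apply_self (by simp) hinv
  have hc : ContinuousAt (cdf.implicitFunction (by simp) hinv) s₀ := hψ.continuousAt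
  have hball : ∀ᶠ s in 𝓝 s₀, cdf.implicitFunction (by simp) hinv s ∈ Metric.ball (0 : X) ρ :=
    hc.eventually_mem (Metric.isOpen_ball.mem_nhds (by rw [h0]; exact (hz s₀ hs₀).1))
  filter_upwards [hball, cdf.eventually_apply_implicitFunction (by simp) hinv,
    hU.mem_nhds hs₀] with s hs1 hs2 hs3
  have e1 : T (s, cdf.implicitFunction (by simp) hinv s) = cdf.implicitFunction (by simp) hinv s := by
    rw [hf0] at hs2
    exact (sub_eq_zero.1 hs2).symm
  have h := hlip s hs3 _ (hz s hs3).1 _ hs1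
  rw [(hz s hs3).2, e1] at h
  have := norm_nonneg (z s - cdf.implicitFunction (by simp) hinv s)
  exact sub_eq_zero.1 (norm_le_zero_iff.1 (by linarith))

/-- A `1/2`-Lipschitz self-map of an open ball, moving the centre by little, has a fixed point. -/
theorem exists_fixedPoint_ball {T : X → X} {ρ η : ℝ} (hη : 0 ≤ η) (hρ : 2 * η < ρ)
    (hlip : ∀ x ∈ Metric.ball (0 : X) ρ, ∀ y ∈ Metric.ball (0 : X) ρ,
      ‖T x - T y‖ ≤ 1 / 2 * ‖x - y‖) (h0 : ‖T 0‖ ≤ η) :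
    ∃ z ∈ Metric.ball (0 : X) ρ, T z = z := by
  have hsub : Metric.closedBall (0 : X) (2 * η) ⊆ Metric.ball 0 ρ := Metric.closedBall_subset_ball hρ
  have h0ρ : (0 : X) ∈ Metric.ball (0 : X) ρ := hsub (Metric.mem_closedBall_self (by positivity))
  have hmaps : Set.MapsTo T (Metric.closedBall (0 : X) (2 * η)) (Metric.closedBall 0 (2 * η)) := by
    intro x hx
    have h := hlip x (hsub hx) 0 h0ρ
    have h2 := norm_le_norm_add_norm_sub' (T x) (T 0)
    rw [mem_closedBall_zero_iff] at hx ⊢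
    rw [sub_zero] at h
    linarith
  have hcontr : ContractingWith (1 / 2) (hmaps.restrict T _ _) := by
    refine ⟨by norm_num [← NNReal.coe_lt_coe], LipschitzWith.of_dist_le_mul fun x y => ?_⟩
    have := hlip x (hsub x.2) y (hsub y.2)
    rw [Subtype.dist_eq, Subtype.dist_eq, dist_eq_norm, dist_eq_norm]
    simpa using this
  obtain ⟨y, hy, hfix, -⟩ := ContractingWith.exists_fixedPoint' (x := (0 : X))
    Metric.isClosed_closedBall.isComplete hmaps hcontr
    (Metric.mem_closedBall_self (by positivity)) (edist_ne_top _ _)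
  exact ⟨y, hsub hy, hfix⟩

end UniformContraction

/-! ### Derivative, monotonicity and limits of tanh. -/

section HyperbolicTangent

theorem hasDerivAt_real_tanh (t : ℝ) : HasDerivAt Real.tanh ((Real.cosh t ^ 2)⁻¹) t := by
  have h := (Real.hasDerivAt_sinh t).div (Real.hasDerivAt_cosh t) (Real.cosh_pos t).ne'
  have e : Real.tanh = Real.sinh / Real.cosh := by
    ext s; simp [Real.tanh_eq_sinh_div_cosh]
  rw [e]
  convert! h using 1
  have := Real.cosh_sq_sub_sinh_sq t
  rw [inv_eq_one_div, ← this]; ring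

theorem inv_cosh_sq_eq (t : ℝ) : (Real.cosh t ^ 2)⁻¹ = 1 - Real.tanh t ^ 2 := by
  have := Real.cosh_sq_sub_sinh_sq t
  have h := (Real.cosh_pos t).ne'
  rw [Real.tanh_eq_sinh_div_cosh]
  field_simp
  linarith

theorem strictMono_real_tanh : StrictMono Real.tanh :=
  strictMono_of_hasDerivAt_pos hasDerivAt_real_tanh
    (fun t => by have := Real.cosh_pos t; positivity)

theorem tendsto_real_tanh_atTop : Tendsto Real.tanh atTop (𝓝 1) := by
  refine tendsto_order.2 ⟨fun a ha => ?_, fun a ha => Eventually.of_forall fun t =>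
    (Real.tanh_lt_one t).trans ha⟩
  have hm : max a 0 ∈ Set.Ioo (-1 : ℝ) 1 := ⟨by simp, by simp [ha]⟩
  filter_upwards [eventually_gt_atTop (Real.artanh (max a 0))] with t ht
  have := strictMono_real_tanh ht
  rw [Real.tanh_artanh hm] at this
  exact (le_max_left _ _).trans_lt this

theorem tendsto_real_tanh_atBot : Tendsto Real.tanh atBot (𝓝 (-1)) := by
  have h := (tendsto_real_tanh_atTop.comp tendsto_neg_atBot_atTop).neg
  refine h.congr fun t => ?_
  simp

theorem real_tanh_nonneg {t : ℝ} (ht : 0 ≤ t) : 0 ≤ Real.tanh t := by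
  simpa using strictMono_real_tanh.monotone ht

end HyperbolicTangent

/-! ### The two scalar linear equations along the model orbit. -/

section LinearOperators

open MeasureTheory
open intervalIntegral hiding integral_const_mul integral_mul_const

/-- `sech²`. -/
noncomputable def sechSq (t : ℝ) : ℝ := (Real.cosh t ^ 2)⁻¹

theorem sechSq_pos (t : ℝ) : 0 < sechSq t := by
  have := Real.cosh_pos t; unfold sechSq; positivity

theorem continuous_sechSq : Continuous sechSq :=
  (Real.continuous_cosh.pow 2).inv₀ fun t => pow_ne_zero 2 (Real.cosh_pos t).ne'

theorem cosh_sq_mul_sechSq (t : ℝ) : Real.cosh t ^ 2 * sechSq t = 1 :=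
  mul_inv_cancel₀ (by have := Real.cosh_pos t; positivity)

theorem hasDerivAt_cosh_sq (t : ℝ) :
    HasDerivAt (fun s => Real.cosh s ^ 2) (2 * Real.tanh t * Real.cosh t ^ 2) t := by
  convert! (Real.hasDerivAt_cosh t).pow 2 using 1
  have h := (Real.cosh_pos t).ne'
  rw [Real.tanh_eq_sinh_div_cosh]; field_simp
  simp [mul_comm]

theorem hasDerivAt_sechSq (t : ℝ) : HasDerivAt sechSq (-2 * Real.tanh t * sechSq t) t := by
  have h0 : Real.cosh t ^ 2 ≠ 0 := by have := Real.cosh_pos t; positivity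
  convert! (hasDerivAt_cosh_sq t).inv h0 using 1
  unfold sechSq; field_simp

theorem integrable_sechSq : Integrable sechSq := by
  refine integrable_inv_one_add_sq.mono' continuous_sechSq.aestronglyMeasurable
    (Eventually.of_forall fun t => ?_)
  rw [Real.norm_of_nonneg (sechSq_pos t).le, sechSq]
  refine inv_anti₀ (by positivity) ?_
  rw [Real.cosh_sq']
  have : |t| ≤ |Real.sinh t| := by
    rw [Real.abs_sinh]; exact Real.self_le_sinh_iff.2 (abs_nonneg t)
  have := sq_le_sq.2 this
  linarith

theorem integral_Iic_sechSq (t : ℝ) : ∫ s in Set.Iic t, sechSq s = Real.tanh t + 1 := by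
  rw [integral_Iic_of_hasDerivAt_of_tendsto' (f' := sechSq) (fun x _ => hasDerivAt_real_tanh x)
    integrable_sechSq.integrableOn tendsto_real_tanh_atBot]
  ring

theorem integral_Ioi_sechSq (t : ℝ) : ∫ s in Set.Ioi t, sechSq s = 1 - Real.tanh t :=
  integral_Ioi_of_hasDerivAt_of_tendsto' (fun x _ => hasDerivAt_real_tanh x)
    integrable_sechSq.integrableOn tendsto_real_tanh_atTop

theorem integral_sechSq : ∫ s, sechSq s = 2 := by
  rw [integral_of_hasDerivAt_of_tendsto (f' := sechSq) hasDerivAt_real_tanh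
    integrable_sechSq tendsto_real_tanh_atBot tendsto_real_tanh_atTop]
  norm_num

theorem integrable_sechSq_mul (h : ℝ →ᵇ ℝ) : Integrable fun t => sechSq t * h t :=
  integrable_sechSq.mul_bdd (c := ‖h‖) h.continuous.aestronglyMeasurable
    (Eventually.of_forall h.norm_coe_le_norm)

theorem norm_sechSq_mul_le (h : ℝ →ᵇ ℝ) (t : ℝ) : ‖sechSq t * h t‖ ≤ sechSq t * ‖h‖ := by
  rw [norm_mul, Real.norm_of_nonneg (sechSq_pos t).le]
  exact mul_le_mul_of_nonneg_left (h.norm_coe_le_norm t) (sechSq_pos t).le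

/-- The mean of a bounded function against `sech² / 2`. -/
noncomputable def sechMean : (ℝ →ᵇ ℝ) →L[ℝ] ℝ :=
  LinearMap.mkContinuous
    { toFun := fun h => (1 / 2) * ∫ t, sechSq t * h t
      map_add' := fun g h => by
        simp only [BoundedContinuousFunction.coe_add, Pi.add_apply, mul_add]
        rw [integral_add (integrable_sechSq_mul g) (integrable_sechSq_mul h)]; ring
      map_smul' := fun c h => by
        simp only [BoundedContinuousFunction.coe_smul, smul_eq_mul, RingHom.id_apply]
        rw [← integral_const_mul, ← integral_const_mul, ← integral_const_mul]
        exact integral_congr_ae (Eventually.of_forall fun t => by ring) } 1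
    (fun h => by
      have := norm_integral_le_of_norm_le (integrable_sechSq.mul_const ‖h‖)
        (Eventually.of_forall (norm_sechSq_mul_le h))
      rw [integral_mul_const, integral_sechSq] at this
      simp only [LinearMap.coe_mk, AddHom.coe_mk, norm_mul]
      norm_num
      rw [Real.norm_eq_abs] at this
      linarith)

theorem sechMean_apply (h : ℝ →ᵇ ℝ) : sechMean h = (1 / 2) * ∫ t, sechSq t * h t := rfl

theorem norm_sechMean_le (h : ℝ →ᵇ ℝ) : |sechMean h| ≤ ‖h‖ := by
  have h1 : ‖sechMean‖ ≤ 1 := LinearMap.mkContinuous_norm_le _ zero_le_one _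
  simpa using sechMean.le_of_opNorm_le h1 h

/-! ### The contracting direction -/

theorem hasDerivAt_contractingSolution (g : ℝ →ᵇ ℝ) (t : ℝ) :
    HasDerivAt (fun t => sechSq t * ∫ s in (0 : ℝ)..t, Real.cosh s ^ 2 * g s)
      (-2 * Real.tanh t * (sechSq t * ∫ s in (0 : ℝ)..t, Real.cosh s ^ 2 * g s) + g t) t := by
  have hc : Continuous fun s => Real.cosh s ^ 2 * g s :=
    (Real.continuous_cosh.pow 2).mul g.continuous
  have h := (hasDerivAt_sechSq t).mul
    (integral_hasDerivAt_right (hc.intervalIntegrable 0 t)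
      hc.aestronglyMeasurable.stronglyMeasurableAtFilter hc.continuousAt)
  convert! h using 1
  have := cosh_sq_mul_sechSq t
  linear_combination -(g t) * this

/-- `cosh²` is at most `cosh² + sinh²`, the derivative of `sinh · cosh`, and `|sinh · cosh| ≤
cosh²`. So the factor `sechSq` cancels the growth of the integral exactly. -/
theorem abs_contractingSolution_le (g : ℝ →ᵇ ℝ) (t : ℝ) :
    ‖sechSq t * ∫ s in (0 : ℝ)..t, Real.cosh s ^ 2 * g s‖ ≤ ‖g‖ := by
  have hd : ∀ s, HasDerivAt (fun s => Real.sinh s * Real.cosh s * ‖g‖)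
      ((Real.cosh s * Real.cosh s + Real.sinh s * Real.sinh s) * ‖g‖) s := fun s =>
    ((Real.hasDerivAt_sinh s).mul (Real.hasDerivAt_cosh s)).mul_const _
  have hcont : Continuous fun s =>
      (Real.cosh s * Real.cosh s + Real.sinh s * Real.sinh s) * ‖g‖ := by fun_prop
  have hint := integral_eq_sub_of_hasDerivAt (a := 0) (b := t) (fun s _ => hd s)
    (hcont.intervalIntegrable 0 t)
  have hle := norm_integral_le_abs_of_norm_le (a := (0 : ℝ)) (b := t) (μ := volume)
    (f := fun s => Real.cosh s ^ 2 * g s)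
    (g := fun s => (Real.cosh s * Real.cosh s + Real.sinh s * Real.sinh s) * ‖g‖)
    (Eventually.of_forall fun s => by
      rw [norm_mul, Real.norm_of_nonneg (by positivity)]
      have := g.norm_coe_le_norm s
      have h2 := mul_self_nonneg (Real.sinh s)
      gcongr
      nlinarith) (hcont.intervalIntegrable 0 t)
  rw [hint] at hle
  simp only [Real.sinh_zero, zero_mul, sub_zero] at hle
  rw [norm_mul, Real.norm_of_nonneg (sechSq_pos t).le]
  have h3 : |Real.sinh t * Real.cosh t * ‖g‖| ≤ Real.cosh t ^ 2 * ‖g‖ := by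
    rw [abs_mul, abs_mul, abs_norm, abs_of_pos (Real.cosh_pos t), pow_two]
    have : |Real.sinh t| ≤ Real.cosh t := by
      rw [Real.abs_sinh, ← Real.cosh_abs t]; exact (Real.sinh_lt_cosh _).le
    have := (Real.cosh_pos t).le
    gcongr
  calc _ ≤ sechSq t * (Real.cosh t ^ 2 * ‖g‖) :=
        mul_le_mul_of_nonneg_left (hle.trans h3) (sechSq_pos t).le
    _ = ‖g‖ := by rw [← mul_assoc, mul_comm (sechSq t), cosh_sq_mul_sechSq, one_mul]

/-- The solution with `ξ(0) = 0` of `ξ' = -2 tanh(t) ξ + g`. -/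
noncomputable def contractingSolution : (ℝ →ᵇ ℝ) →L[ℝ] (ℝ →ᵇ ℝ) :=
  LinearMap.mkContinuous
    { toFun := fun g => BoundedContinuousFunction.ofNormedAddCommGroup
        (fun t => sechSq t * ∫ s in (0 : ℝ)..t, Real.cosh s ^ 2 * g s)
        (continuous_iff_continuousAt.2 fun t => (hasDerivAt_contractingSolution g t).continuousAt)
        ‖g‖ (abs_contractingSolution_le g)
      map_add' := fun g h => by
        ext t
        have hc : ∀ g : ℝ →ᵇ ℝ, IntervalIntegrable (fun s => Real.cosh s ^ 2 * g s) volume 0 t :=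
          fun g => ((Real.continuous_cosh.pow 2).mul g.continuous).intervalIntegrable 0 t
        simp only [BoundedContinuousFunction.coe_add, Pi.add_apply, mul_add,
          BoundedContinuousFunction.coe_ofNormedAddCommGroup]
        rw [integral_add (hc g) (hc h), mul_add]
      map_smul' := fun c h => by
        ext t
        simp only [BoundedContinuousFunction.coe_smul, smul_eq_mul, RingHom.id_apply,
          BoundedContinuousFunction.coe_ofNormedAddCommGroup]
        have e : ∀ s, Real.cosh s ^ 2 * (c * h s) = c * (Real.cosh s ^ 2 * h s) := fun s => by ring
        simp only [e]
        rw [intervalIntegral.integral_const_mul, mul_left_comm] } 1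
    (fun g => by
      rw [one_mul]
      exact BoundedContinuousFunction.norm_ofNormedAddCommGroup_le _ (norm_nonneg _)
        (abs_contractingSolution_le g))

theorem contractingSolution_apply (g : ℝ →ᵇ ℝ) (t : ℝ) : contractingSolution g t =
    sechSq t * ∫ s in (0 : ℝ)..t, Real.cosh s ^ 2 * g s := rfl

theorem norm_contractingSolution_le (g : ℝ →ᵇ ℝ) : ‖contractingSolution g‖ ≤ ‖g‖ := by
  have h1 : ‖contractingSolution‖ ≤ 1 := LinearMap.mkContinuous_norm_le _ zero_le_one _
  simpa using contractingSolution.le_of_opNorm_le h1 g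

theorem hasDerivAt_contracting (g : ℝ →ᵇ ℝ) (t : ℝ) : HasDerivAt (contractingSolution g)
    (-2 * Real.tanh t * contractingSolution g t + g t) t :=
  hasDerivAt_contractingSolution g t

theorem eq_contractingSolution {ξ : ℝ → ℝ} {g : ℝ →ᵇ ℝ} (h0 : ξ 0 = 0)
    (h : ∀ t, HasDerivAt ξ (-2 * Real.tanh t * ξ t + g t) t) (t : ℝ) :
    ξ t = contractingSolution g t := by
  have hc : Continuous fun s => Real.cosh s ^ 2 * g s :=
    (Real.continuous_cosh.pow 2).mul g.continuous
  have hd : ∀ s, HasDerivAt (fun s => Real.cosh s ^ 2 * ξ s) (Real.cosh s ^ 2 * g s) s := by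
    intro s
    convert! (hasDerivAt_cosh_sq s).mul (h s) using 1
    ring
  rw [contractingSolution_apply, integral_eq_sub_of_hasDerivAt (fun s _ => hd s)
    (hc.intervalIntegrable 0 t), h0, mul_zero, sub_zero, ← mul_assoc, mul_comm (sechSq t),
    cosh_sq_mul_sechSq, one_mul]

/-! ### The expanding direction -/

/-- `h` minus its weighted mean. -/
noncomputable def centered (h : ℝ →ᵇ ℝ) : ℝ →ᵇ ℝ :=
  h - BoundedContinuousFunction.const ℝ (sechMean h)

theorem centered_apply (h : ℝ →ᵇ ℝ) (t : ℝ) : centered h t = h t - sechMean h := rfl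

theorem norm_centered_le (h : ℝ →ᵇ ℝ) : ‖centered h‖ ≤ 2 * ‖h‖ := by
  refine (norm_sub_le _ _).trans ?_
  have h1 := norm_sechMean_le h
  have h2 := BoundedContinuousFunction.norm_const_le (α := ℝ) (sechMean h)
  rw [Real.norm_eq_abs] at h2
  linarith

theorem integral_sechSq_mul_centered (h : ℝ →ᵇ ℝ) : ∫ t, sechSq t * centered h t = 0 := by
  simp only [centered_apply, mul_sub]
  rw [integral_sub (integrable_sechSq_mul h) (integrable_sechSq.mul_const _), integral_mul_const,
    integral_sechSq, sechMean_apply]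
  ring

theorem hasDerivAt_integral_Iic {φ : ℝ → ℝ} (hφ : Integrable φ) (hc : Continuous φ) (t : ℝ) :
    HasDerivAt (fun t => ∫ s in Set.Iic t, φ s) (φ t) t := by
  have e : (fun t => ∫ s in Set.Iic t, φ s) =
      fun t => (∫ s in Set.Iic 0, φ s) + ∫ s in (0 : ℝ)..t, φ s := by
    ext t
    rw [← integral_Iic_sub_Iic hφ.integrableOn hφ.integrableOn]; ring
  rw [e]
  exact (integral_hasDerivAt_right (hc.intervalIntegrable 0 t)
    hc.aestronglyMeasurable.stronglyMeasurableAtFilter hc.continuousAt).const_add _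

theorem continuous_sechSq_mul (h : ℝ →ᵇ ℝ) : Continuous fun t => sechSq t * h t :=
  continuous_sechSq.mul h.continuous

theorem hasDerivAt_expandingSolution (h : ℝ →ᵇ ℝ) (t : ℝ) :
    HasDerivAt (fun t => Real.cosh t ^ 2 * ∫ s in Set.Iic t, sechSq s * h s)
      (2 * Real.tanh t * (Real.cosh t ^ 2 * ∫ s in Set.Iic t, sechSq s * h s) + h t) t := by
  convert! (hasDerivAt_cosh_sq t).mul
    (hasDerivAt_integral_Iic (integrable_sechSq_mul h) (continuous_sechSq_mul h) t) using 1
  have := cosh_sq_mul_sechSq t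
  linear_combination -(h t) * this

/-- The homogeneous solution `cosh²` grows at both ends. For `t ≤ 0` the integral over `Iic t` is at
most `(1 + tanh t)‖h‖`, which compensates. For `t ≥ 0` the vanishing total integral turns it into
minus the integral over `Ioi t`, at most `(1 - tanh t)‖h‖`. -/
theorem abs_expandingSolution_le (h : ℝ →ᵇ ℝ) (h0 : ∫ t, sechSq t * h t = 0) (t : ℝ) :
    ‖Real.cosh t ^ 2 * ∫ s in Set.Iic t, sechSq s * h s‖ ≤ ‖h‖ := by
  rw [norm_mul, Real.norm_of_nonneg (by positivity)]
  have hcosh := Real.cosh_pos t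
  have hsq := Real.cosh_sq_sub_sinh_sq t
  have ht : Real.tanh t * Real.cosh t = Real.sinh t := by
    rw [Real.tanh_eq_sinh_div_cosh]; field_simp
  rcases le_total t 0 with h1 | h1
  · have hle : ‖∫ s in Set.Iic t, sechSq s * h s‖ ≤ (Real.tanh t + 1) * ‖h‖ := by
      rw [← integral_Iic_sechSq, ← integral_mul_const]
      exact norm_integral_le_of_norm_le (integrable_sechSq.mul_const _).integrableOn
        (Eventually.of_forall (norm_sechSq_mul_le h))
    have hs : Real.sinh t ≤ 0 := Real.sinh_nonpos_iff.2 h1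
    have hcs : 0 < Real.cosh t + Real.sinh t := by rw [Real.cosh_add_sinh]; positivity
    have hb : Real.cosh t ^ 2 * (Real.tanh t + 1) ≤ 1 := by
      have : Real.cosh t ^ 2 * (Real.tanh t + 1) = Real.cosh t * (Real.cosh t + Real.sinh t) := by
        rw [← ht]; ring
      rw [this]; nlinarith
    calc _ ≤ Real.cosh t ^ 2 * ((Real.tanh t + 1) * ‖h‖) := by gcongr
      _ = Real.cosh t ^ 2 * (Real.tanh t + 1) * ‖h‖ := by ring
      _ ≤ 1 * ‖h‖ := by gcongr
      _ = ‖h‖ := one_mul _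
  · have hsplit := integral_Iic_add_Ioi (b := t) (integrable_sechSq_mul h).integrableOn
      (integrable_sechSq_mul h).integrableOn
    rw [h0] at hsplit
    have hle : ‖∫ s in Set.Iic t, sechSq s * h s‖ ≤ (1 - Real.tanh t) * ‖h‖ := by
      rw [eq_neg_of_add_eq_zero_left hsplit, norm_neg, ← integral_Ioi_sechSq, ← integral_mul_const]
      exact norm_integral_le_of_norm_le (integrable_sechSq.mul_const _).integrableOn
        (Eventually.of_forall (norm_sechSq_mul_le h))
    have hs : 0 ≤ Real.sinh t := Real.sinh_nonneg_iff.2 h1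
    have hcs : 0 < Real.cosh t - Real.sinh t := by rw [Real.cosh_sub_sinh]; positivity
    have hb : Real.cosh t ^ 2 * (1 - Real.tanh t) ≤ 1 := by
      have : Real.cosh t ^ 2 * (1 - Real.tanh t) = Real.cosh t * (Real.cosh t - Real.sinh t) := by
        rw [← ht]; ring
      rw [this]; nlinarith
    calc _ ≤ Real.cosh t ^ 2 * ((1 - Real.tanh t) * ‖h‖) := by gcongr
      _ = Real.cosh t ^ 2 * (1 - Real.tanh t) * ‖h‖ := by ring
      _ ≤ 1 * ‖h‖ := by gcongr
      _ = ‖h‖ := one_mul _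

/-- The bounded solution of `η' = 2 tanh(t) η + h - sechMean h`. -/
noncomputable def expandingSolution : (ℝ →ᵇ ℝ) →L[ℝ] (ℝ →ᵇ ℝ) :=
  LinearMap.mkContinuous
    { toFun := fun h => BoundedContinuousFunction.ofNormedAddCommGroup
        (fun t => Real.cosh t ^ 2 * ∫ s in Set.Iic t, sechSq s * centered h s)
        (continuous_iff_continuousAt.2 fun t =>
          (hasDerivAt_expandingSolution (centered h) t).continuousAt)
        ‖centered h‖ (abs_expandingSolution_le _ (integral_sechSq_mul_centered h))
      map_add' := fun g h => by
        ext t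
        have e : ∀ s, sechSq s * centered (g + h) s =
            sechSq s * centered g s + sechSq s * centered h s := fun s => by
          simp only [centered_apply, map_add, BoundedContinuousFunction.coe_add, Pi.add_apply]
          ring
        simp only [BoundedContinuousFunction.coe_add, Pi.add_apply, e,
          BoundedContinuousFunction.coe_ofNormedAddCommGroup]
        rw [integral_add (integrable_sechSq_mul _).integrableOn
          (integrable_sechSq_mul _).integrableOn, mul_add]
      map_smul' := fun c h => by
        ext t
        have e : ∀ s, sechSq s * centered (c • h) s = c * (sechSq s * centered h s) := fun s => by
          simp only [centered_apply, map_smul, BoundedContinuousFunction.coe_smul, smul_eq_mul]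
          ring
        simp only [BoundedContinuousFunction.coe_smul, smul_eq_mul, RingHom.id_apply, e,
          BoundedContinuousFunction.coe_ofNormedAddCommGroup]
        rw [MeasureTheory.integral_const_mul, mul_left_comm] } 2
    (fun h => (BoundedContinuousFunction.norm_ofNormedAddCommGroup_le _ (norm_nonneg _)
        (abs_expandingSolution_le _ (integral_sechSq_mul_centered h))).trans (norm_centered_le h))

theorem expandingSolution_apply (h : ℝ →ᵇ ℝ) (t : ℝ) : expandingSolution h t =
    Real.cosh t ^ 2 * ∫ s in Set.Iic t, sechSq s * centered h s := rfl

theorem norm_expandingSolution_le (h : ℝ →ᵇ ℝ) : ‖expandingSolution h‖ ≤ 2 * ‖h‖ :=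
  expandingSolution.le_of_opNorm_le (LinearMap.mkContinuous_norm_le _ zero_le_two _) h

theorem hasDerivAt_expanding (h : ℝ →ᵇ ℝ) (t : ℝ) : HasDerivAt (expandingSolution h)
    (2 * Real.tanh t * expandingSolution h t + (h t - sechMean h)) t :=
  hasDerivAt_expandingSolution (centered h) t

theorem tendsto_sechSq_atTop : Tendsto sechSq atTop (𝓝 0) := by
  have h := (tendsto_real_tanh_atTop.pow 2).const_sub 1
  norm_num at h
  exact h.congr fun t => (inv_cosh_sq_eq t).symm

theorem tendsto_sechSq_atBot : Tendsto sechSq atBot (𝓝 0) := by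
  have h := (tendsto_real_tanh_atBot.pow 2).const_sub 1
  norm_num at h
  exact h.congr fun t => (inv_cosh_sq_eq t).symm

/-- `sechSq` solves the adjoint equation, so `sechSq * η` has derivative `sechSq * (h - β)`. Since
`η` is bounded, the boundary terms vanish at both ends: integrating over ℝ gives `β`, and
integrating over `Iic t` gives `η`. -/
theorem eq_expandingSolution {η : ℝ →ᵇ ℝ} {h : ℝ →ᵇ ℝ} {β : ℝ}
    (hd : ∀ t, HasDerivAt η (2 * Real.tanh t * η t + (h t - β)) t) :
    β = sechMean h ∧ η = expandingSolution h := by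
  have hS : ∀ t, HasDerivAt (fun t => sechSq t * η t) (sechSq t * h t - sechSq t * β) t := by
    intro t
    convert! (hasDerivAt_sechSq t).mul (hd t) using 1
    ring
  have hi : Integrable fun t => sechSq t * h t - sechSq t * β :=
    (integrable_sechSq_mul h).sub (integrable_sechSq.mul_const _)
  have hbd : ∀ l : Filter ℝ, Tendsto sechSq l (𝓝 0) →
      Tendsto (fun t => sechSq t * η t) l (𝓝 0) := fun l hl =>
    hl.zero_mul_isBoundedUnder_le ⟨‖η‖, by simpa using Eventually.of_forall η.norm_coe_le_norm⟩
  have htot := integral_of_hasDerivAt_of_tendsto hS hi (hbd _ tendsto_sechSq_atBot)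
    (hbd _ tendsto_sechSq_atTop)
  rw [integral_sub (integrable_sechSq_mul h) (integrable_sechSq.mul_const _), integral_mul_const,
    integral_sechSq] at htot
  have hβ : β = sechMean h := by rw [sechMean_apply]; linarith
  refine ⟨hβ, ?_⟩
  ext t
  have hI := integral_Iic_of_hasDerivAt_of_tendsto' (a := t) (fun x _ => hS x) hi.integrableOn
    (hbd _ tendsto_sechSq_atBot)
  rw [expandingSolution_apply]
  have e : ∀ s, sechSq s * centered h s = sechSq s * h s - sechSq s * β := fun s => by
    rw [centered_apply, hβ]; ring
  simp only [e]
  rw [hI, sub_zero, ← mul_assoc, cosh_sq_mul_sechSq, one_mul]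

end LinearOperators

/-! ### Orbits near the model orbit as fixed points of a contraction. -/

section BoundedOrbits

/-- Pointwise real part. -/
noncomputable def reBdd : (ℝ →ᵇ ℂ) →L[ℝ] (ℝ →ᵇ ℝ) := Complex.reCLM.compLeftContinuousBounded ℝ

/-- Pointwise imaginary part. -/
noncomputable def imBdd : (ℝ →ᵇ ℂ) →L[ℝ] (ℝ →ᵇ ℝ) := Complex.imCLM.compLeftContinuousBounded ℝ

/-- Pointwise inclusion of the reals in the complex numbers. -/
noncomputable def ofRealBdd : (ℝ →ᵇ ℝ) →L[ℝ] (ℝ →ᵇ ℂ) :=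
  Complex.ofRealCLM.compLeftContinuousBounded ℝ

/-- Pointwise inclusion of the reals as the imaginary axis. -/
noncomputable def mulIBdd : (ℝ →ᵇ ℝ) →L[ℝ] (ℝ →ᵇ ℂ) :=
  ((Complex.I • Complex.ofRealCLM : ℝ →L[ℝ] ℂ)).compLeftContinuousBounded ℝ

@[simp] theorem reBdd_apply (g : ℝ →ᵇ ℂ) (t : ℝ) : reBdd g t = (g t).re := rfl
@[simp] theorem imBdd_apply (g : ℝ →ᵇ ℂ) (t : ℝ) : imBdd g t = (g t).im := rfl
@[simp] theorem ofRealBdd_apply (g : ℝ →ᵇ ℝ) (t : ℝ) : ofRealBdd g t = (g t : ℂ) := rfl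
@[simp] theorem mulIBdd_apply (g : ℝ →ᵇ ℝ) (t : ℝ) : mulIBdd g t = Complex.I * (g t : ℂ) := rfl

theorem norm_reBdd_le (g : ℝ →ᵇ ℂ) : ‖reBdd g‖ ≤ ‖g‖ :=
  (BoundedContinuousFunction.norm_le (norm_nonneg _)).2 fun t =>
    (Complex.abs_re_le_norm _).trans (g.norm_coe_le_norm t)

theorem norm_imBdd_le (g : ℝ →ᵇ ℂ) : ‖imBdd g‖ ≤ ‖g‖ :=
  (BoundedContinuousFunction.norm_le (norm_nonneg _)).2 fun t =>
    (Complex.abs_im_le_norm _).trans (g.norm_coe_le_norm t)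

/-- The bounded solution of `ζ' = -2 tanh(t) conj ζ + g - i β`, with `β` the mean of `Im g`. -/
noncomputable def saddleSolution : (ℝ →ᵇ ℂ) →L[ℝ] (ℝ →ᵇ ℂ) :=
  ofRealBdd.comp (contractingSolution.comp reBdd) + mulIBdd.comp (expandingSolution.comp imBdd)

theorem saddleSolution_apply (g : ℝ →ᵇ ℂ) (t : ℝ) : saddleSolution g t =
    (contractingSolution (reBdd g) t : ℂ) + Complex.I * (expandingSolution (imBdd g) t : ℂ) := rfl

theorem norm_saddleSolution_le (g : ℝ →ᵇ ℂ) : ‖saddleSolution g‖ ≤ 3 * ‖g‖ := by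
  refine (BoundedContinuousFunction.norm_le (by positivity)).2 fun t => ?_
  rw [saddleSolution_apply]
  refine (norm_add_le _ _).trans ?_
  rw [norm_mul, Complex.norm_I, one_mul, Complex.norm_real, Complex.norm_real]
  have h1 := (contractingSolution (reBdd g)).norm_coe_le_norm t
  have h2 := (expandingSolution (imBdd g)).norm_coe_le_norm t
  linarith [norm_contractingSolution_le (reBdd g), norm_expandingSolution_le (imBdd g),
    norm_reBdd_le g, norm_imBdd_le g]

theorem hasDerivAt_saddleSolution (g : ℝ →ᵇ ℂ) (t : ℝ) : HasDerivAt (saddleSolution g)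
    (-2 * (Real.tanh t : ℂ) * conj (saddleSolution g t) + g t -
      Complex.I * (sechMean (imBdd g) : ℂ)) t := by
  have h1 := (hasDerivAt_contracting (reBdd g) t).ofReal_comp
  have h2 := ((hasDerivAt_expanding (imBdd g) t).ofReal_comp).const_mul Complex.I
  refine HasDerivAt.congr_deriv (h1.add h2) ?_
  rw [saddleSolution_apply]
  apply Complex.ext <;> simp <;> ring

/-- As `tanh` is real, the equation decouples: the real part is fixed by its value at 0, the
imaginary part together with `β` by boundedness alone. -/
theorem eq_saddleSolution {ζ g : ℝ →ᵇ ℂ} {β : ℝ} (h0 : (ζ 0).re = 0)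
    (h : ∀ t, HasDerivAt ζ (-2 * (Real.tanh t : ℂ) * conj (ζ t) + g t - Complex.I * (β : ℂ)) t) :
    β = sechMean (imBdd g) ∧ ζ = saddleSolution g := by
  have hre : ∀ t, HasDerivAt (reBdd ζ) (-2 * Real.tanh t * reBdd ζ t + reBdd g t) t := fun t => by
    refine HasDerivAt.congr_deriv (Complex.reCLM.hasFDerivAt.comp_hasDerivAt t (h t)) ?_
    simp [-Complex.ofReal_tanh]
  have him : ∀ t, HasDerivAt (imBdd ζ) (2 * Real.tanh t * imBdd ζ t + (imBdd g t - β)) t :=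
    fun t => by
      refine HasDerivAt.congr_deriv (Complex.imCLM.hasFDerivAt.comp_hasDerivAt t (h t)) ?_
      simp [-Complex.ofReal_tanh]; ring
  obtain ⟨hβ, hη⟩ := eq_expandingSolution him
  refine ⟨hβ, ?_⟩
  ext t
  rw [saddleSolution_apply, ← eq_contractingSolution (ξ := reBdd ζ) (by simpa using h0) hre t, ← hη]
  apply Complex.ext <;> simp

/-- A vector field on `ℂ` that is smooth and small in the `C¹` sense. -/
structure IsSmallField (p : ℂ → ℂ) (ε : ℝ) : Prop where
  contDiff : ContDiff ℝ ∞ p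
  norm_le : ∀ z, ‖p z‖ ≤ ε
  norm_fderiv_le : ∀ z, ‖fderiv ℝ p z‖ ≤ ε

theorem IsSmallField.nonneg {p : ℂ → ℂ} {ε : ℝ} (h : IsSmallField p ε) : 0 ≤ ε :=
  (norm_nonneg _).trans (h.norm_le 0)

theorem IsSmallField.mono {p : ℂ → ℂ} {ε ε' : ℝ} (h : IsSmallField p ε) (hε : ε ≤ ε') :
    IsSmallField p ε' :=
  ⟨h.contDiff, fun z => (h.norm_le z).trans hε, fun z => (h.norm_fderiv_le z).trans hε⟩

theorem IsSmallField.differentiable {p : ℂ → ℂ} {ε : ℝ} (h : IsSmallField p ε) :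
    Differentiable ℝ p := h.contDiff.differentiable (by simp)

theorem IsSmallField.norm_sub_le {p : ℂ → ℂ} {ε : ℝ} (h : IsSmallField p ε) (z w : ℂ) :
    ‖p z - p w‖ ≤ ε * ‖z - w‖ :=
  convex_univ.norm_image_sub_le_of_norm_fderiv_le (fun x _ => h.differentiable x)
    (fun x _ => h.norm_fderiv_le x) (Set.mem_univ w) (Set.mem_univ z)

/-- The connecting orbit `t ↦ -tanh t` of the model field `conj z² - 1`. -/
noncomputable def modelOrbit : ℝ →ᵇ ℂ :=
  BoundedContinuousFunction.ofNormedAddCommGroup (fun t => (-(Real.tanh t) : ℂ))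
    (Complex.continuous_ofReal.comp (continuous_iff_continuousAt.2 fun t =>
      (hasDerivAt_real_tanh t).continuousAt)).neg 1 fun t => by
      rw [norm_neg, Complex.norm_real]; exact (Real.abs_tanh_lt_one t).le

@[simp] theorem modelOrbit_apply (t : ℝ) : modelOrbit t = (-(Real.tanh t) : ℂ) := rfl

/-- The point of the unit circle with positive real part and imaginary part `b`. -/
noncomputable def circlePoint (b : ℝ) : ℂ := (Real.sqrt (1 - b ^ 2) : ℂ) + Complex.I * b

/-- The parameter and the deviation from the model orbit as one curve. -/
noncomputable def orbitData (v : ℝ × (ℝ →ᵇ ℂ)) : ℝ →ᵇ ℝ × ℂ × ℂ :=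
  v.1 • BoundedContinuousFunction.const ℝ ((1 : ℝ), (0 : ℂ), (0 : ℂ)) +
    (((ContinuousLinearMap.inr ℝ ℝ (ℂ × ℂ)).comp
      (ContinuousLinearMap.inl ℝ ℂ ℂ)).compLeftContinuousBounded ℝ v.2 +
    ((ContinuousLinearMap.inr ℝ ℝ (ℂ × ℂ)).comp
      (ContinuousLinearMap.inr ℝ ℂ ℂ)).compLeftContinuousBounded ℝ modelOrbit)

theorem orbitData_apply (v : ℝ × (ℝ →ᵇ ℂ)) (t : ℝ) :
    orbitData v t = (v.1, v.2 t, modelOrbit t) := by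
  simp [orbitData]

theorem contDiff_orbitData : ContDiff ℝ ∞ orbitData := by
  unfold orbitData
  exact (contDiff_fst.smul contDiff_const).add
    (((ContinuousLinearMap.contDiff _).comp contDiff_snd).add contDiff_const)

variable {q : ℝ × ℂ → ℂ}

theorem contDiff_orbitForcing (hq : ContDiff ℝ ∞ q) :
    ContDiff ℝ ∞ fun v : ℝ × ℂ × ℂ => conj v.2.1 ^ 2 + q (v.1, v.2.1 + v.2.2) := by
  have h1 : ContDiff ℝ ∞ fun v : ℝ × ℂ × ℂ => conj v.2.1 :=
    Complex.conjCLE.contDiff.comp (contDiff_fst.comp contDiff_snd)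
  exact (h1.pow 2).add (hq.comp (contDiff_fst.prodMk
    ((contDiff_fst.comp contDiff_snd).add (contDiff_snd.comp contDiff_snd))))

/-- The inhomogeneity `conj ζ² + q(σ, ζ - tanh)`. -/
noncomputable def forcing (hq : ContDiff ℝ ∞ q) (v : ℝ × (ℝ →ᵇ ℂ)) : ℝ →ᵇ ℂ :=
  superposition _ (contDiff_orbitForcing hq).continuous (orbitData v)

theorem forcing_apply (hq : ContDiff ℝ ∞ q) (v : ℝ × (ℝ →ᵇ ℂ)) (t : ℝ) :
    forcing hq v t = conj (v.2 t) ^ 2 + q (v.1, v.2 t + modelOrbit t) := by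
  rw [forcing, superposition_apply, orbitData_apply]

theorem contDiff_forcing (hq : ContDiff ℝ ∞ q) : ContDiff ℝ ∞ (forcing hq) :=
  (contDiff_superposition (contDiff_orbitForcing hq) _).comp contDiff_orbitData

/-- The imaginary part of the parameter selected by solvability. -/
noncomputable def forcingMean (hq : ContDiff ℝ ∞ q) (v : ℝ × (ℝ →ᵇ ℂ)) : ℝ :=
  sechMean (imBdd (forcing hq v))

theorem contDiff_forcingMean (hq : ContDiff ℝ ∞ q) : ContDiff ℝ ∞ (forcingMean hq) :=
  sechMean.contDiff.comp (imBdd.contDiff.comp (contDiff_forcing hq))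

/-- The map whose fixed points are the bounded orbits near the model orbit. -/
noncomputable def orbitMap (hq : ContDiff ℝ ∞ q) (v : ℝ × (ℝ →ᵇ ℂ)) : ℝ →ᵇ ℂ :=
  saddleSolution (forcing hq v + (1 - Real.sqrt (1 - forcingMean hq v ^ 2)) •
    BoundedContinuousFunction.const ℝ (1 : ℂ))

theorem contDiffAt_orbitMap (hq : ContDiff ℝ ∞ q) {v : ℝ × (ℝ →ᵇ ℂ)}
    (hv : |forcingMean hq v| < 1) : ContDiffAt ℝ ∞ (orbitMap hq) v := by
  have h1 : 1 - forcingMean hq v ^ 2 ≠ 0 := by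
    have := (sq_lt_one_iff_abs_lt_one _).2 hv
    linarith
  have h2 : ContDiffAt ℝ ∞ (fun v => 1 - Real.sqrt (1 - forcingMean hq v ^ 2)) v :=
    contDiffAt_const.sub
      ((contDiffAt_const.sub ((contDiff_forcingMean hq).contDiffAt.pow 2)).sqrt h1)
  exact saddleSolution.contDiff.contDiffAt.comp v
    ((contDiff_forcing hq).contDiffAt.add (h2.smul contDiffAt_const))

/-- Difference of squares: both roots are at least `1/2`, so their sum is at least 1, while `|b + c|
≤ 1`. -/
theorem sub_mem_circlePoint_re {b c : ℝ} (hb : |b| ≤ 1 / 2) (hc : |c| ≤ 1 / 2) :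
    |Real.sqrt (1 - b ^ 2) - Real.sqrt (1 - c ^ 2)| ≤ |b - c| := by
  have key : ∀ x : ℝ, |x| ≤ 1 / 2 → 1 / 2 ≤ Real.sqrt (1 - x ^ 2) ∧
      Real.sqrt (1 - x ^ 2) ^ 2 = 1 - x ^ 2 := fun x hx => by
    have := abs_le.1 hx
    exact ⟨Real.le_sqrt_of_sq_le (by nlinarith), Real.sq_sqrt (by nlinarith)⟩
  obtain ⟨hb1, hb2⟩ := key b hb
  obtain ⟨hc1, hc2⟩ := key c hc
  set B := Real.sqrt (1 - b ^ 2)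
  set C := Real.sqrt (1 - c ^ 2)
  have h1 : (B - C) * (B + C) = (c - b) * (b + c) := by linear_combination hb2 - hc2
  have h2 : |B - C| * (B + C) = |b - c| * |b + c| := by
    rw [← abs_of_nonneg (show 0 ≤ B + C by linarith), ← abs_mul, h1, abs_mul, abs_sub_comm]
  have h3 : |b + c| ≤ 1 := (abs_add_le _ _).trans (by linarith)
  nlinarith [abs_nonneg (B - C), abs_nonneg (b - c)]

theorem one_sub_sqrt_le {b : ℝ} (hb : |b| ≤ 1 / 2) : |1 - Real.sqrt (1 - b ^ 2)| ≤ |b| := by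
  have := sub_mem_circlePoint_re (b := 0) (c := b) (by norm_num) hb
  simpa using this

section Estimates

variable {σ ε : ℝ} (hq : ContDiff ℝ ∞ q) (hσ : IsSmallField (fun z => q (σ, z)) ε)
  (hε : ε ≤ 1 / 1000)

include hσ in
-- The quadratic term has Lipschitz constant `2 · 1/32` on the ball, the perturbation has `ε`.
theorem norm_forcing_sub_le {ζ η : ℝ →ᵇ ℂ} (hζ : ‖ζ‖ ≤ 1 / 32) (hη : ‖η‖ ≤ 1 / 32) :
    ‖forcing hq (σ, ζ) - forcing hq (σ, η)‖ ≤ (1 / 16 + ε) * ‖ζ - η‖ := by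
  have hε0 := hσ.nonneg
  refine (BoundedContinuousFunction.norm_le (by positivity)).2 fun t => ?_
  rw [BoundedContinuousFunction.sub_apply, forcing_apply, forcing_apply]
  have e : conj (ζ t) ^ 2 + q (σ, ζ t + modelOrbit t) -
      (conj (η t) ^ 2 + q (σ, η t + modelOrbit t)) =
      conj ((ζ t - η t) * (ζ t + η t)) +
        (q (σ, ζ t + modelOrbit t) - q (σ, η t + modelOrbit t)) := by
    rw [map_mul, map_sub, map_add]; ring
  simp only [e]
  have h1 := hσ.norm_sub_le (ζ t + modelOrbit t) (η t + modelOrbit t)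
  rw [add_sub_add_right_eq_sub] at h1
  have h2 : ‖ζ t - η t‖ ≤ ‖ζ - η‖ := (ζ - η).norm_coe_le_norm t
  have h3 : ‖ζ t + η t‖ ≤ 1 / 16 := (norm_add_le _ _).trans (by
    linarith [ζ.norm_coe_le_norm t, η.norm_coe_le_norm t])
  refine (norm_add_le _ _).trans ?_
  rw [Complex.norm_conj, norm_mul, add_mul, mul_comm (1 / 16 : ℝ)]
  gcongr
  exact h1.trans (by gcongr)

include hσ in
theorem norm_forcing_zero_le : ‖forcing hq (σ, 0)‖ ≤ ε := by
  refine (BoundedContinuousFunction.norm_le hσ.nonneg).2 fun t => ?_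
  rw [forcing_apply]
  simpa using hσ.norm_le (-(Real.tanh t) : ℂ)

include hσ hε in
theorem abs_forcingMean_le {ζ : ℝ →ᵇ ℂ} (hζ : ‖ζ‖ ≤ 1 / 32) :
    |forcingMean hq (σ, ζ)| ≤ 1 / 200 := by
  have h1 := norm_sechMean_le (imBdd (forcing hq (σ, ζ)))
  have h2 := norm_imBdd_le (forcing hq (σ, ζ))
  have h3 : ‖forcing hq (σ, ζ)‖ ≤ 1 / 1024 + ε := by
    have := hσ.nonneg
    refine (BoundedContinuousFunction.norm_le (by positivity)).2 fun t => ?_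
    rw [forcing_apply]
    refine (norm_add_le _ _).trans (add_le_add ?_ (hσ.norm_le _))
    rw [norm_pow, Complex.norm_conj]
    have := (ζ.norm_coe_le_norm t).trans hζ
    calc ‖ζ t‖ ^ 2 ≤ (1 / 32) ^ 2 := by gcongr
      _ = 1 / 1024 := by norm_num
  unfold forcingMean
  linarith

include hσ hε in
-- The real part of the parameter varies no faster than the forcing, so the input of
-- `saddleSolution` varies at most twice as fast. With its norm bound 3 the Lipschitz constant is at
-- most `6 (1/16 + 1/1000) < 1/2`.
theorem norm_orbitMap_sub_le {ζ η : ℝ →ᵇ ℂ} (hζ : ‖ζ‖ ≤ 1 / 32) (hη : ‖η‖ ≤ 1 / 32) :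
    ‖orbitMap hq (σ, ζ) - orbitMap hq (σ, η)‖ ≤ 1 / 2 * ‖ζ - η‖ := by
  have h1 := norm_forcing_sub_le hq hσ hζ hη
  have hb := abs_forcingMean_le hq hσ hε hζ
  have hc := abs_forcingMean_le hq hσ hε hη
  have h2 := sub_mem_circlePoint_re (hc.trans (by norm_num)) (hb.trans (by norm_num))
  have h3 : |forcingMean hq (σ, η) - forcingMean hq (σ, ζ)| ≤
      ‖forcing hq (σ, ζ) - forcing hq (σ, η)‖ := by
    rw [abs_sub_comm, forcingMean, forcingMean, ← map_sub, ← map_sub]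
    exact (norm_sechMean_le _).trans (norm_imBdd_le _)
  rw [orbitMap, orbitMap, ← map_sub, add_sub_add_comm, ← sub_smul, sub_sub_sub_cancel_left]
  refine (norm_saddleSolution_le _).trans ?_
  have h4 := norm_add_le (forcing hq (σ, ζ) - forcing hq (σ, η))
    ((Real.sqrt (1 - forcingMean hq (σ, η) ^ 2) - Real.sqrt (1 - forcingMean hq (σ, ζ) ^ 2)) •
      BoundedContinuousFunction.const ℝ (1 : ℂ))
  have h5 : ‖(BoundedContinuousFunction.const ℝ (1 : ℂ))‖ ≤ 1 := by
    simp
  rw [norm_smul, Real.norm_eq_abs] at h4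
  have h6 := mul_le_mul_of_nonneg_left h5
    (abs_nonneg (Real.sqrt (1 - forcingMean hq (σ, η) ^ 2) -
      Real.sqrt (1 - forcingMean hq (σ, ζ) ^ 2)))
  have h7 : (1 / 16 + ε) * ‖ζ - η‖ ≤ (1 / 16 + 1 / 1000) * ‖ζ - η‖ := by gcongr
  linarith [norm_nonneg (ζ - η)]

include hσ hε in
theorem norm_orbitMap_zero_le : ‖orbitMap hq (σ, 0)‖ ≤ 6 * ε := by
  have h1 := norm_forcing_zero_le hq hσ
  have hb := abs_forcingMean_le hq hσ hε (ζ := 0) (by simp)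
  have h2 := one_sub_sqrt_le (hb.trans (by norm_num))
  have h3 : |forcingMean hq (σ, 0)| ≤ ε :=
    ((norm_sechMean_le _).trans (norm_imBdd_le _)).trans h1
  refine (norm_saddleSolution_le _).trans ?_
  have h4 := norm_add_le (forcing hq (σ, 0)) ((1 - Real.sqrt (1 - forcingMean hq (σ, 0) ^ 2)) •
      BoundedContinuousFunction.const ℝ (1 : ℂ))
  have h5 : ‖(BoundedContinuousFunction.const ℝ (1 : ℂ))‖ ≤ 1 := by
    simp
  rw [norm_smul, Real.norm_eq_abs] at h4
  have h6 := mul_le_mul_of_nonneg_left h5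
    (abs_nonneg (1 - Real.sqrt (1 - forcingMean hq (σ, 0) ^ 2)))
  linarith

include hσ hε in
theorem exists_fixedPoint_orbitMap :
    ∃ ζ ∈ Metric.ball (0 : ℝ →ᵇ ℂ) (1 / 32), orbitMap hq (σ, ζ) = ζ :=
  exists_fixedPoint_ball (η := 6 * ε) (by linarith [hσ.nonneg]) (by linarith)
    (fun x hx y hy => norm_orbitMap_sub_le hq hσ hε (by simpa using (mem_ball_zero_iff.1 hx).le)
      (by simpa using (mem_ball_zero_iff.1 hy).le)) (norm_orbitMap_zero_le hq hσ hε)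

include hσ hε in
theorem eq_of_fixedPoint_orbitMap {ζ η : ℝ →ᵇ ℂ} (hζ : ‖ζ‖ ≤ 1 / 32) (hη : ‖η‖ ≤ 1 / 32)
    (h1 : orbitMap hq (σ, ζ) = ζ) (h2 : orbitMap hq (σ, η) = η) : ζ = η := by
  have := norm_orbitMap_sub_le hq hσ hε hζ hη
  rw [h1, h2] at this
  exact sub_eq_zero.1 (norm_le_zero_iff.1 (by linarith [norm_nonneg (ζ - η)]))

end Estimates

theorem hasDerivAt_modelOrbit (t : ℝ) :
    HasDerivAt modelOrbit ((Real.tanh t : ℂ) ^ 2 - 1) t := by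
  refine HasDerivAt.congr_deriv (hasDerivAt_real_tanh t).ofReal_comp.neg ?_
  rw [inv_cosh_sq_eq]; push_cast; ring

/-- Fixed points of `orbitMap` are orbits. -/
theorem hasDerivAt_of_fixedPoint (hq : ContDiff ℝ ∞ q) {σ : ℝ} {ζ : ℝ →ᵇ ℂ}
    (h : orbitMap hq (σ, ζ) = ζ) (t : ℝ) :
    HasDerivAt (fun t => ζ t + modelOrbit t) (conj (ζ t + modelOrbit t) ^ 2 -
      circlePoint (forcingMean hq (σ, ζ)) + q (σ, ζ t + modelOrbit t)) t := by
  have h1 := hasDerivAt_saddleSolution (forcing hq (σ, ζ) +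
    (1 - Real.sqrt (1 - forcingMean hq (σ, ζ) ^ 2)) • BoundedContinuousFunction.const ℝ (1 : ℂ)) t
  rw [← orbitMap, h] at h1
  refine HasDerivAt.congr_deriv (h1.add (hasDerivAt_modelOrbit t)) ?_
  have e : imBdd (forcing hq (σ, ζ) + (1 - Real.sqrt (1 - forcingMean hq (σ, ζ) ^ 2)) •
      BoundedContinuousFunction.const ℝ (1 : ℂ)) = imBdd (forcing hq (σ, ζ)) := by
    ext s; simp
  rw [e, ← forcingMean, BoundedContinuousFunction.add_apply, forcing_apply, circlePoint]
  simp only [BoundedContinuousFunction.coe_smul, BoundedContinuousFunction.const_apply,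
    modelOrbit_apply, map_add, map_neg, Complex.conj_ofReal, Complex.real_smul]
  push_cast
  ring

/-- Orbits near the model orbit are fixed points of `orbitMap`. -/
theorem fixedPoint_of_hasDerivAt (hq : ContDiff ℝ ∞ q) {σ b : ℝ} {ζ : ℝ →ᵇ ℂ}
    (h0 : (ζ 0).re = 0)
    (h : ∀ t, HasDerivAt (fun t => ζ t + modelOrbit t) (conj (ζ t + modelOrbit t) ^ 2 -
      circlePoint b + q (σ, ζ t + modelOrbit t)) t) :
    b = forcingMean hq (σ, ζ) ∧ orbitMap hq (σ, ζ) = ζ := by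
  have hζ : ∀ t, HasDerivAt ζ (-2 * (Real.tanh t : ℂ) * conj (ζ t) + (forcing hq (σ, ζ) +
      (1 - Real.sqrt (1 - b ^ 2)) • BoundedContinuousFunction.const ℝ (1 : ℂ)) t -
      Complex.I * (b : ℂ)) t := by
    intro t
    have h1 := (h t).sub (hasDerivAt_modelOrbit t)
    have e : (fun t => ζ t + modelOrbit t) - modelOrbit = ζ := by
      ext s; simp
    rw [e] at h1
    refine h1.congr_deriv ?_
    rw [BoundedContinuousFunction.add_apply, forcing_apply, circlePoint]
    simp only [BoundedContinuousFunction.coe_smul, BoundedContinuousFunction.const_apply,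
      modelOrbit_apply, map_add, map_neg, Complex.conj_ofReal, Complex.real_smul]
    push_cast
    ring
  obtain ⟨hb, hfix⟩ := eq_saddleSolution h0 hζ
  have e : imBdd (forcing hq (σ, ζ) + (1 - Real.sqrt (1 - b ^ 2)) •
      BoundedContinuousFunction.const ℝ (1 : ℂ)) = imBdd (forcing hq (σ, ζ)) := by
    ext s; simp
  rw [e, ← forcingMean] at hb
  refine ⟨hb, ?_⟩
  rw [orbitMap, ← hb]
  exact hfix.symm

/-- The parameter at which a connecting orbit exists depends smoothly on the scale. -/
theorem exists_smooth_fixedPoint (hq : ContDiff ℝ ∞ q) {U : Set ℝ} (hU : IsOpen U) {ε : ℝ}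
    (hε : ε ≤ 1 / 1000) (hsmall : ∀ σ ∈ U, IsSmallField (fun z => q (σ, z)) ε) :
    ∃ z : ℝ → ℝ →ᵇ ℂ, (∀ σ ∈ U, ‖z σ‖ ≤ 1 / 32 ∧ orbitMap hq (σ, z σ) = z σ) ∧
      ∀ σ ∈ U, ContDiffAt ℝ ∞ (fun σ => forcingMean hq (σ, z σ)) σ := by
  have hex : ∀ σ, ∃ ζ : ℝ →ᵇ ℂ, σ ∈ U →
      ζ ∈ Metric.ball (0 : ℝ →ᵇ ℂ) (1 / 32) ∧ orbitMap hq (σ, ζ) = ζ := fun σ => by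
    by_cases hσ : σ ∈ U
    · obtain ⟨ζ, h1, h2⟩ := exists_fixedPoint_orbitMap hq (hsmall σ hσ) hε
      exact ⟨ζ, fun _ => ⟨h1, h2⟩⟩
    · exact ⟨0, fun h => (hσ h).elim⟩
  choose z hz using hex
  refine ⟨z, fun σ hσ => ⟨(mem_ball_zero_iff.1 (hz σ hσ).1).le, (hz σ hσ).2⟩, fun σ hσ => ?_⟩
  have hzs : ContDiffAt ℝ ∞ z σ := by
    refine contDiffAt_fixedPoint (T := orbitMap hq) hU (ρ := 1 / 32) ?_ ?_ hz hσ
    · intro s hs x hx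
      refine contDiffAt_orbitMap hq ?_
      have := abs_forcingMean_le hq (hsmall s hs) hε (mem_ball_zero_iff.1 hx).le
      linarith
    · intro s hs x hx y hy
      exact norm_orbitMap_sub_le hq (hsmall s hs) hε (mem_ball_zero_iff.1 hx).le
        (mem_ball_zero_iff.1 hy).le
  exact (contDiff_forcingMean hq).contDiffAt.comp σ (contDiffAt_id.prodMk hzs)

end BoundedOrbits

/-! ### Connecting orbits, cones, and algebra of the two zeros. -/

section Connections

/-- The vector field `conj z² - x + p(z)`, for `p = 0` the gradient of the elliptic umbilic. -/
noncomputable def umbilicField (p : ℂ → ℂ) (x z : ℂ) : ℂ := conj z ^ 2 - x + p z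

/-- `γ` is an orbit of the vector field `umbilicField p x` joining distinct zeros. -/
structure IsConnection (p : ℂ → ℂ) (x : ℂ) (γ : ℝ → ℂ) (s₁ s₂ : ℂ) : Prop where
  ne : s₁ ≠ s₂
  zero_left : umbilicField p x s₁ = 0
  zero_right : umbilicField p x s₂ = 0
  hasDerivAt : ∀ t, HasDerivAt γ (umbilicField p x (γ t)) t
  tendsto_atBot : Tendsto γ atBot (𝓝 s₁)
  tendsto_atTop : Tendsto γ atTop (𝓝 s₂)

theorem hasDerivAt_comp_neg {E : Type*} [NormedAddCommGroup E] [NormedSpace ℝ E] {f : ℝ → E}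
    {f' : E} {t : ℝ} (h : HasDerivAt f f' (-t)) : HasDerivAt (fun s => f (-s)) (-f') t := by
  exact (h.scomp t (hasDerivAt_neg t)).congr_deriv (by simp)

/-- The cone of complex numbers with small argument. -/
def InCone (η : ℝ) (z : ℂ) : Prop := |z.im| ≤ η * z.re

theorem InCone.re_nonneg {η : ℝ} {z : ℂ} (hη : 0 < η) (h : InCone η z) : 0 ≤ z.re :=
  nonneg_of_mul_nonneg_right ((abs_nonneg _).trans h) hη

/-- With `P = z.re * w.re`, the imaginary part of the product is at most `2ηP` and the real part at
least `(1 - η²)P ≥ 3/4 P`, so the factor 3 suffices. -/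
theorem InCone.mul {η : ℝ} {z w : ℂ} (hη : 0 < η) (hη1 : η ≤ 1 / 2) (hz : InCone η z)
    (hw : InCone η w) : InCone (3 * η) (z * w) := by
  have hz0 := hz.re_nonneg hη
  have hw0 := hw.re_nonneg hη
  have h1 : |z.im * w.re| ≤ η * (z.re * w.re) := by
    rw [abs_mul, abs_of_nonneg hw0, ← mul_assoc]; exact mul_le_mul_of_nonneg_right hz hw0
  have h2 : |z.re * w.im| ≤ η * (z.re * w.re) := by
    rw [abs_mul, abs_of_nonneg hz0, mul_left_comm]; exact mul_le_mul_of_nonneg_left hw hz0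
  have h3 : |z.im * w.im| ≤ η * (η * (z.re * w.re)) := by
    rw [abs_mul]
    calc _ ≤ (η * z.re) * (η * w.re) :=
          mul_le_mul hz hw (abs_nonneg _) (by positivity)
      _ = _ := by ring
  have hP : 0 ≤ z.re * w.re := by positivity
  set P := z.re * w.re
  unfold InCone
  rw [Complex.mul_im, Complex.mul_re]
  have h4 := (abs_le.1 h3).2
  have h5 := abs_add_le (z.re * w.im) (z.im * w.re)
  have h6 : η * (η * P) ≤ 1 / 2 * (1 / 2 * P) := by gcongr
  nlinarith

theorem InCone.conj {η : ℝ} {z : ℂ} (h : InCone η z) : InCone η (conj z) := by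
  simpa [InCone] using h

theorem InCone.add {η : ℝ} {z w : ℂ} (hz : InCone η z) (hw : InCone η w) : InCone η (z + w) := by
  unfold InCone at *
  rw [Complex.add_im, Complex.add_re, mul_add]
  exact (abs_add_le _ _).trans (add_le_add hz hw)

theorem InCone.smul {η r : ℝ} {z : ℂ} (hr : 0 ≤ r) (hz : InCone η z) : InCone η ((r : ℂ) * z) := by
  unfold InCone at *
  rw [Complex.re_ofReal_mul, Complex.im_ofReal_mul, abs_mul, abs_of_nonneg hr, mul_left_comm]
  exact mul_le_mul_of_nonneg_left hz hr

/-- Write `w = X + iY`. The imaginary part of `w³/3 - w` is `-Y(1 - X² + Y²/3)`. For `X ≥ 0` the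
real part of `w³/3 - w + 2/3` is at most `(1 - X)²(X + 2)/3 ≤ (1 - X)²`, so the first cone gives
`|Y|(1 - X²) ≤ κ(1 - X)²`. For `X ≤ 0` the second cone is used symmetrically. -/
theorem abs_im_le_of_inCone {κ : ℝ} {w : ℂ} (hκ : 0 < κ) (hX : |w.re| < 1)
    (h1 : InCone κ (w ^ 3 / 3 - w + 2 / 3)) (h2 : InCone κ (2 / 3 - (w ^ 3 / 3 - w))) :
    |w.im| ≤ κ := by
  obtain ⟨X, Y⟩ := w
  have e1 : ((⟨X, Y⟩ : ℂ) ^ 3 / 3 - (⟨X, Y⟩ : ℂ)).re = X ^ 3 / 3 - X * Y ^ 2 - X := by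
    have : ((⟨X, Y⟩ : ℂ) ^ 3 / 3 - (⟨X, Y⟩ : ℂ)) =
      ((1 / 3 : ℝ) : ℂ) * ((⟨X, Y⟩ : ℂ) * ⟨X, Y⟩ * ⟨X, Y⟩) - (⟨X, Y⟩ : ℂ) := by push_cast; ring
    rw [this, Complex.sub_re, Complex.re_ofReal_mul]; simp; ring
  have e2 : ((⟨X, Y⟩ : ℂ) ^ 3 / 3 - (⟨X, Y⟩ : ℂ)).im = -(Y * (1 - X ^ 2 + Y ^ 2 / 3)) := by
    have : ((⟨X, Y⟩ : ℂ) ^ 3 / 3 - (⟨X, Y⟩ : ℂ)) =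
      ((1 / 3 : ℝ) : ℂ) * ((⟨X, Y⟩ : ℂ) * ⟨X, Y⟩ * ⟨X, Y⟩) - (⟨X, Y⟩ : ℂ) := by push_cast; ring
    rw [this, Complex.sub_im, Complex.im_ofReal_mul]; simp; ring
  have e3 : ((2 : ℂ) / 3).re = 2 / 3 ∧ ((2 : ℂ) / 3).im = 0 := by
    have : (2 : ℂ) / 3 = ((2 / 3 : ℝ) : ℂ) := by push_cast; ring
    rw [this]; simp
  unfold InCone at h1 h2
  rw [Complex.add_re, Complex.add_im, e1, e2, e3.1, e3.2] at h1
  rw [Complex.sub_re, Complex.sub_im, e1, e2, e3.1, e3.2] at h2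
  simp only [add_zero, zero_sub, neg_neg, abs_neg, abs_mul] at h1 h2 hX ⊢
  obtain ⟨ha, hb⟩ := abs_lt.1 hX
  have hpos : 0 ≤ 1 - X ^ 2 + Y ^ 2 / 3 := by nlinarith [sq_nonneg Y]
  rw [abs_of_nonneg hpos] at h1 h2
  have hY := abs_nonneg Y
  have hYY : 0 ≤ |Y| * (Y ^ 2 / 3) := by positivity
  rcases le_total 0 X with h | h
  · have h3 : κ * (X ^ 3 / 3 - X * Y ^ 2 - X + 2 / 3) ≤ κ * (1 - X) ^ 2 := by
      refine mul_le_mul_of_nonneg_left ?_ hκ.le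
      nlinarith [mul_nonneg h (sq_nonneg Y), mul_nonneg (sq_nonneg (1 - X)) (sub_nonneg.2 hb.le)]
    have h4 : (1 - X) * (|Y| * (1 + X)) ≤ (1 - X) * (κ * (1 - X)) := by nlinarith
    have h5 := le_of_mul_le_mul_left h4 (by linarith)
    nlinarith
  · have h3 : κ * (2 / 3 - (X ^ 3 / 3 - X * Y ^ 2 - X)) ≤ κ * (1 + X) ^ 2 := by
      refine mul_le_mul_of_nonneg_left ?_ hκ.le
      nlinarith [mul_nonneg (neg_nonneg.2 h) (sq_nonneg Y),
        mul_nonneg (sq_nonneg (1 + X)) (show 0 ≤ 1 + X by linarith)]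
    have h4 : (1 + X) * (|Y| * (1 - X)) ≤ (1 + X) * (κ * (1 + X)) := by nlinarith
    have h5 := le_of_mul_le_mul_left h4 (by linarith)
    nlinarith

/-- On the line `Re w = 1` the real part of the cone element is `-Y²`, so `Y = 0`. This makes the
line a barrier that an orbit can meet only at the zero itself. -/
theorem eq_one_of_inCone {κ : ℝ} {w : ℂ} (hκ : 0 < κ) (hX : w.re = 1)
    (h : InCone κ (w ^ 3 / 3 - w + 2 / 3)) : w = 1 := by
  obtain ⟨X, Y⟩ := w
  simp only at hX
  subst hX
  have e0 : ((⟨1, Y⟩ : ℂ) ^ 3 / 3 - (⟨1, Y⟩ : ℂ) + 2 / 3) =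
      ((1 / 3 : ℝ) : ℂ) * ((⟨1, Y⟩ : ℂ) * ⟨1, Y⟩ * ⟨1, Y⟩) - (⟨1, Y⟩ : ℂ) + ((2 / 3 : ℝ) : ℂ) := by
    push_cast; ring
  have e1 : ((⟨1, Y⟩ : ℂ) ^ 3 / 3 - (⟨1, Y⟩ : ℂ) + 2 / 3).re = -Y ^ 2 := by
    rw [e0, Complex.add_re, Complex.sub_re, Complex.re_ofReal_mul]; simp; ring
  unfold InCone at h
  rw [e1] at h
  have h2 := (abs_nonneg _).trans h
  have : Y = 0 := by
    have : Y ^ 2 ≤ 0 := by nlinarith [sq_nonneg Y]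
    exact pow_eq_zero_iff two_ne_zero |>.1 (le_antisymm this (sq_nonneg Y))
  subst this; rfl

theorem eq_neg_one_of_inCone {κ : ℝ} {w : ℂ} (hκ : 0 < κ) (hX : w.re = -1)
    (h : InCone κ (2 / 3 - (w ^ 3 / 3 - w))) : w = -1 := by
  have := eq_one_of_inCone (w := -w) hκ (by simp [hX]) (by convert! h using 1; ring)
  rw [← this, neg_neg]

/-- An orbit of a field that is dominated by the distance to `s` on the orbit avoids `s`. -/
theorem orbit_eq_of_eq_of_norm_deriv_le {γ γ' : ℝ → ℂ} {s : ℂ} {K : ℝ → ℝ} (hK : Continuous K)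
    (hd : ∀ t, HasDerivAt γ (γ' t) t) (hb : ∀ t, ‖γ' t‖ ≤ K t * ‖γ t - s‖) {t₀ : ℝ}
    (h0 : γ t₀ = s) {t : ℝ} (ht : t₀ ≤ t) : γ t = s := by
  obtain ⟨C, hC⟩ := (isCompact_Icc (a := t₀) (b := t)).exists_bound_of_continuousOn hK.continuousOn
  have hd' : ∀ t, HasDerivAt (fun t => γ t - s) (γ' t) t := fun t => (hd t).sub_const s
  have := eq_zero_of_abs_deriv_le_mul_abs_self_of_eq_zero_right (f := fun t => γ t - s) (f' := γ')
    (K := C) (a := t₀) (b := t) (fun u _ => (hd' u).continuousAt.continuousWithinAt)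
    (fun u _ => (hd' u).hasDerivWithinAt) (by simp [h0])
    (fun u hu => (hb u).trans (mul_le_mul_of_nonneg_right
      ((le_abs_self _).trans (hC u ⟨hu.1, hu.2.le⟩)) (norm_nonneg _))) t ⟨ht, le_rfl⟩
  exact sub_eq_zero.1 this

variable {p : ℂ → ℂ} {x s₁ s₂ : ℂ} {γ : ℝ → ℂ} {ε : ℝ}

/-- Subtracting the two zero equations gives `conj ((s₁ - s₂)(s₁ + s₂)) = p s₂ - p s₁`; the
Lipschitz bound for `p` then allows division by `s₁ - s₂`. -/
theorem norm_add_zeros_le (hp : IsSmallField p ε) (hne : s₁ ≠ s₂) (h1 : umbilicField p x s₁ = 0)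
    (h2 : umbilicField p x s₂ = 0) : ‖s₁ + s₂‖ ≤ ε := by
  unfold umbilicField at h1 h2
  have e : conj ((s₁ - s₂) * (s₁ + s₂)) = p s₂ - p s₁ := by
    rw [map_mul, map_sub, map_add]
    linear_combination h1 - h2
  have h := hp.norm_sub_le s₂ s₁
  rw [← e, Complex.norm_conj, norm_mul, norm_sub_rev s₂, mul_comm] at h
  exact le_of_mul_le_mul_right h (norm_pos_iff.2 (sub_ne_zero.2 hne))

/-- The conjugate of the field is the polynomial with roots `s₁, s₂` up to an error that vanishes at
`s₁`, not merely a small one. This keeps the comparison valid near the zeros. -/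
theorem norm_conj_field_sub_le (hp : IsSmallField p ε) (hs : ‖s₁ + s₂‖ ≤ ε)
    (h1 : umbilicField p x s₁ = 0) (z : ℂ) :
    ‖conj (umbilicField p x z) - (z - s₁) * (z - s₂)‖ ≤ 2 * ε * ‖z - s₁‖ := by
  have e : conj (umbilicField p x z) - (z - s₁) * (z - s₂) =
      (z - s₁) * (s₁ + s₂) + conj (p z - p s₁) := by
    have h1' : conj (umbilicField p x s₁) = 0 := by rw [h1, map_zero]
    unfold umbilicField at *
    simp only [map_add, map_sub, map_pow, Complex.conj_conj] at *
    linear_combination h1'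
  rw [e]
  refine (norm_add_le _ _).trans ?_
  rw [Complex.norm_conj, norm_mul]
  have := hp.norm_sub_le z s₁
  have := mul_le_mul_of_nonneg_left hs (norm_nonneg (z - s₁))
  linarith

/-- Average the two zero equations: the half-difference is an approximate root of `conj c ^ 2 = x`.
-/
theorem norm_sq_sub_le (hp : IsSmallField p ε) (hε : ε ≤ 1) (hs : ‖s₁ + s₂‖ ≤ ε)
    (h1 : umbilicField p x s₁ = 0) (h2 : umbilicField p x s₂ = 0) :
    ‖conj ((s₁ - s₂) / 2) ^ 2 - x‖ ≤ 2 * ε := by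
  have e : conj ((s₁ - s₂) / 2) ^ 2 - x = -((p s₁ + p s₂) / 2 + conj (s₁ + s₂) ^ 2 / 4) := by
    unfold umbilicField at *
    simp only [map_add, map_sub, map_div₀, Complex.conj_ofNat]
    linear_combination (h1 + h2) / 2
  rw [e, norm_neg]
  refine (norm_add_le _ _).trans ?_
  have h3 := norm_add_le (p s₁) (p s₂)
  have h4 := hp.norm_le s₁
  have h5 := hp.norm_le s₂
  have h6 := hp.nonneg
  rw [norm_div, norm_div, norm_pow, Complex.norm_conj]
  have : ‖s₁ + s₂‖ ^ 2 ≤ ε := by nlinarith [norm_nonneg (s₁ + s₂)]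
  norm_num
  linarith

end Connections

/-! ### Confinement of connecting orbits to the segment between their limits. -/

section Confinement

/-- The cone is the intersection of the half-planes `η Re ± Im ≥ 0`, so a derivative in the cone
makes both functionals monotone. Increments up to the limits at `±∞` then lie in the cone too. -/
theorem monotone_of_derivative_inCone {M M' : ℝ → ℂ} {η : ℝ} (hM : ∀ t, HasDerivAt M (M' t) t)
    (h : ∀ t, InCone η (M' t)) :
    Monotone (fun t => η * (M t).re - (M t).im) ∧ Monotone (fun t => η * (M t).re + (M t).im) := by
  have hre : ∀ t, HasDerivAt (fun t => (M t).re) (M' t).re t := fun t =>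
    Complex.reCLM.hasFDerivAt.comp_hasDerivAt t (hM t)
  have him : ∀ t, HasDerivAt (fun t => (M t).im) (M' t).im t := fun t =>
    Complex.imCLM.hasFDerivAt.comp_hasDerivAt t (hM t)
  constructor
  · refine monotone_of_hasDerivAt_nonneg (fun t => ((hre t).const_mul η).sub (him t)) fun t => ?_
    have := (abs_le.1 (h t)).2
    simp only [Pi.zero_apply]; linarith
  · refine monotone_of_hasDerivAt_nonneg (fun t => ((hre t).const_mul η).add (him t)) fun t => ?_
    have := (abs_le.1 (h t)).1
    simp only [Pi.zero_apply]; linarith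

theorem tendsto_re_im_combination {M : ℝ → ℂ} {L : ℂ} {l : Filter ℝ} (η : ℝ)
    (h : Tendsto M l (𝓝 L)) :
    Tendsto (fun t => η * (M t).re - (M t).im) l (𝓝 (η * L.re - L.im)) ∧
      Tendsto (fun t => η * (M t).re + (M t).im) l (𝓝 (η * L.re + L.im)) := by
  have hre := (Complex.continuous_re.tendsto L).comp h
  have him := (Complex.continuous_im.tendsto L).comp h
  exact ⟨(hre.const_mul η).sub him, (hre.const_mul η).add him⟩

theorem inCone_limit_sub {M M' : ℝ → ℂ} {η : ℝ} {L : ℂ} (hM : ∀ t, HasDerivAt M (M' t) t)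
    (h : ∀ t, InCone η (M' t)) (hL : Tendsto M atTop (𝓝 L)) (t : ℝ) : InCone η (L - M t) := by
  obtain ⟨h1, h2⟩ := monotone_of_derivative_inCone hM h
  obtain ⟨h3, h4⟩ := tendsto_re_im_combination η hL
  have h5 := h1.ge_of_tendsto h3 t
  have h6 := h2.ge_of_tendsto h4 t
  unfold InCone
  rw [Complex.sub_im, Complex.sub_re, abs_le]
  constructor <;> linarith

theorem inCone_sub_limit {M M' : ℝ → ℂ} {η : ℝ} {L : ℂ} (hM : ∀ t, HasDerivAt M (M' t) t)
    (h : ∀ t, InCone η (M' t)) (hL : Tendsto M atBot (𝓝 L)) (t : ℝ) : InCone η (M t - L) := by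
  obtain ⟨h1, h2⟩ := monotone_of_derivative_inCone hM h
  obtain ⟨h3, h4⟩ := tendsto_re_im_combination η hL
  have h5 := h1.le_of_tendsto h3 t
  have h6 := h2.le_of_tendsto h4 t
  unfold InCone
  rw [Complex.sub_im, Complex.sub_re, abs_le]
  constructor <;> linarith

theorem inCone_mul_conj_add {P r : ℂ} {ε : ℝ} (hε : 0 ≤ ε) (hε1 : ε ≤ 1 / 12)
    (hr : ‖r‖ ≤ 3 * ε * ‖P‖) : InCone (4 * ε) (P * conj (P + r)) := by
  have e : P * conj (P + r) = ((‖P‖ ^ 2 : ℝ) : ℂ) + P * conj r := by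
    rw [map_add, mul_add, Complex.mul_conj']; push_cast; rfl
  have h1 : ‖P * conj r‖ ≤ 3 * ε * ‖P‖ ^ 2 := by
    rw [norm_mul, Complex.norm_conj]
    calc _ ≤ ‖P‖ * (3 * ε * ‖P‖) := by gcongr
      _ = _ := by ring
  unfold InCone
  rw [e, Complex.add_im, Complex.add_re, Complex.ofReal_im, Complex.ofReal_re, zero_add]
  have h2 := (Complex.abs_im_le_norm (P * conj r)).trans h1
  have h3 := (abs_le.1 ((Complex.abs_re_le_norm (P * conj r)).trans h1)).1
  have h4 : 0 ≤ ‖P‖ ^ 2 := by positivity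
  have h5 : 4 * ε * (‖P‖ ^ 2 + -(3 * ε * ‖P‖ ^ 2)) ≤
    4 * ε * (‖P‖ ^ 2 + (P * conj r).re) := by gcongr
  have h6 : ε * (ε * ‖P‖ ^ 2) ≤ 1 / 12 * (ε * ‖P‖ ^ 2) := by gcongr
  linarith

/-- Multiplying by `conj a` turns the product into `‖a‖² b`; `InCone.mul` accounts for the factor 3.
-/
theorem inCone_of_mul {a b : ℂ} {η : ℝ} (hη : 0 < η) (hη1 : η ≤ 1 / 2) (ha : a ≠ 0)
    (hac : InCone η a) (h : InCone η (a * b)) : InCone (3 * η) b := by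
  have h1 := (hac.conj.mul hη hη1 h).smul (r := (‖a‖ ^ 2)⁻¹) (by positivity)
  have h2 : (‖a‖ : ℂ) ≠ 0 := by simpa using ha
  convert! h1 using 1
  rw [← mul_assoc (conj a), mul_comm (conj a), Complex.mul_conj']
  push_cast
  field_simp

variable {p : ℂ → ℂ} {x s₁ s₂ : ℂ} {γ : ℝ → ℂ} {ε : ℝ}

theorem IsConnection.norm_half_sub (hp : IsSmallField p ε) (hε : ε ≤ 1 / 100) (hx : ‖x‖ = 1)
    (h : IsConnection p x γ s₁ s₂) : |‖(s₁ - s₂) / 2‖ ^ 2 - 1| ≤ 2 * ε := by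
  have hs := norm_add_zeros_le hp h.ne h.zero_left h.zero_right
  have h1 := norm_sq_sub_le hp (by linarith) hs h.zero_left h.zero_right
  have h2 := abs_norm_sub_norm_le (conj ((s₁ - s₂) / 2) ^ 2) x
  rw [norm_pow, Complex.norm_conj, hx] at h2
  linarith

/-- Use the error bound at the nearer zero. The farther one is at distance at least `9/10`, which
turns `2ε` times one distance into `3ε` times the product. -/
theorem IsConnection.norm_remainder_le (hp : IsSmallField p ε) (hε : ε ≤ 1 / 100) (hx : ‖x‖ = 1)
    (h : IsConnection p x γ s₁ s₂) (z : ℂ) :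
    ‖conj (umbilicField p x z) - (z - s₁) * (z - s₂)‖ ≤ 3 * ε * ‖(z - s₁) * (z - s₂)‖ := by
  have hs := norm_add_zeros_le hp h.ne h.zero_left h.zero_right
  have h1 := norm_conj_field_sub_le hp hs h.zero_left z
  have h2 := norm_conj_field_sub_le hp (by rwa [add_comm]) h.zero_right (s₂ := s₁) z
  rw [mul_comm (z - s₂)] at h2
  have hc := (abs_le.1 (h.norm_half_sub hp hε hx)).1
  have hε0 := hp.nonneg
  have hc2 : 9 / 10 ≤ ‖(s₁ - s₂) / 2‖ := by
    by_contra! hlt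
    nlinarith [norm_nonneg ((s₁ - s₂) / 2)]
  rw [norm_div, Complex.norm_ofNat] at hc2
  have h3 : ‖s₁ - s₂‖ ≤ ‖z - s₁‖ + ‖z - s₂‖ := by
    have := norm_sub_le (z - s₂) (z - s₁)
    rw [sub_sub_sub_cancel_left] at this
    linarith
  rw [norm_mul]
  have ha := norm_nonneg (z - s₁)
  have hb := norm_nonneg (z - s₂)
  rcases le_total ‖z - s₁‖ ‖z - s₂‖ with h4 | h4
  · refine h1.trans ?_
    have : ε * ‖z - s₁‖ * (9 / 10) ≤ ε * ‖z - s₁‖ * ‖z - s₂‖ := by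
      gcongr; linarith
    nlinarith [mul_nonneg hε0 ha]
  · refine h2.trans ?_
    have : ε * ‖z - s₂‖ * (9 / 10) ≤ ε * ‖z - s₂‖ * ‖z - s₁‖ := by
      gcongr; linarith
    nlinarith [mul_nonneg hε0 hb]

theorem IsConnection.continuous (h : IsConnection p x γ s₁ s₂) : Continuous γ :=
  continuous_iff_continuousAt.2 fun t => (h.hasDerivAt t).continuousAt

/-- The field is dominated by the distance to `s₁`, so an orbit reaching `s₁` would stay there and
could not tend to `s₂`. For `s₂` the same argument runs with time reversed. -/
theorem IsConnection.ne_left (hp : IsSmallField p ε) (h : IsConnection p x γ s₁ s₂) (t : ℝ) :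
    γ t ≠ s₁ := by
  intro ht
  have hs := norm_add_zeros_le hp h.ne h.zero_left h.zero_right
  have hall : ∀ u, t ≤ u → γ u = s₁ := fun u hu =>
    orbit_eq_of_eq_of_norm_deriv_le (K := fun t => ‖γ t - s₂‖ + 2 * ε)
      ((h.continuous.sub continuous_const).norm.add continuous_const) h.hasDerivAt (fun t => by
        have h1 := norm_conj_field_sub_le hp hs h.zero_left (γ t)
        have h2 := norm_le_norm_add_norm_sub' (conj (umbilicField p x (γ t)))
          ((γ t - s₁) * (γ t - s₂))
        rw [Complex.norm_conj, norm_mul] at h2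
        linarith) ht hu
  refine h.ne (tendsto_nhds_unique ?_ h.tendsto_atTop)
  refine tendsto_const_nhds.congr' ?_
  filter_upwards [eventually_ge_atTop t] with u hu using (hall u hu).symm

theorem IsConnection.ne_right (hp : IsSmallField p ε) (h : IsConnection p x γ s₁ s₂) (t : ℝ) :
    γ t ≠ s₂ := by
  intro ht
  have hs := norm_add_zeros_le hp h.ne h.zero_left h.zero_right
  have hc : Continuous fun t => γ (-t) := h.continuous.comp continuous_neg
  have hall : ∀ u, -t ≤ u → γ (-u) = s₂ := fun u hu =>
    orbit_eq_of_eq_of_norm_deriv_le (γ := fun t => γ (-t)) (K := fun t => ‖γ (-t) - s₁‖ + 2 * ε)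
      ((hc.sub continuous_const).norm.add continuous_const)
      (fun t => hasDerivAt_comp_neg (h.hasDerivAt (-t))) (fun t => by
        have h1 := norm_conj_field_sub_le hp (by rwa [add_comm]) h.zero_right (s₂ := s₁) (γ (-t))
        have h2 := norm_le_norm_add_norm_sub' (conj (umbilicField p x (γ (-t))))
          ((γ (-t) - s₂) * (γ (-t) - s₁))
        rw [Complex.norm_conj, norm_mul] at h2
        rw [norm_neg]
        linarith) (by simpa using ht) hu
  refine h.ne (tendsto_nhds_unique h.tendsto_atBot ?_)
  refine tendsto_const_nhds.congr' ?_
  filter_upwards [eventually_le_atBot t] with u hu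
  simpa using (hall (-u) (by linarith)).symm

/-- A connecting orbit stays close to the segment between its limits, and the cube of the
half-difference of the limits is nearly a positive real number. -/
theorem IsConnection.confined (hp : IsSmallField p ε) (hε0 : 0 < ε) (hε : ε ≤ 1 / 100)
    (hx : ‖x‖ = 1) (h : IsConnection p x γ s₁ s₂) :
    InCone (4 * ε) (((s₁ - s₂) / 2) ^ 3) ∧
      ∀ t, |((γ t - (s₁ + s₂) / 2) / ((s₁ - s₂) / 2)).re| < 1 ∧
        |((γ t - (s₁ + s₂) / 2) / ((s₁ - s₂) / 2)).im| ≤ 12 * ε := by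
  set c := (s₁ - s₂) / 2 with hc
  set m := (s₁ + s₂) / 2 with hm
  have hc0 : c ≠ 0 := by simpa [hc] using sub_ne_zero.2 h.ne
  have hs1 : s₁ = m + c := by rw [hm, hc]; ring
  have hs2 : s₂ = m - c := by rw [hm, hc]; ring
  set w : ℝ → ℂ := fun t => (γ t - m) / c with hw
  -- `w` is the affine coordinate taking `s₁, s₂` to `1, -1`, and `M` is a primitive of `(γ - s₁)(γ
  -- - s₂) γ'`. Since `γ'` is nearly the conjugate of `(γ - s₁)(γ - s₂)`, the derivative of `M` is
  -- nearly a nonnegative real.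
  set M : ℝ → ℂ := fun t => c ^ 3 * (w t ^ 3 / 3 - w t) with hM
  have hMc : Continuous fun z : ℂ => c ^ 3 * (((z - m) / c) ^ 3 / 3 - (z - m) / c) := by fun_prop
  have hwd : ∀ t, HasDerivAt w (umbilicField p x (γ t) / c) t := fun t =>
    ((h.hasDerivAt t).sub_const m).div_const c
  have hMd : ∀ t, HasDerivAt M ((γ t - s₁) * (γ t - s₂) * umbilicField p x (γ t)) t := by
    intro t
    refine HasDerivAt.congr_deriv (((((hwd t).pow 3).div_const 3).sub (hwd t)).const_mul _) ?_
    rw [hs1, hs2]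
    simp only [hw, Nat.cast_ofNat]
    norm_num
    field_simp
    ring
  have hcone : ∀ t, InCone (4 * ε) ((γ t - s₁) * (γ t - s₂) * umbilicField p x (γ t)) := by
    intro t
    have := inCone_mul_conj_add hε0.le (by linarith) (h.norm_remainder_le hp hε hx (γ t))
    rwa [add_sub_cancel, Complex.conj_conj] at this
  have hbot : Tendsto M atBot (𝓝 (-(c ^ 3 * (2 / 3)))) := by
    have := (hMc.tendsto s₁).comp h.tendsto_atBot
    convert! this using 2
    rw [hs1]; field_simp; ring
  have htop : Tendsto M atTop (𝓝 (c ^ 3 * (2 / 3))) := by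
    have := (hMc.tendsto s₂).comp h.tendsto_atTop
    convert! this using 2
    rw [hs2]; field_simp; ring
  have hA := inCone_sub_limit hMd hcone hbot
  have hB := inCone_limit_sub hMd hcone htop
  -- The total increment of `M` is `4/3 c³`, whence the factor `3/4`.
  have hc3 : InCone (4 * ε) (c ^ 3) := by
    have := ((hA 0).add (hB 0)).smul (r := 3 / 4) (by norm_num)
    convert! this using 1
    push_cast; ring
  have hη : 0 < 4 * ε := by positivity
  have hη1 : 4 * ε ≤ 1 / 2 := by linarith
  have hA' : ∀ t, InCone (12 * ε) (w t ^ 3 / 3 - w t + 2 / 3) := fun t => by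
    have := inCone_of_mul hη hη1 (pow_ne_zero 3 hc0) hc3 (b := w t ^ 3 / 3 - w t + 2 / 3)
      (by convert! hA t using 1; simp only [hM]; ring)
    convert! this using 1; ring
  have hB' : ∀ t, InCone (12 * ε) (2 / 3 - (w t ^ 3 / 3 - w t)) := fun t => by
    have := inCone_of_mul hη hη1 (pow_ne_zero 3 hc0) hc3 (b := 2 / 3 - (w t ^ 3 / 3 - w t))
      (by convert! hB t using 1; simp only [hM]; ring)
    convert! this using 1; ring
  have hκ : 0 < 12 * ε := by positivity
  have hw1 : ∀ t, (w t).re ≠ 1 := fun t ht => by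
    have := eq_one_of_inCone hκ ht (hA' t)
    refine h.ne_left hp t ?_
    rw [hs1]
    simp only [hw] at this
    rw [div_eq_one_iff_eq hc0] at this
    rw [← this]; ring
  have hw2 : ∀ t, (w t).re ≠ -1 := fun t ht => by
    have := eq_neg_one_of_inCone hκ ht (hB' t)
    refine h.ne_right hp t ?_
    rw [hs2]
    simp only [hw] at this
    rw [div_eq_iff hc0] at this
    linear_combination this
  have hwc : Continuous fun t => (w t).re := Complex.continuous_re.comp
    (continuous_iff_continuousAt.2 fun t => (hwd t).continuousAt)
  have hXc : Continuous fun z : ℂ => ((z - m) / c).re := by fun_prop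
  have hXbot : Tendsto (fun t => (w t).re) atBot (𝓝 1) := by
    have := (hXc.tendsto s₁).comp h.tendsto_atBot
    convert! this using 2
    rw [hs1]; simp [hc0]
  have hXtop : Tendsto (fun t => (w t).re) atTop (𝓝 (-1)) := by
    have := (hXc.tendsto s₂).comp h.tendsto_atTop
    convert! this using 2
    rw [hs2, sub_sub_cancel_left, neg_div, div_self hc0]; simp
  -- `Re w` runs from 1 to -1 and takes neither value, so leaving the interval would contradict the
  -- intermediate value theorem.
  have hlt : ∀ t, |(w t).re| < 1 := by
    intro t
    by_contra! hge
    rcases le_abs.1 hge with h1 | h1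
    · obtain ⟨a, ha⟩ := (hXtop.eventually (eventually_le_nhds (show (-1 : ℝ) < 1 by norm_num))).exists
      obtain ⟨u, hu⟩ := mem_range_of_exists_le_of_exists_ge hwc ⟨a, ha⟩ ⟨t, h1⟩
      exact hw1 u hu
    · obtain ⟨a, ha⟩ := (hXbot.eventually (eventually_ge_nhds (show (-1 : ℝ) < 1 by norm_num))).exists
      obtain ⟨u, hu⟩ := mem_range_of_exists_le_of_exists_ge hwc ⟨t, by linarith⟩ ⟨a, ha⟩
      exact hw2 u hu
  exact ⟨hc3, fun t => ⟨hlt t, abs_im_le_of_inCone hκ (hlt t) (hA' t) (hB' t)⟩⟩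

end Confinement

/-! ### Cube roots of unity. -/

section CubeRoots

/-- A primitive cube root of unity. -/
noncomputable def primitiveCubeRoot : ℂ := ⟨-1 / 2, Real.sqrt 3 / 2⟩

/-- The cube roots of unity. -/
noncomputable def cubeRoot (j : Fin 3) : ℂ := ![1, primitiveCubeRoot, conj primitiveCubeRoot] j

theorem primitiveCubeRoot_mul_conj : primitiveCubeRoot * conj primitiveCubeRoot = 1 := by
  have h := Real.mul_self_sqrt (show (0 : ℝ) ≤ 3 by norm_num)
  apply Complex.ext <;> simp [primitiveCubeRoot] <;> nlinarith

theorem primitiveCubeRoot_add_conj : primitiveCubeRoot + conj primitiveCubeRoot = -1 := by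
  apply Complex.ext <;> simp [primitiveCubeRoot]

theorem pow_three_sub_one_eq (c : ℂ) :
    c ^ 3 - 1 = (c - cubeRoot 0) * (c - cubeRoot 1) * (c - cubeRoot 2) := by
  simp only [cubeRoot, Matrix.cons_val]
  linear_combination (c ^ 2 - c) * primitiveCubeRoot_add_conj +
    (1 - c) * primitiveCubeRoot_mul_conj

theorem cubeRoot_pow (j : Fin 3) : cubeRoot j ^ 3 = 1 := by
  rw [← sub_eq_zero, pow_three_sub_one_eq]
  fin_cases j <;> simp

theorem norm_cubeRoot (j : Fin 3) : ‖cubeRoot j‖ = 1 :=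
  Complex.norm_eq_one_of_pow_eq_one (cubeRoot_pow j) three_ne_zero

theorem cubeRoot_ne_zero (j : Fin 3) : cubeRoot j ≠ 0 := by
  rw [← norm_pos_iff, norm_cubeRoot]; exact one_pos

/-- `c³ - 1` is the product of the distances to the three roots, up to modulus; if all exceeded `d`,
the product would exceed `d³`. -/
theorem exists_cubeRoot_near {c : ℂ} {d : ℝ} (h : ‖c ^ 3 - 1‖ ≤ d ^ 3) :
    ∃ j, ‖c - cubeRoot j‖ ≤ d := by
  by_contra! hlt
  rcases le_total 0 d with hd | hd
  · rw [pow_three_sub_one_eq, norm_mul, norm_mul] at h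
    have h1 : d * d * d < ‖c - cubeRoot 0‖ * ‖c - cubeRoot 1‖ * ‖c - cubeRoot 2‖ := by
      have h01 : d * d < ‖c - cubeRoot 0‖ * ‖c - cubeRoot 1‖ :=
        mul_lt_mul'' (hlt 0) (hlt 1) hd hd
      exact mul_lt_mul'' h01 (hlt 2) (by positivity) hd
    nlinarith
  · have h1 : c ^ 3 - 1 = 0 := by
      have : d ^ 3 ≤ 0 := Odd.pow_nonpos_iff (by decide) |>.2 hd
      exact norm_le_zero_iff.1 (h.trans this)
    rcases hd.lt_or_eq with h2 | h2
    · have : d ^ 3 < 0 := Odd.pow_neg_iff (by decide) |>.2 h2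
      linarith [norm_nonneg (c ^ 3 - 1)]
    · rw [pow_three_sub_one_eq, mul_eq_zero, mul_eq_zero] at h1
      rcases h1 with (h1 | h1) | h1
      · have := hlt 0; rw [h1] at this; simp [h2] at this
      · have := hlt 1; rw [h1] at this; simp [h2] at this
      · have := hlt 2; rw [h1] at this; simp [h2] at this

end CubeRoots

/-! ### Scaling and threefold rotational symmetry of the family. -/

section Rescaling

theorem IsSmallField.rescale {p : ℂ → ℂ} {ε K : ℝ} (hp : IsSmallField p ε) {a b : ℂ}
    (ha : ‖a‖ ≤ K) (hab : ‖a‖ * ‖b‖ ≤ K) : IsSmallField (fun z => a * p (b * z)) (K * ε) := by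
  have hε := hp.nonneg
  refine ⟨contDiff_const.mul (hp.contDiff.comp (contDiff_const.mul contDiff_id)), fun z => ?_,
    fun z => ?_⟩
  · rw [norm_mul]
    exact mul_le_mul ha (hp.norm_le _) (norm_nonneg _) ((norm_nonneg _).trans ha)
  · have hK : 0 ≤ K := (norm_nonneg _).trans ha
    refine norm_fderiv_le_of_lip' ℝ (by positivity) (Eventually.of_forall fun w => ?_)
    rw [← mul_sub, norm_mul]
    have h1 := hp.norm_sub_le (b * w) (b * z)
    rw [← mul_sub, norm_mul] at h1
    calc ‖a‖ * ‖p (b * w) - p (b * z)‖ ≤ ‖a‖ * (ε * (‖b‖ * ‖w - z‖)) := by gcongr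
      _ = (‖a‖ * ‖b‖) * (ε * ‖w - z‖) := by ring
      _ ≤ K * (ε * ‖w - z‖) := by gcongr
      _ = _ := by ring

/-- The field `p` in coordinates rescaled by `l` and rotated by `u`. -/
noncomputable def rescaledField (p : ℂ → ℂ) (l : ℝ) (u z : ℂ) : ℂ :=
  ((l : ℂ) ^ 2 * u)⁻¹ * p (l * u * z)

/-- For a cube root of unity `conj u ^ 2 = u`, so `conj z ^ 2` and `x` acquire the same factor `l²
u`. -/
theorem umbilicField_rescaledField {p : ℂ → ℂ} {x u : ℂ} {l : ℝ} (hl : l ≠ 0) (hu : u ^ 3 = 1)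
    (z : ℂ) : umbilicField (rescaledField p l u) (((l : ℂ) ^ 2 * u)⁻¹ * x) ((l * u)⁻¹ * z) =
      ((l : ℂ) ^ 2 * u)⁻¹ * umbilicField p x z := by
  have hl' : (l : ℂ) ≠ 0 := by exact_mod_cast hl
  have hu0 : u ≠ 0 := by rintro rfl; norm_num at hu
  have hconj : conj u = u⁻¹ :=
    (Complex.inv_eq_conj (Complex.norm_eq_one_of_pow_eq_one hu three_ne_zero)).symm
  have e : (l : ℂ) * u * ((l * u)⁻¹ * z) = z := by field_simp
  unfold umbilicField rescaledField
  rw [e, map_mul, map_inv₀, map_mul, hconj, Complex.conj_ofReal]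
  field_simp
  linear_combination (conj z ^ 2) * hu

/-- Positions scale by `l` and velocities by `l²`, so time is rescaled by `l⁻¹`. -/
theorem IsConnection.rescale {p : ℂ → ℂ} {x s₁ s₂ u : ℂ} {γ : ℝ → ℂ} {l : ℝ} (hl : 0 < l)
    (hu : u ^ 3 = 1) (h : IsConnection p x γ s₁ s₂) :
    IsConnection (rescaledField p l u) (((l : ℂ) ^ 2 * u)⁻¹ * x)
      (fun t => ((l : ℂ) * u)⁻¹ * γ (l⁻¹ * t)) (((l : ℂ) * u)⁻¹ * s₁) (((l : ℂ) * u)⁻¹ * s₂) := by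
  have hl' : (l : ℂ) ≠ 0 := by exact_mod_cast hl.ne'
  have hu0 : u ≠ 0 := by rintro rfl; norm_num at hu
  refine ⟨?_, ?_, ?_, fun t => ?_, ?_, ?_⟩
  · rw [Ne, mul_right_inj' (inv_ne_zero (mul_ne_zero hl' hu0))]
    exact h.ne
  · rw [umbilicField_rescaledField hl.ne' hu, h.zero_left, mul_zero]
  · rw [umbilicField_rescaledField hl.ne' hu, h.zero_right, mul_zero]
  · rw [umbilicField_rescaledField hl.ne' hu]
    have h1 : HasDerivAt (fun t => γ (l⁻¹ * t)) (l⁻¹ • umbilicField p x (γ (l⁻¹ * t))) t := by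
      exact ((h.hasDerivAt (l⁻¹ * t)).scomp t ((hasDerivAt_id t).const_mul l⁻¹)).congr_deriv
        (by simp)
    refine (h1.const_mul ((l : ℂ) * u)⁻¹).congr_deriv ?_
    rw [Complex.real_smul]
    push_cast
    field_simp
  · exact (h.tendsto_atBot.comp (tendsto_id.const_mul_atBot (inv_pos.2 hl))).const_mul _
  · exact (h.tendsto_atTop.comp (tendsto_id.const_mul_atTop (inv_pos.2 hl))).const_mul _

theorem rescaledField_rescaledField {p : ℂ → ℂ} {l k : ℝ} {u τ : ℂ} :
    rescaledField (rescaledField p l u) k τ = rescaledField p (l * k) (u * τ) := by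
  ext z
  unfold rescaledField
  rw [← mul_assoc, ← mul_inv]
  push_cast
  congr 2
  · ring
  · ring_nf

theorem rescaledField_one {p : ℂ → ℂ} : rescaledField p 1 1 = p := by
  ext z; simp [rescaledField]

end Rescaling

/-! ### Comparison for the perturbed Riccati equation. -/

section Riccati

/-- First `A ≤ 0`, since at `A = 0` the derivative is negative. The deviation `ξ = A + tanh`
satisfies `ξ' = ξ (A - tanh) + e`, where `A - tanh ≤ 0` damps it, and `±K tanh` are barriers: where
`ξ = K tanh` one has `ξ' ≤ -K tanh² + e < K (1 - tanh²)`. -/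
theorem abs_add_tanh_le_of_nonneg {A e : ℝ → ℝ} {E K : ℝ} (hE : ∀ t, |e t| ≤ E) (hEK : E < K)
    (hK : K ≤ 1) (h0 : A 0 = 0) (hA : ∀ t, HasDerivAt A (A t ^ 2 - 1 + e t) t) {t : ℝ}
    (ht : 0 ≤ t) : |A t + Real.tanh t| ≤ K := by
  have hc : Continuous A := continuous_iff_continuousAt.2 fun t => (hA t).continuousAt
  have hneg : ∀ s, 0 ≤ s → A s ≤ 0 := fun s hs =>
    image_le_of_deriv_right_lt_deriv_boundary (f := A) (a := 0) (b := s) (B := fun _ => 0)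
      (B' := fun _ => 0) hc.continuousOn (fun v _ => (hA v).hasDerivWithinAt) h0.le
      (fun u => hasDerivAt_const u _) (fun u _ hu => by
        have := (abs_le.1 (hE u)).2
        rw [hu]; linarith) ⟨hs, le_rfl⟩
  have hξ : ∀ s, HasDerivAt (fun s => A s + Real.tanh s)
      (A s ^ 2 - 1 + e s + (1 - Real.tanh s ^ 2)) s := fun s => by
    have := (hA s).add (hasDerivAt_real_tanh s)
    rwa [inv_cosh_sq_eq] at this
  have hξc : Continuous fun s => A s + Real.tanh s :=
    continuous_iff_continuousAt.2 fun t => (hξ t).continuousAt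
  have hB : ∀ s, HasDerivAt (fun s => K * Real.tanh s) (K * (1 - Real.tanh s ^ 2)) s := fun s => by
    have := (hasDerivAt_real_tanh s).const_mul K
    rwa [inv_cosh_sq_eq] at this
  have hK0 : 0 < K := ((abs_nonneg _).trans (hE 0)).trans_lt hEK
  have hup : A t + Real.tanh t ≤ K * Real.tanh t :=
    image_le_of_deriv_right_lt_deriv_boundary (f := fun s => A s + Real.tanh s) (a := 0) (b := t)
      hξc.continuousOn (fun u _ => (hξ u).hasDerivWithinAt) (by simp [h0]) hB (fun u hu hEq => by
        have h1 := (abs_le.1 (hE u)).2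
        have h2 := hneg u hu.1
        have h3 := real_tanh_nonneg hu.1
        have h4 : A u * (A u + Real.tanh u) ≤ 0 := by
          rw [hEq]; exact mul_nonpos_of_nonpos_of_nonneg h2 (by positivity)
        nlinarith) ⟨ht, le_rfl⟩
  have hlo : -(A t + Real.tanh t) ≤ K * Real.tanh t :=
    image_le_of_deriv_right_lt_deriv_boundary (f := fun s => -(A s + Real.tanh s)) (a := 0) (b := t)
      hξc.neg.continuousOn (fun u _ => (hξ u).neg.hasDerivWithinAt) (by simp [h0]) hB
      (fun u hu hEq => by
        have h1 := (abs_le.1 (hE u)).1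
        have h2 := hneg u hu.1
        have h3 := real_tanh_nonneg hu.1
        have h4 : A u * -(A u + Real.tanh u) ≤ 0 := by
          rw [hEq]; exact mul_nonpos_of_nonpos_of_nonneg h2 (by positivity)
        nlinarith) ⟨ht, le_rfl⟩
  have h5 : K * Real.tanh t ≤ K := by
    have := Real.tanh_lt_one t
    nlinarith
  rw [abs_le]; constructor <;> linarith

/-- A perturbed Riccati equation stays near the heteroclinic solution. -/
theorem abs_add_tanh_le {A e : ℝ → ℝ} {E K : ℝ} (hE : ∀ t, |e t| ≤ E) (hEK : E < K)
    (hK : K ≤ 1) (h0 : A 0 = 0) (hA : ∀ t, HasDerivAt A (A t ^ 2 - 1 + e t) t) (t : ℝ) :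
    |A t + Real.tanh t| ≤ K := by
  rcases le_total 0 t with ht | ht
  · exact abs_add_tanh_le_of_nonneg hE hEK hK h0 hA ht
  · have := abs_add_tanh_le_of_nonneg (A := fun t => -A (-t)) (e := fun t => e (-t))
      (fun t => hE (-t)) hEK hK (by simp [h0]) (fun t => by
        refine (hasDerivAt_comp_neg (hA (-t))).neg.congr_deriv ?_
        ring) (t := -t) (by linarith)
    rw [neg_neg, Real.tanh_neg, ← neg_add, abs_neg] at this
    exact this

end Riccati

/-! ### A priori estimate: every connection is close to a rotated model orbit. -/

section APriori

variable {p : ℂ → ℂ} {x s₁ s₂ : ℂ} {γ : ℝ → ℂ} {ε : ℝ}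

/-- `c³` lies in a cone of opening `4ε` and has modulus within `7ε` of 1, so it is within `17ε` of
1. The bound on `ε` is chosen so that `17ε ≤ (1/1000)³`. -/
theorem IsConnection.exists_cubeRoot_near (hp : IsSmallField p ε) (hε0 : 0 < ε)
    (hε : ε ≤ 1 / 10 ^ 11) (hx : ‖x‖ = 1) (h : IsConnection p x γ s₁ s₂) :
    ∃ j, ‖(s₁ - s₂) / 2 - cubeRoot j‖ ≤ 1 / 1000 := by
  have hε' : ε ≤ 1 / 100 := hε.trans (by norm_num)
  obtain ⟨hcone, -⟩ := h.confined hp hε0 hε' hx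
  have hN := abs_le.1 (h.norm_half_sub hp hε' hx)
  set c := (s₁ - s₂) / 2
  refine _root_.exists_cubeRoot_near ?_
  set N := ‖c‖
  have hN0 : 0 ≤ N := norm_nonneg _
  have hre := hcone.re_nonneg (by positivity)
  have h1 : (c ^ 3).re ≤ N ^ 3 := by
    rw [← norm_pow]; exact Complex.re_le_norm _
  have h2 : N ^ 3 ≤ |(c ^ 3).re| + |(c ^ 3).im| := by
    rw [← norm_pow]; exact Complex.norm_le_abs_re_add_abs_im _
  rw [abs_of_nonneg hre] at h2
  unfold InCone at hcone
  have h3 : N ≤ 1 + 2 * ε := by nlinarith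
  have h4 : 1 - 2 * ε ≤ N := by nlinarith
  have h5 : N ^ 3 ≤ 1 + 7 * ε := by
    have : N ^ 3 = N * N ^ 2 := by ring
    rw [this]
    nlinarith
  have h6 : 1 - 7 * ε ≤ N ^ 3 := by
    have : N ^ 3 = N * N ^ 2 := by ring
    rw [this]
    nlinarith
  have h7 : |(c ^ 3).im| ≤ 5 * ε := by nlinarith
  have h8 : ‖c ^ 3 - 1‖ ≤ |(c ^ 3).re - 1| + |(c ^ 3).im| := by
    have := Complex.norm_le_abs_re_add_abs_im (c ^ 3 - 1)
    rwa [Complex.sub_re, Complex.sub_im, Complex.one_re, Complex.one_im, sub_zero] at this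
  have h9 : |(c ^ 3).re - 1| ≤ 12 * ε := by
    rw [abs_le]; constructor <;> linarith
  norm_num at hε ⊢
  linarith

/-- After rotation by a cube root of unity and translation of time, a connecting orbit is close
to the model orbit. -/
theorem IsConnection.near_modelOrbit (hp : IsSmallField p ε) (hε0 : 0 < ε)
    (hε : ε ≤ 1 / 10 ^ 11) (hx : ‖x‖ = 1) (h : IsConnection p x γ s₁ s₂) :
    ∃ (j : Fin 3) (t₀ : ℝ), 0 < ((cubeRoot j)⁻¹ * x).re ∧ ((cubeRoot j)⁻¹ * γ t₀).re = 0 ∧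
      ∀ t, ‖(cubeRoot j)⁻¹ * γ (t + t₀) + (Real.tanh t : ℂ)‖ ≤ 1 / 32 := by
  have hε' : ε ≤ 1 / 100 := hε.trans (by norm_num)
  have hε2 : ε ≤ 1 / 10 ^ 6 := hε.trans (by norm_num)
  obtain ⟨j, hj⟩ := h.exists_cubeRoot_near hp hε0 hε hx
  have hs := norm_add_zeros_le hp h.ne h.zero_left h.zero_right
  have hsq := norm_sq_sub_le hp (by linarith) hs h.zero_left h.zero_right
  have hconf := (h.confined hp hε0 hε' hx).2
  set u := cubeRoot j
  have hu : u ^ 3 = 1 := cubeRoot_pow j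
  have hu0 : u ≠ 0 := cubeRoot_ne_zero j
  have hun : ‖u‖ = 1 := norm_cubeRoot j
  have hconj : conj u = u⁻¹ := (Complex.inv_eq_conj hun).symm
  set c := (s₁ - s₂) / 2 with hc
  set m := (s₁ + s₂) / 2 with hm
  have hc0 : c ≠ 0 := by simpa [hc] using sub_ne_zero.2 h.ne
  have hmn : ‖m‖ ≤ ε := by
    rw [hm, norm_div, Complex.norm_ofNat]; linarith [norm_nonneg (s₁ + s₂)]
  -- `x` is nearly `conj c ^ 2`, hence nearly `conj u ^ 2 = u`.
  have hxu : ‖u⁻¹ * x - 1‖ ≤ 3 / 1000 := by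
    have e : u⁻¹ * x - 1 = u⁻¹ * (conj ((c - u) * ((c - u) + 2 * u)) - (conj c ^ 2 - x)) := by
      simp only [map_mul, map_sub, map_add, hconj, Complex.conj_ofNat]
      field_simp
      linear_combination -hu
    rw [e, norm_mul, norm_inv, hun, inv_one, one_mul]
    refine (norm_sub_le _ _).trans ?_
    rw [Complex.norm_conj, norm_mul]
    have h1 : ‖c - u + 2 * u‖ ≤ 1 / 1000 + 2 := by
      refine (norm_add_le _ _).trans ?_
      rw [norm_mul, hun, Complex.norm_ofNat]; linarith
    have h2 : ‖c - u‖ * ‖c - u + 2 * u‖ ≤ 1 / 1000 * (1 / 1000 + 2) := by gcongr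
    linarith
  have hnear : ∀ t, ∃ X : ℝ, |X| < 1 ∧ ‖u⁻¹ * γ t - X‖ ≤ 3 / 1000 := by
    intro t
    obtain ⟨h1, h2⟩ := hconf t
    set w := (γ t - m) / c with hw
    refine ⟨w.re, h1, ?_⟩
    have hγ : γ t = m + c * w := by rw [hw]; field_simp; ring
    have e : u⁻¹ * γ t - w.re = u⁻¹ * (m + (c - u) * w) + Complex.I * w.im := by
      have := Complex.re_add_im w
      rw [hγ]
      field_simp
      linear_combination -u * this
    have hwn : ‖w‖ ≤ 2 := (Complex.norm_le_abs_re_add_abs_im w).trans (by linarith)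
    rw [e]
    refine (norm_add_le _ _).trans ?_
    rw [norm_mul, norm_mul, norm_inv, hun, Complex.norm_I, Complex.norm_real, Real.norm_eq_abs,
      inv_one, one_mul, one_mul]
    have h3 := norm_add_le m ((c - u) * w)
    rw [norm_mul] at h3
    have h4 : ‖c - u‖ * ‖w‖ ≤ 1 / 1000 * 2 := by gcongr
    linarith
  have hrot := h.rescale (l := 1) one_pos hu
  simp only [Complex.ofReal_one, one_pow, one_mul, inv_one] at hrot
  set A : ℝ → ℝ := fun t => (u⁻¹ * γ t).re with hA
  -- The real part of the rotated equation is a Riccati equation; the perturbation, the deviation of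
  -- the parameter from 1 and the squared imaginary part are collected in `e`.
  set e : ℝ → ℝ := fun t => (rescaledField p 1 u (u⁻¹ * γ t)).re - ((u⁻¹ * x).re - 1) -
    (u⁻¹ * γ t).im ^ 2 with he
  have hAd : ∀ t, HasDerivAt A (A t ^ 2 - 1 + e t) t := fun t => by
    refine (Complex.reCLM.hasFDerivAt.comp_hasDerivAt t (hrot.hasDerivAt t)).congr_deriv ?_
    simp only [umbilicField, hA, he, Complex.reCLM_apply, Complex.add_re, Complex.sub_re, pow_two,
      Complex.mul_re (conj _), Complex.conj_re, Complex.conj_im]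
    ring
  have hAc : Continuous A := continuous_iff_continuousAt.2 fun t => (hAd t).continuousAt
  have hpn : ∀ z, ‖rescaledField p 1 u z‖ ≤ ε := fun z => by
    simp only [rescaledField, Complex.ofReal_one, one_pow, one_mul]
    rw [norm_mul, norm_inv, hun, inv_one, one_mul]
    exact hp.norm_le _
  have hE : ∀ t, |e t| ≤ 4 / 1000 := fun t => by
    obtain ⟨X, -, hX⟩ := hnear t
    have h1 := (Complex.abs_im_le_norm _).trans hX
    simp only [Complex.sub_im, Complex.ofReal_im, sub_zero] at h1
    have h2 := (Complex.abs_re_le_norm _).trans (hpn (u⁻¹ * γ t))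
    have h3 := (Complex.abs_re_le_norm _).trans hxu
    simp only [Complex.sub_re, Complex.one_re] at h3
    have h4 : (u⁻¹ * γ t).im ^ 2 ≤ (3 / 1000) ^ 2 := sq_le_sq.2 (by
      rw [abs_of_nonneg (show (0 : ℝ) ≤ 3 / 1000 by norm_num)]; exact h1)
    have h5 := sq_nonneg (u⁻¹ * γ t).im
    have h2' := abs_le.1 h2
    have h3' := abs_le.1 h3
    simp only [he]
    rw [abs_le]; constructor <;> linarith [h2'.1, h2'.2, h3'.1, h3'.2]
  have hend : ∀ s : ℂ, ∀ k : ℂ, s = m + k → ‖k - u‖ ≤ 1 / 1000 → 0 < (u⁻¹ * s).re := by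
    intro s k hk hku
    have e1 : u⁻¹ * s - 1 = u⁻¹ * (m + (k - u)) := by rw [hk]; field_simp; ring
    have h1 : ‖u⁻¹ * s - 1‖ ≤ 1 / 2 := by
      rw [e1, norm_mul, norm_inv, hun, inv_one, one_mul]
      exact (norm_add_le _ _).trans (by linarith)
    have h2 := (abs_le.1 ((Complex.abs_re_le_norm _).trans h1)).1
    simp only [Complex.sub_re, Complex.one_re] at h2
    linarith
  have hleft : 0 < (u⁻¹ * s₁).re := hend s₁ c (by rw [hm, hc]; ring) hj
  have hright : (u⁻¹ * s₂).re < 0 := by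
    have e1 : u⁻¹ * s₂ + 1 = u⁻¹ * (m - (c - u)) := by
      have : s₂ = m - c := by rw [hm, hc]; ring
      rw [this]; field_simp; ring
    have h1 : ‖u⁻¹ * s₂ + 1‖ ≤ 1 / 2 := by
      rw [e1, norm_mul, norm_inv, hun, inv_one, one_mul]
      exact (norm_sub_le _ _).trans (by linarith)
    have h2 := (abs_le.1 ((Complex.abs_re_le_norm _).trans h1)).2
    simp only [Complex.add_re, Complex.one_re] at h2
    linarith
  have hbot : Tendsto A atBot (𝓝 (u⁻¹ * s₁).re) :=
    (Complex.continuous_re.tendsto _).comp (h.tendsto_atBot.const_mul u⁻¹)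
  have htop : Tendsto A atTop (𝓝 (u⁻¹ * s₂).re) :=
    (Complex.continuous_re.tendsto _).comp (h.tendsto_atTop.const_mul u⁻¹)
  -- The real part changes sign along the orbit; a zero of it becomes the time origin, as required
  -- by the normalisation `(ζ 0).re = 0`.
  obtain ⟨t₀, ht₀⟩ := mem_range_of_exists_le_of_exists_ge hAc
    (htop.eventually (eventually_le_nhds hright)).exists
    (hbot.eventually (eventually_ge_nhds hleft)).exists
  refine ⟨j, t₀, ?_, ht₀, fun t => ?_⟩
  · have := (abs_le.1 ((Complex.abs_re_le_norm _).trans hxu)).1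
    simp only [Complex.sub_re, Complex.one_re] at this
    linarith
  · have h1 := abs_add_tanh_le (A := fun t => A (t + t₀)) (e := fun t => e (t + t₀)) (K := 5 / 1000)
      (fun t => hE (t + t₀)) (by norm_num) (by norm_num) (by simpa using ht₀)
      (fun t => (hAd (t + t₀)).comp_add_const t t₀) t
    obtain ⟨X, -, hX⟩ := hnear (t + t₀)
    have h2 := (Complex.abs_im_le_norm _).trans hX
    simp only [Complex.sub_im, Complex.ofReal_im, sub_zero] at h2
    have h3 := Complex.norm_le_abs_re_add_abs_im (u⁻¹ * γ (t + t₀) + (Real.tanh t : ℂ))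
    rw [Complex.add_re, Complex.add_im, Complex.ofReal_re, Complex.ofReal_im, add_zero] at h3
    simp only [hA] at h1
    linarith

end APriori

/-! ### Orbits near the model orbit converge to zeros of the field. -/

section Convergence

/-- A bounded solution of a perturbation of `v' = -2 conj v` decays. -/
theorem tendsto_zero_of_hyperbolic {v r : ℝ → ℂ} {T C : ℝ}
    (hd : ∀ t, HasDerivAt v (-2 * conj (v t) + r t) t) (hr : ∀ t, T ≤ t → ‖r t‖ ≤ 1 / 4 * ‖v t‖)
    (hb : ∀ t, T ≤ t → ‖v t‖ ≤ C) : Tendsto v atTop (𝓝 0) := by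
  have ha : ∀ t, HasDerivAt (fun t => (v t).re) (-2 * (v t).re + (r t).re) t := fun t =>
    (Complex.reCLM.hasFDerivAt.comp_hasDerivAt t (hd t)).congr_deriv (by simp)
  have hi : ∀ t, HasDerivAt (fun t => (v t).im) (2 * (v t).im + (r t).im) t := fun t =>
    (Complex.imCLM.hasFDerivAt.comp_hasDerivAt t (hd t)).congr_deriv (by simp)
  have hn : ∀ t, ‖v t‖ ^ 2 = (v t).re ^ 2 + (v t).im ^ 2 := fun t => by
    rw [← Complex.normSq_eq_norm_sq, Complex.normSq_apply]; ring
  have hexp : ∀ k t : ℝ, HasDerivAt (fun t => Real.exp (k * t)) (k * Real.exp (k * t)) t :=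
    fun k t => (((hasDerivAt_id t).const_mul k).exp).congr_deriv (by simp; ring)
  -- `W` is positive where the expanding imaginary direction dominates. As `W * exp (-2t)` is
  -- nondecreasing, one positive value would force exponential growth, against boundedness.
  set W : ℝ → ℝ := fun t => (v t).im ^ 2 - (v t).re ^ 2 with hW
  have hWd : ∀ t, HasDerivAt W (2 * (v t).im * (2 * (v t).im + (r t).im) -
      2 * (v t).re * (-2 * (v t).re + (r t).re)) t := fun t =>
    (((hi t).pow 2).sub ((ha t).pow 2)).congr_deriv (by simp)
  have hmono : MonotoneOn (fun t => W t * Real.exp (-2 * t)) (Set.Ici T) := by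
    have hF := fun t => (hWd t).mul (hexp (-2) t)
    refine monotoneOn_of_deriv_nonneg (convex_Ici T)
      (fun t _ => (hF t).continuousAt.continuousWithinAt)
      (fun t _ => (hF t).differentiableAt.differentiableWithinAt) fun t ht => ?_
    rw [interior_Ici] at ht
    have hT := hr t ht.le
    have h1 : |(v t * r t).re| ≤ ‖v t‖ * (1 / 4 * ‖v t‖) :=
      (Complex.abs_re_le_norm _).trans (by rw [norm_mul]; gcongr)
    rw [Complex.mul_re] at h1
    have h2 := (abs_le.1 h1).2
    have h3 := hn t
    change 0 ≤ deriv (W * fun t => Real.exp (-2 * t)) t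
    rw [(hF t).deriv]
    have h4 := Real.exp_pos (-2 * t)
    have h5 : 0 ≤ 2 * (v t).im * (2 * (v t).im + (r t).im) -
      2 * (v t).re * (-2 * (v t).re + (r t).re) - 2 * W t := by
      simp only [hW]
      nlinarith [sq_nonneg (v t).re, sq_nonneg (v t).im]
    nlinarith [mul_nonneg h5 h4.le]
  have hWle : ∀ t, T ≤ t → W t ≤ 0 := by
    intro t ht
    by_contra! hpos
    have hlim : Tendsto (fun s => W t * Real.exp (-2 * t) * Real.exp (2 * s)) atTop atTop :=
      (Real.tendsto_exp_atTop.comp (tendsto_id.const_mul_atTop two_pos)).const_mul_atTop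
        (by positivity)
    obtain ⟨s, hs1, hs2⟩ := ((hlim.eventually_gt_atTop (C ^ 2)).and (eventually_ge_atTop t)).exists
    have h1 : W t * Real.exp (-2 * t) ≤ W s * Real.exp (-2 * s) :=
      hmono ht (ht.trans hs2) hs2
    have h2 : Real.exp (-2 * s) * Real.exp (2 * s) = 1 := by
      rw [← Real.exp_add]; simp
    have h3 : W t * Real.exp (-2 * t) * Real.exp (2 * s) ≤ W s := by
      calc _ ≤ W s * Real.exp (-2 * s) * Real.exp (2 * s) := by gcongr
        _ = W s := by rw [mul_assoc, h2, mul_one]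
    have h4 : W s ≤ ‖v s‖ ^ 2 := by
      rw [hn]; simp only [hW]; nlinarith [sq_nonneg (v s).re]
    have h5 : ‖v s‖ ^ 2 ≤ C ^ 2 := by
      have := hb s (ht.trans hs2)
      gcongr
    linarith
  -- Now `|Im v| ≤ |Re v|`, so the remainder is at most `1/2 |Re v|`, and the contracting real part
  -- decays at a definite rate and controls `v`.
  have hanti : AntitoneOn (fun t => (v t).re ^ 2 * Real.exp (2 * t)) (Set.Ici T) := by
    have hF := fun t => ((ha t).pow 2).mul (hexp 2 t)
    refine antitoneOn_of_deriv_nonpos (convex_Ici T)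
      (fun t _ => (hF t).continuousAt.continuousWithinAt)
      (fun t _ => (hF t).differentiableAt.differentiableWithinAt) fun t ht => ?_
    rw [interior_Ici] at ht
    have h1 := hWle t ht.le
    have h2 : ‖v t‖ ≤ 2 * |(v t).re| := by
      refine abs_le_of_sq_le_sq' ?_ (by positivity) |>.2
      rw [hn, mul_pow, sq_abs]
      simp only [hW] at h1
      nlinarith [sq_nonneg (v t).re]
    have h3 : |(r t).re| ≤ 1 / 2 * |(v t).re| :=
      (Complex.abs_re_le_norm _).trans ((hr t ht.le).trans (by linarith))
    have h4 : |(v t).re * (r t).re| ≤ 1 / 2 * (v t).re ^ 2 := by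
      rw [abs_mul, ← sq_abs (v t).re]
      calc _ ≤ |(v t).re| * (1 / 2 * |(v t).re|) := by gcongr
        _ = _ := by ring
    have h5 := (abs_le.1 h4).2
    change deriv (((fun t => (v t).re) ^ 2) * fun t => Real.exp (2 * t)) t ≤ 0
    rw [(hF t).deriv]
    have h6 := Real.exp_pos (2 * t)
    have h7 : 2 * (v t).re * (-2 * (v t).re + (r t).re) + 2 * (v t).re ^ 2 ≤ 0 := by nlinarith
    simp only [Nat.cast_ofNat, Pi.pow_apply]
    norm_num
    nlinarith [mul_nonneg (neg_nonneg.2 h7) h6.le]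
  have hbound : ∀ t, T ≤ t → ‖v t‖ ^ 2 ≤ 2 * ((v T).re ^ 2 * Real.exp (2 * T)) *
      Real.exp (-2 * t) := by
    intro t ht
    have h1 : (v t).re ^ 2 * Real.exp (2 * t) ≤ (v T).re ^ 2 * Real.exp (2 * T) :=
      hanti (Set.mem_Ici.2 le_rfl) ht ht
    have h2 : Real.exp (2 * t) * Real.exp (-2 * t) = 1 := by
      rw [← Real.exp_add]; simp
    have h3 := hWle t ht
    simp only [hW] at h3
    rw [hn]
    calc (v t).re ^ 2 + (v t).im ^ 2 ≤ 2 * (v t).re ^ 2 := by linarith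
      _ = 2 * ((v t).re ^ 2 * Real.exp (2 * t)) * Real.exp (-2 * t) := by
        rw [mul_assoc, mul_assoc, h2, mul_one]
      _ ≤ _ := by gcongr
  have hsq : Tendsto (fun t => ‖v t‖ ^ 2) atTop (𝓝 0) := by
    refine squeeze_zero' (Eventually.of_forall fun t => by positivity)
      ((eventually_ge_atTop T).mono hbound) ?_
    have : Tendsto (fun t : ℝ => Real.exp (-2 * t)) atTop (𝓝 0) :=
      Real.tendsto_exp_atBot.comp (tendsto_id.const_mul_atTop_of_neg (by norm_num))
    simpa using this.const_mul (2 * ((v T).re ^ 2 * Real.exp (2 * T)))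
  rw [tendsto_zero_iff_norm_tendsto_zero]
  have := hsq.sqrt
  simpa [Real.sqrt_sq] using this

variable {p : ℂ → ℂ} {x : ℂ} {ε : ℝ}

theorem hasDerivAt_umbilicField_comp (hp : IsSmallField p ε) {z : ℝ → ℂ} {z' : ℂ} {t : ℝ}
    (hz : HasDerivAt z z' t) : HasDerivAt (fun t => umbilicField p x (z t))
      (2 * conj (z t) * conj z' + fderiv ℝ p (z t) z') t := by
  have h1 : HasDerivAt (fun t => conj (z t)) (conj z') t :=
    Complex.conjCLE.hasFDerivAt.comp_hasDerivAt t hz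
  have h2 : HasDerivAt (fun t => p (z t)) (fderiv ℝ p (z t) z') t :=
    (hp.differentiable _).hasFDerivAt.comp_hasDerivAt t hz
  exact (((h1.pow 2).sub_const x).add h2).congr_deriv (by simp)

theorem continuous_umbilicField (hp : IsSmallField p ε) : Continuous (umbilicField p x) :=
  ((Complex.continuous_conj.pow 2).sub continuous_const).add hp.contDiff.continuous

/-- Near `-1` the velocity along the orbit is a bounded solution of the perturbed hyperbolic
equation, hence tends to 0. There the field also does not decrease distances, so the convergence of
the velocities makes the orbit Cauchy. -/
theorem tendsto_zero_of_near_modelOrbit (hp : IsSmallField p ε) (hε : ε ≤ 1 / 100) {z : ℝ → ℂ}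
    (hz : ∀ t, HasDerivAt z (umbilicField p x (z t)) t)
    (hnear : ∀ t, ‖z t + (Real.tanh t : ℂ)‖ ≤ 1 / 32) :
    ∃ s, umbilicField p x s = 0 ∧ ‖s + 1‖ ≤ 1 / 16 ∧ Tendsto z atTop (𝓝 s) := by
  obtain ⟨T, hT⟩ := eventually_atTop.1
    (tendsto_real_tanh_atTop.eventually (lt_mem_nhds (show (1 - 1 / 32 : ℝ) < 1 by norm_num)))
  have hz1 : ∀ t, T ≤ t → ‖z t + 1‖ ≤ 1 / 16 := by
    intro t ht
    have h1 := hT t ht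
    have h2 := Real.tanh_lt_one t
    have e : z t + 1 = (z t + (Real.tanh t : ℂ)) + ((1 - Real.tanh t : ℝ) : ℂ) := by
      push_cast; ring
    rw [e]
    refine (norm_add_le _ _).trans ?_
    rw [Complex.norm_real, Real.norm_of_nonneg (by linarith)]
    linarith [hnear t]
  set v : ℝ → ℂ := fun t => umbilicField p x (z t) with hv
  have hvd : ∀ t, HasDerivAt v (-2 * conj (v t) +
      (2 * conj (z t + 1) * conj (v t) + fderiv ℝ p (z t) (v t))) t := fun t =>
    (hasDerivAt_umbilicField_comp hp (hz t)).congr_deriv (by simp only [hv, map_add, map_one]; ring)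
  have hv0 : Tendsto v atTop (𝓝 0) := by
    refine tendsto_zero_of_hyperbolic (T := T) (C := 4 + ‖x‖ + ε) hvd (fun t ht => ?_)
      (fun t ht => ?_)
    · refine (norm_add_le _ _).trans ?_
      rw [norm_mul, norm_mul, Complex.norm_conj, Complex.norm_conj, Complex.norm_ofNat]
      have h1 := (fderiv ℝ p (z t)).le_of_opNorm_le (hp.norm_fderiv_le (z t)) (v t)
      have h2 := hz1 t ht
      have h3 : 2 * ‖z t + 1‖ * ‖v t‖ ≤ 2 * (1 / 16) * ‖v t‖ := by gcongr
      have h4 : ε * ‖v t‖ ≤ 1 / 100 * ‖v t‖ := by gcongr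
      linarith [norm_nonneg (v t)]
    · simp only [hv, umbilicField]
      refine (norm_add_le _ _).trans (add_le_add ((norm_sub_le _ _).trans ?_) (hp.norm_le _))
      rw [norm_pow, Complex.norm_conj]
      have h1 : ‖z t‖ ≤ 2 := by
        have := norm_sub_le (z t + 1) 1
        rw [add_sub_cancel_right, norm_one] at this
        linarith [hz1 t ht]
      have : ‖z t‖ ^ 2 ≤ 2 ^ 2 := by gcongr
      linarith
  have hexpand : ∀ t u, T ≤ t → T ≤ u → ‖z t - z u‖ ≤ ‖v t - v u‖ := by
    intro t u ht hu
    have e : conj ((z t - z u) * (z t + z u)) = (v t - v u) - (p (z t) - p (z u)) := by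
      simp only [hv, umbilicField, map_mul, map_sub, map_add]; ring
    have h1 : ‖z t - z u‖ * ‖z t + z u‖ ≤ ‖v t - v u‖ + ε * ‖z t - z u‖ := by
      rw [← norm_mul, ← Complex.norm_conj, e]
      exact (norm_sub_le _ _).trans (add_le_add le_rfl (hp.norm_sub_le _ _))
    have h2 : 3 / 2 ≤ ‖z t + z u‖ := by
      have h3 := norm_sub_le ((z t + 1) + (z u + 1)) (z t + z u)
      have e2 : (z t + 1) + (z u + 1) - (z t + z u) = 2 := by ring
      rw [e2, Complex.norm_ofNat] at h3
      have h4 := norm_add_le (z t + 1) (z u + 1)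
      linarith [hz1 t ht, hz1 u hu]
    nlinarith [norm_nonneg (z t - z u)]
  have hcauchy : CauchySeq z := by
    refine Metric.cauchySeq_iff.2 fun δ hδ => ?_
    obtain ⟨N, hN⟩ := Metric.cauchySeq_iff.1 hv0.cauchySeq δ hδ
    refine ⟨max N T, fun t ht u hu => ?_⟩
    have h1 := hN t ((le_max_left _ _).trans ht) u ((le_max_left _ _).trans hu)
    rw [dist_eq_norm] at h1 ⊢
    exact (hexpand t u ((le_max_right _ _).trans ht) ((le_max_right _ _).trans hu)).trans_lt h1
  obtain ⟨s, hs⟩ := cauchySeq_tendsto_of_complete hcauchy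
  refine ⟨s, tendsto_nhds_unique (((continuous_umbilicField hp).tendsto s).comp hs) hv0, ?_, hs⟩
  exact le_of_tendsto (hs.add_const 1).norm ((eventually_ge_atTop T).mono hz1)

/-- An orbit near the model orbit is a connecting orbit. -/
theorem isConnection_of_near_modelOrbit (hp : IsSmallField p ε) (hε : ε ≤ 1 / 100) {z : ℝ → ℂ}
    (hz : ∀ t, HasDerivAt z (umbilicField p x (z t)) t)
    (hnear : ∀ t, ‖z t + (Real.tanh t : ℂ)‖ ≤ 1 / 32) :
    ∃ s₁ s₂, IsConnection p x z s₁ s₂ := by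
  obtain ⟨s₂, h2, h2', hlim2⟩ := tendsto_zero_of_near_modelOrbit hp hε hz hnear
  -- The curve `-z(-t)` solves the equation for `p(-·)` with the same `x` and is again near the
  -- model orbit; its forward limit gives the backward limit of `z`.
  have hp' : IsSmallField (fun z => p (-z)) ε := by
    simpa using hp.rescale (a := 1) (b := -1) (K := 1) (by simp) (by simp)
  obtain ⟨s₁, h1, h1', hlim1⟩ := tendsto_zero_of_near_modelOrbit (x := x) hp' hε
    (z := fun t => -z (-t)) (fun t => (hasDerivAt_comp_neg (hz (-t))).neg.congr_deriv
      (by simp [umbilicField])) (fun t => by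
      have := hnear (-t)
      rw [Real.tanh_neg] at this
      push_cast at this ⊢
      rw [← norm_neg]
      convert! this using 2
      ring)
  refine ⟨-s₁, s₂, ?_, by simpa [umbilicField] using h1, h2, hz, ?_, hlim2⟩
  · intro heq
    rw [← heq] at h2'
    have h3 := norm_add_le (s₁ + 1) (-s₁ + 1)
    have e : s₁ + 1 + (-s₁ + 1) = 2 := by ring
    rw [e, Complex.norm_ofNat] at h3
    linarith
  · have := (hlim1.neg).comp tendsto_neg_atBot_atTop
    simpa [Function.comp_def] using this

end Convergence

/-! ### Zeros as saddles: determinant and eigenvalues. -/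

section Saddles

/-- A real-linear endomorphism of the plane with negative determinant has a positive and a
negative eigenvalue. -/
theorem exists_eigenvectors_of_det_neg (L : ℂ →ₗ[ℝ] ℂ)
    (hdet : (conj (L 1) * L Complex.I).im < 0) :
    (∃ a : ℝ, a < 0 ∧ ∃ v, v ≠ 0 ∧ L v = a • v) ∧ ∃ b : ℝ, 0 < b ∧ ∃ v, v ≠ 0 ∧ L v = b • v := by
  set M : Matrix (Fin 2) (Fin 2) ℝ :=
    !![(L 1).re, (L Complex.I).re; (L 1).im, (L Complex.I).im] with hM
  set D := (conj (L 1) * L Complex.I).im with hD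
  have hDet : D = (L 1).re * (L Complex.I).im - (L Complex.I).re * (L 1).im := by
    rw [hD, Complex.mul_im, Complex.conj_re, Complex.conj_im]; ring
  have key : ∀ a : ℝ, a ^ 2 - ((L 1).re + (L Complex.I).im) * a + D = 0 →
      ∃ v, v ≠ 0 ∧ L v = a • v := by
    intro a ha
    have h0 : (M - a • (1 : Matrix (Fin 2) (Fin 2) ℝ)).det = 0 := by
      rw [Matrix.det_fin_two]
      simp [hM]
      linear_combination ha - hDet
    obtain ⟨w, hw0, hw⟩ := Matrix.exists_mulVec_eq_zero_iff.2 h0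
    refine ⟨⟨w 0, w 1⟩, ?_, ?_⟩
    · intro hz
      apply hw0
      ext i
      have h1 := congrArg Complex.re hz
      have h2 := congrArg Complex.im hz
      fin_cases i
      · simpa using h1
      · simpa using h2
    · have e : (⟨w 0, w 1⟩ : ℂ) = w 0 • (1 : ℂ) + w 1 • Complex.I := by
        apply Complex.ext <;> simp
      have h1 := congrFun hw 0
      have h2 := congrFun hw 1
      simp [hM, Matrix.mulVec, dotProduct, Fin.sum_univ_two] at h1 h2
      rw [e, map_add, map_smul, map_smul]
      apply Complex.ext
      · simp; linarith
      · simp; linarith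
  set S := (L 1).re + (L Complex.I).im
  set R := Real.sqrt (S ^ 2 - 4 * D) with hR
  have hR2 : R ^ 2 = S ^ 2 - 4 * D := Real.sq_sqrt (by nlinarith [sq_nonneg S])
  have hRS : |S| < R := by
    rw [hR]; apply Real.lt_sqrt_of_sq_lt; rw [sq_abs]; linarith
  have := abs_lt.1 hRS
  refine ⟨⟨(S - R) / 2, by linarith, key _ ?_⟩, ⟨(S + R) / 2, by linarith, key _ ?_⟩⟩
  · linear_combination hR2 / 4
  · linear_combination hR2 / 4

/-- The map `h ↦ β conj h` has determinant `-‖β‖²`; the perturbation changes it by at most `2k‖β‖ +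
k² ≤ 9/16 ‖β‖²`. -/
theorem det_neg_of_near_conj {β : ℂ} {k : ℝ} {L D : ℂ →ₗ[ℝ] ℂ} (hD : ∀ h, ‖D h‖ ≤ k * ‖h‖)
    (hL : ∀ h, L h = β * conj h + D h) (hk0 : 0 ≤ k) (hk : 4 * k ≤ ‖β‖) (hβ : β ≠ 0) :
    (conj (L 1) * L Complex.I).im < 0 := by
  have h1 := hD 1
  have h2 := hD Complex.I
  rw [norm_one, mul_one] at h1
  rw [Complex.norm_I, mul_one] at h2
  have e : conj (L 1) * L Complex.I = -Complex.I * ((‖β‖ ^ 2 : ℝ) : ℂ) +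
      (conj β * D Complex.I + -Complex.I * β * conj (D 1) + conj (D 1) * D Complex.I) := by
    rw [hL, hL, map_add, map_mul, map_one, map_one, Complex.conj_I]
    have := Complex.mul_conj' β
    push_cast
    rw [← this]; ring
  have h3 : ‖conj β * D Complex.I + -Complex.I * β * conj (D 1) + conj (D 1) * D Complex.I‖ ≤
      ‖β‖ * k + ‖β‖ * k + k * k := by
    refine (norm_add_le _ _).trans (add_le_add ((norm_add_le _ _).trans (add_le_add ?_ ?_)) ?_)
    · rw [norm_mul, Complex.norm_conj]; gcongr
    · rw [norm_mul, norm_mul, Complex.norm_conj, norm_neg, Complex.norm_I, one_mul]; gcongr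
    · rw [norm_mul, Complex.norm_conj]; gcongr
  have h4 := (Complex.abs_im_le_norm _).trans h3
  rw [e, Complex.add_im]
  have h5 : (-Complex.I * ((‖β‖ ^ 2 : ℝ) : ℂ)).im = -‖β‖ ^ 2 := by
    rw [Complex.mul_im, Complex.ofReal_im, Complex.ofReal_re]; simp
  have h6 := (abs_le.1 h4).2
  have h7 : 0 < ‖β‖ := norm_pos_iff.2 hβ
  rw [h5]
  nlinarith

end Saddles

/-! ### The parameters with a connection form three polar graphs. -/

section ConnectionLocus

theorem IsConnection.comp_add_const {p : ℂ → ℂ} {x s₁ s₂ : ℂ} {γ : ℝ → ℂ}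
    (h : IsConnection p x γ s₁ s₂) (t₀ : ℝ) : IsConnection p x (fun t => γ (t + t₀)) s₁ s₂ :=
  ⟨h.ne, h.zero_left, h.zero_right, fun t => (h.hasDerivAt (t + t₀)).comp_add_const t t₀,
    h.tendsto_atBot.comp (tendsto_atBot_add_const_right _ t₀ tendsto_id),
    h.tendsto_atTop.comp (tendsto_atTop_add_const_right _ t₀ tendsto_id)⟩

theorem circlePoint_im {x : ℂ} (hx : ‖x‖ = 1) (hre : 0 < x.re) : circlePoint x.im = x := by
  have h : 1 - x.im ^ 2 = x.re ^ 2 := by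
    have : ‖x‖ ^ 2 = x.re ^ 2 + x.im ^ 2 := by
      rw [← Complex.normSq_eq_norm_sq, Complex.normSq_apply]; ring
    rw [hx] at this; linarith
  rw [circlePoint, h, Real.sqrt_sq hre.le, mul_comm]
  exact Complex.re_add_im x

/-- The scale is written as `exp σ` so that the family is smooth on all of `ℝ × ℂ`, as the
superposition operators demand. -/
theorem contDiff_rescaledField_exp {p : ℂ → ℂ} (hp : ContDiff ℝ ∞ p) {u : ℂ} (hu : u ≠ 0) :
    ContDiff ℝ ∞ fun v : ℝ × ℂ => rescaledField p (Real.exp v.1) u v.2 := by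
  have h1 : ContDiff ℝ ∞ fun v : ℝ × ℂ => ((Real.exp v.1 : ℝ) : ℂ) :=
    Complex.ofRealCLM.contDiff.comp (Real.contDiff_exp.comp contDiff_fst)
  have h2 : ContDiff ℝ ∞ fun v : ℝ × ℂ => ((((Real.exp v.1 : ℝ) : ℂ)) ^ 2 * u)⁻¹ :=
    ((h1.pow 2).mul contDiff_const).inv fun v =>
      mul_ne_zero (pow_ne_zero 2 (by exact_mod_cast (Real.exp_pos v.1).ne')) hu
  exact h2.mul (hp.comp ((h1.mul contDiff_const).mul contDiff_snd))

theorem IsSmallField.rescaledField {p : ℂ → ℂ} {ε K : ℝ} (hp : IsSmallField p ε) {u : ℂ}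
    (hu : ‖u‖ = 1) {l : ℝ} (hl : 0 < l) (h1 : (l ^ 2)⁻¹ ≤ K) (h2 : l⁻¹ ≤ K) :
    IsSmallField (rescaledField p l u) (K * ε) := by
  have ha : ‖((l : ℂ) ^ 2 * u)⁻¹‖ = (l ^ 2)⁻¹ := by
    rw [norm_inv, norm_mul, hu, mul_one, norm_pow, Complex.norm_real, Real.norm_of_nonneg hl.le]
  have hb : ‖(l : ℂ) * u‖ = l := by
    rw [norm_mul, hu, mul_one, Complex.norm_real, Real.norm_of_nonneg hl.le]
  refine hp.rescale (by rw [ha]; exact h1) ?_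
  rw [ha, hb]
  convert! h2 using 1
  field_simp

/-- The parameters outside a disc with a connecting orbit form three smooth curves, each of them
a graph over a ray in polar coordinates. -/
theorem exists_connection_iff {p : ℂ → ℂ} {ε K r₀ : ℝ} (hp : IsSmallField p ε)
    (hr₀ : 0 < r₀) (hK1 : r₀⁻¹ ≤ K) (hK2 : (Real.sqrt r₀)⁻¹ ≤ K) (hKε : K * ε ≤ 1 / 10 ^ 11) :
    ∃ b : Fin 3 → ℝ → ℝ, (∀ j r, r₀ < r → ContDiffAt ℝ ∞ (b j) r ∧ |b j r| ≤ 1 / 200) ∧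
      ∀ x : ℂ, r₀ < ‖x‖ → ((∃ γ s₁ s₂, IsConnection p x γ s₁ s₂) ↔
        ∃ j, x = (‖x‖ : ℂ) * (cubeRoot j * circlePoint (b j ‖x‖))) := by
  set δ : ℝ := 1 / 10 ^ 11 with hδ
  have hδ0 : 0 < δ := by norm_num [hδ]
  have hsmall : ∀ l, Real.sqrt r₀ < l → ∀ u : ℂ, ‖u‖ = 1 →
      IsSmallField (rescaledField p l u) δ := by
    intro l hl u hu
    have hs : 0 < Real.sqrt r₀ := Real.sqrt_pos.2 hr₀
    have hl0 : 0 < l := hs.trans hl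
    refine (hp.rescaledField (K := K) hu hl0 (le_trans ?_ hK1) (le_trans ?_ hK2)).mono hKε
    · refine inv_anti₀ hr₀ ?_
      rw [← Real.sq_sqrt hr₀.le]; gcongr
    · exact inv_anti₀ hs hl.le
  set q : Fin 3 → ℝ × ℂ → ℂ := fun j v => rescaledField p (Real.exp v.1) (cubeRoot j) v.2
  have hq : ∀ j, ContDiff ℝ ∞ (q j) := fun j =>
    contDiff_rescaledField_exp hp.contDiff (cubeRoot_ne_zero j)
  set U : Set ℝ := Set.Ioi (Real.log (Real.sqrt r₀)) with hU
  have hexpU : ∀ σ ∈ U, Real.sqrt r₀ < Real.exp σ := fun σ hσ =>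
    (Real.log_lt_iff_lt_exp (Real.sqrt_pos.2 hr₀)).1 hσ
  have hqs : ∀ j, ∀ σ ∈ U, IsSmallField (fun z => q j (σ, z)) δ := fun j σ hσ =>
    hsmall _ (hexpU σ hσ) _ (norm_cubeRoot j)
  have hδ1 : δ ≤ 1 / 1000 := by norm_num [hδ]
  have hδ2 : δ ≤ 1 / 100 := by norm_num [hδ]
  choose z hz hzs using fun j => exists_smooth_fixedPoint (hq j) isOpen_Ioi hδ1 (hqs j)
  have hscale : ∀ r, r₀ < r → Real.log (Real.sqrt r) ∈ U ∧
      Real.exp (Real.log (Real.sqrt r)) = Real.sqrt r := fun r hr =>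
    ⟨Real.log_lt_log (Real.sqrt_pos.2 hr₀) (Real.sqrt_lt_sqrt hr₀.le hr),
      Real.exp_log (Real.sqrt_pos.2 (hr₀.trans hr))⟩
  refine ⟨fun j r => forcingMean (hq j) (Real.log (Real.sqrt r), z j (Real.log (Real.sqrt r))),
    fun j r hr => ⟨?_, ?_⟩, fun x hx => ?_⟩
  · have hr0 : r ≠ 0 := (hr₀.trans hr).ne'
    have h1 : ContDiffAt ℝ ∞ (fun r => Real.log (Real.sqrt r)) r :=
      (contDiffAt_id.sqrt hr0).log (Real.sqrt_pos.2 (hr₀.trans hr)).ne'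
    exact ContDiffAt.comp (g := fun σ => forcingMean (hq j) (σ, z j σ)) r
      (hzs j _ (hscale r hr).1) h1
  · exact abs_forcingMean_le (hq j) (hqs j _ (hscale r hr).1) hδ1 (hz j _ (hscale r hr).1).1
  · obtain ⟨hσU, hexp⟩ := hscale _ hx
    set σ := Real.log (Real.sqrt ‖x‖)
    set l := Real.exp σ with hl
    have hl0 : 0 < l := Real.exp_pos σ
    have hl2 : l ^ 2 = ‖x‖ := by rw [hexp, Real.sq_sqrt (norm_nonneg x)]
    have hl2' : (l : ℂ) ^ 2 = (‖x‖ : ℂ) := by rw [← hl2]; push_cast; rfl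
    have hlC : (l : ℂ) ≠ 0 := by exact_mod_cast hl0.ne'
    constructor
    · rintro ⟨γ, s₁, s₂, h⟩
      -- First only the scale is normalised, to `‖x‖ = 1`; the rotation can be chosen after the a
      -- priori estimate has supplied the cube root.
      have h1 := h.rescale (u := 1) hl0 (one_pow 3)
      have hx1 : ‖((l : ℂ) ^ 2 * 1)⁻¹ * x‖ = 1 := by
        rw [mul_one, hl2', norm_mul, norm_inv, Complex.norm_real, norm_norm]
        exact inv_mul_cancel₀ (hr₀.trans hx).ne'
      obtain ⟨j, t₀, hre, h0, hnear⟩ := h1.near_modelOrbit (hsmall l (hexpU σ hσU) 1 norm_one)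
        hδ0 le_rfl hx1
      have h2 := (h1.rescale (u := cubeRoot j) one_pos (cubeRoot_pow j)).comp_add_const t₀
      rw [rescaledField_rescaledField, mul_one, one_mul] at h2
      simp only [Complex.ofReal_one, one_pow, one_mul, inv_one] at h2
      set y := (cubeRoot j)⁻¹ * (((l : ℂ) ^ 2 * 1)⁻¹ * x) with hy
      have hyn : ‖y‖ = 1 := by rw [hy, norm_mul, hx1, norm_inv, norm_cubeRoot]; norm_num
      set w : ℝ → ℂ := fun t => (cubeRoot j)⁻¹ * (((l : ℂ) * 1)⁻¹ * γ (l⁻¹ * (t + t₀))) with hw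
      have hwd : ∀ t, HasDerivAt w (umbilicField (rescaledField p l (cubeRoot j)) y (w t)) t :=
        h2.hasDerivAt
      have hwc : Continuous w := continuous_iff_continuousAt.2 fun t => (hwd t).continuousAt
      set ζ : ℝ →ᵇ ℂ := BoundedContinuousFunction.ofNormedAddCommGroup
        (fun t => w t - modelOrbit t) (hwc.sub modelOrbit.continuous) (1 / 32) (fun t => by
          rw [modelOrbit_apply, sub_neg_eq_add]; exact hnear t) with hζ
      have hζa : ∀ t, ζ t + modelOrbit t = w t := fun t => sub_add_cancel _ _
      have hζn : ‖ζ‖ ≤ 1 / 32 :=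
        BoundedContinuousFunction.norm_ofNormedAddCommGroup_le _ (by norm_num) _
      have hζ0 : (ζ 0).re = 0 := by
        have : ζ 0 = w 0 := by rw [← hζa 0]; simp
        rw [this]; simpa [hw] using h0
      obtain ⟨hb, hfix⟩ := fixedPoint_of_hasDerivAt (hq j) (σ := σ) (b := y.im) hζ0 (fun t => by
        rw [circlePoint_im hyn hre]
        simp only [hζa]
        exact hwd t)
      have heq := eq_of_fixedPoint_orbitMap (hq j) (hqs j σ hσU) hδ1 hζn (hz j σ hσU).1 hfix
        (hz j σ hσU).2
      refine ⟨j, ?_⟩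
      change x = (‖x‖ : ℂ) * (cubeRoot j * circlePoint (forcingMean (hq j) (σ, z j σ)))
      rw [← heq, ← hb, circlePoint_im hyn hre, hy, ← hl2', mul_one]
      have := cubeRoot_ne_zero j
      field_simp
    · rintro ⟨j, hj⟩
      set b := forcingMean (hq j) (σ, z j σ)
      have hd := hasDerivAt_of_fixedPoint (hq j) (hz j σ hσU).2
      obtain ⟨s₁, s₂, h1⟩ := isConnection_of_near_modelOrbit (x := circlePoint b)
        (hqs j σ hσU) hδ2 hd (fun t => by
          have := ((z j σ).norm_coe_le_norm t).trans (hz j σ hσU).1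
          simpa using this)
      have hu0 := cubeRoot_ne_zero j
      -- Undo scaling and rotation at once: the connection of the normalised field becomes one of
      -- `p` at `x`.
      have h2 := h1.rescale (u := (cubeRoot j)⁻¹) (inv_pos.2 hl0)
        (by rw [inv_pow, cubeRoot_pow, inv_one])
      have e : rescaledField (fun z => q j (σ, z)) l⁻¹ (cubeRoot j)⁻¹ = p := by
        change rescaledField (rescaledField p l (cubeRoot j)) l⁻¹ (cubeRoot j)⁻¹ = p
        rw [rescaledField_rescaledField, mul_inv_cancel₀ hl0.ne', mul_inv_cancel₀ hu0,
          rescaledField_one]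
      have e2 : ((((l⁻¹ : ℝ) : ℂ)) ^ 2 * (cubeRoot j)⁻¹)⁻¹ * circlePoint b = x := by
        have hj' : x = (‖x‖ : ℂ) * (cubeRoot j * circlePoint b) := hj
        rw [hj', ← hl2']
        push_cast
        field_simp
      rw [e, e2] at h2
      exact ⟨_, _, _, h2⟩

end ConnectionLocus

/-! ### Diffeomorphisms rotating each circle around the origin. -/

section Twist

/-- The map rotating each `x` by the angle `ψ x`. -/
noncomputable def twist (ψ : ℂ → ℝ) (x : ℂ) : ℂ := x * Complex.exp (Complex.I * ψ x)

theorem norm_twist (ψ : ℂ → ℝ) (x : ℂ) : ‖twist ψ x‖ = ‖x‖ := by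
  rw [twist, norm_mul, Complex.norm_exp_I_mul_ofReal, mul_one]

theorem norm_exp_I_sub_exp_I_le (a b : ℝ) :
    ‖Complex.exp (Complex.I * a) - Complex.exp (Complex.I * b)‖ ≤ |a - b| := by
  have e : Complex.exp (Complex.I * a) - Complex.exp (Complex.I * b) =
      Complex.exp (Complex.I * b) * (Complex.exp (Complex.I * (a - b : ℝ)) - 1) := by
    rw [mul_sub, ← Complex.exp_add, mul_one]
    congr 2
    push_cast; ring
  rw [e, norm_mul, Complex.norm_exp_I_mul_ofReal, one_mul]
  exact Real.norm_exp_I_mul_ofReal_sub_one_le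

variable {ψ : ℂ → ℝ} {L : ℝ} (hψ : ContDiff ℝ ∞ ψ) (hL : L < 1)
  (hlip : ∀ x y : ℂ, ‖x‖ = ‖y‖ → ‖x‖ * |ψ x - ψ y| ≤ L * ‖x - y‖)

include hL hlip in
-- Twisting preserves norms, so only points of one circle can collide. There the difference of
-- rotation angles moves points by at most `L` times their distance, and `L < 1`.
theorem twist_injective : Function.Injective (twist ψ) := by
  intro x y hxy
  have hn : ‖x‖ = ‖y‖ := by rw [← norm_twist ψ, hxy, norm_twist]
  have e : (x - y) * Complex.exp (Complex.I * ψ y) =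
      x * (Complex.exp (Complex.I * ψ y) - Complex.exp (Complex.I * ψ x)) := by
    unfold twist at hxy
    linear_combination hxy
  have h1 : ‖x - y‖ ≤ ‖x‖ * |ψ x - ψ y| := by
    rw [← mul_one ‖x - y‖, ← Complex.norm_exp_I_mul_ofReal (ψ y), ← norm_mul, e, norm_mul,
      abs_sub_comm]
    gcongr
    exact norm_exp_I_sub_exp_I_le _ _
  have h2 := hlip x y hn
  have h3 := norm_nonneg (x - y)
  exact sub_eq_zero.1 (norm_le_zero_iff.1 (by nlinarith))

include hL hlip in
-- A preimage of `y` is a fixed point of `w ↦ y exp (-i ψ w)`, a contraction of the circle through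
-- `y`.
theorem twist_surjective (hL0 : 0 ≤ L) : Function.Surjective (twist ψ) := by
  intro y
  set T : ℂ → ℂ := fun w => y * Complex.exp (Complex.I * ((-ψ w : ℝ) : ℂ)) with hT
  have hTn : ∀ w, ‖T w‖ = ‖y‖ := fun w => by
    simp only [hT]; rw [norm_mul, Complex.norm_exp_I_mul_ofReal, mul_one]
  have hmaps : Set.MapsTo T (Metric.sphere 0 ‖y‖) (Metric.sphere 0 ‖y‖) := fun w _ => by
    simpa using hTn w
  have hcontr : ContractingWith ⟨L, hL0⟩ (hmaps.restrict T _ _) := by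
    refine ⟨NNReal.coe_lt_coe.1 hL, LipschitzWith.of_dist_le_mul fun u v => ?_⟩
    have hu := mem_sphere_zero_iff_norm.1 u.2
    have hv := mem_sphere_zero_iff_norm.1 v.2
    rw [Subtype.dist_eq, Subtype.dist_eq, dist_eq_norm, dist_eq_norm]
    change ‖T u - T v‖ ≤ L * ‖(u : ℂ) - v‖
    simp only [hT]
    have h := hlip u v (hu.trans hv.symm)
    rw [hu] at h
    rw [← mul_sub, norm_mul]
    refine le_trans ?_ h
    gcongr
    refine (norm_exp_I_sub_exp_I_le _ _).trans ?_
    rw [neg_sub_neg, abs_sub_comm]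
  obtain ⟨w, -, hfix, -⟩ := ContractingWith.exists_fixedPoint' (x := y)
    Metric.isClosed_sphere.isComplete hmaps hcontr (by simp) (edist_ne_top _ _)
  refine ⟨w, ?_⟩
  have hw : T w = w := hfix
  rw [twist]
  nth_rw 1 [← hw]
  simp only [hT]
  rw [mul_assoc, ← Complex.exp_add]
  push_cast
  rw [← mul_add, neg_add_cancel, mul_zero, Complex.exp_zero, mul_one]

include hψ in
theorem contDiff_twist : ContDiff ℝ ∞ (twist ψ) := by
  unfold twist
  exact contDiff_id.mul (contDiff_const.mul (Complex.ofRealCLM.contDiff.comp hψ)).cexp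

include hψ in
theorem hasFDerivAt_twist_apply (x h : ℂ) : fderiv ℝ (twist ψ) x h =
    Complex.exp (Complex.I * ψ x) * (h + Complex.I * x * (fderiv ℝ ψ x h : ℝ)) := by
  have h1 : HasFDerivAt ψ (fderiv ℝ ψ x) x := (hψ.differentiable (by simp) x).hasFDerivAt
  have h2 : HasDerivAt (fun t : ℝ => ψ (x + t • h)) (fderiv ℝ ψ x h) 0 := by
    have hline : HasDerivAt (fun t : ℝ => x + t • h) h 0 := by
      simpa using ((hasDerivAt_id (0 : ℝ)).smul_const h).const_add x
    exact HasFDerivAt.comp_hasDerivAt (0 : ℝ) (by simpa using h1) hline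
  have h3 : HasDerivAt (fun t : ℝ => twist ψ (x + t • h)) (fderiv ℝ (twist ψ) x h) 0 := by
    have hline : HasDerivAt (fun t : ℝ => x + t • h) h 0 := by
      simpa using ((hasDerivAt_id (0 : ℝ)).smul_const h).const_add x
    exact HasFDerivAt.comp_hasDerivAt (0 : ℝ) (by
      simpa using (((contDiff_twist hψ).differentiable (by simp)) x).hasFDerivAt) hline
  have hline : HasDerivAt (fun t : ℝ => x + t • h) h 0 := by
    simpa using ((hasDerivAt_id (0 : ℝ)).smul_const h).const_add x
  have h4 := hline.mul ((h2.ofReal_comp.const_mul Complex.I).cexp)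
  have := h3.unique h4
  rw [this]
  simp
  ring

include hψ hL hlip in
-- A kernel vector is tangent to the circle, `h = i x τ` with `τ = -dψ(h)`. The Lipschitz bound
-- along the circle gives `|τ| ≤ L |τ|`, so `τ = 0`.
theorem fderiv_twist_injective (hL0 : 0 ≤ L) (x : ℂ) :
    Function.Injective (fderiv ℝ (twist ψ) x) := by
  rw [injective_iff_map_eq_zero]
  intro h hh
  rw [hasFDerivAt_twist_apply hψ, mul_eq_zero, or_iff_right (Complex.exp_ne_zero _)] at hh
  set τ := -(fderiv ℝ ψ x h) with hτ
  have hhx : h = Complex.I * x * (τ : ℂ) := by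
    rw [hτ]; push_cast; linear_combination hh
  have hcirc : HasDerivAt (fun t : ℝ => x * Complex.exp (Complex.I * ((τ * t : ℝ) : ℂ))) h 0 := by
    have h1 : HasDerivAt (fun t : ℝ => τ * t) τ 0 := by
      simpa using (hasDerivAt_id (0 : ℝ)).const_mul τ
    refine (((h1.ofReal_comp.const_mul Complex.I).cexp).const_mul x).congr_deriv ?_
    rw [hhx]; simp; ring
  have hder : HasDerivAt (fun t : ℝ => ψ (x * Complex.exp (Complex.I * ((τ * t : ℝ) : ℂ))))
      (fderiv ℝ ψ x h) 0 :=
    HasFDerivAt.comp_hasDerivAt (0 : ℝ)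
      (by simpa using (hψ.differentiable (by simp) x).hasFDerivAt) hcirc
  by_cases hx : x = 0
  · rw [hhx, hx]; simp
  have hxn : 0 < ‖x‖ := norm_pos_iff.2 hx
  have hbd : ‖fderiv ℝ ψ x h‖ ≤ L * |τ| := by
    refine hder.le_of_lip' (by positivity) (Eventually.of_forall fun t => ?_)
    set y := x * Complex.exp (Complex.I * ((τ * t : ℝ) : ℂ)) with hy
    have hyn : ‖y‖ = ‖x‖ := by rw [hy, norm_mul, Complex.norm_exp_I_mul_ofReal, mul_one]
    have h1 := hlip y x hyn
    have h2 : ‖y - x‖ ≤ ‖x‖ * (|τ| * |t|) := by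
      have := norm_exp_I_sub_exp_I_le (τ * t) 0
      simp only [Complex.ofReal_zero, mul_zero, Complex.exp_zero, sub_zero, abs_mul] at this
      rw [hy, ← mul_sub_one, norm_mul]
      gcongr
    rw [hyn] at h1
    have h3 : ‖x‖ * |ψ y - ψ x| ≤ ‖x‖ * (L * (|τ| * |t|)) := by
      refine h1.trans ?_
      calc L * ‖y - x‖ ≤ L * (‖x‖ * (|τ| * |t|)) := by gcongr
        _ = _ := by ring
    have h4 := le_of_mul_le_mul_left h3 hxn
    simpa [mul_assoc] using h4
  have h5 : |τ| ≤ L * |τ| := by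
    rw [hτ, abs_neg] at hbd ⊢; exact hbd
  have h6 : τ = 0 := by
    have := abs_nonneg τ
    exact abs_eq_zero.1 (by nlinarith)
  rw [hhx, h6]; simp

include hψ hL hlip in
theorem exists_diffeomorph_twist (hL0 : 0 ≤ L) :
    ∃ Φ : Diffeomorph 𝓘(ℝ, ℂ) 𝓘(ℝ, ℂ) ℂ ℂ ∞, ∀ x, Φ x = twist ψ x := by
  set A : ℂ → ℂ ≃L[ℝ] ℂ := fun x =>
    (LinearEquiv.ofInjectiveEndo (fderiv ℝ (twist ψ) x : ℂ →ₗ[ℝ] ℂ)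
      (fderiv_twist_injective hψ hL hlip hL0 x)).toContinuousLinearEquiv
  have hA : ∀ x, ((A x : ℂ ≃L[ℝ] ℂ) : ℂ →L[ℝ] ℂ) = fderiv ℝ (twist ψ) x := fun x => by
    ext; rfl
  have hc := contDiff_twist hψ
  have hstrict : ∀ x, HasStrictFDerivAt (twist ψ) (A x : ℂ →L[ℝ] ℂ) x := fun x => by
    rw [hA]; exact hc.contDiffAt.hasStrictFDerivAt (by simp)
  set e : ℂ ≃ₜ ℂ := (Equiv.ofBijective (twist ψ) ⟨twist_injective hL hlip,
    twist_surjective hL hlip hL0⟩).toHomeomorphOfContinuousOpen hc.continuous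
    (isOpenMap_of_hasStrictFDerivAt_equiv hstrict)
  have hsymm : ContDiff ℝ ∞ e.symm :=
    e.contDiff_symm (f₀' := A) (fun x => (hstrict x).hasFDerivAt) hc
  exact ⟨⟨e.toEquiv, hc.contMDiff, hsymm.contMDiff⟩, fun x => rfl⟩

end Twist

/-! ### Carrying the three rays to the three curves. -/

section RayStraightening

theorem circlePoint_eq_exp {b : ℝ} (hb : |b| ≤ 1) :
    circlePoint b = Complex.exp (Complex.I * (Real.arcsin b : ℂ)) := by
  rw [mul_comm, Complex.exp_mul_I, ← Complex.ofReal_cos, ← Complex.ofReal_sin, Real.cos_arcsin,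
    Real.sin_arcsin (abs_le.1 hb).1 (abs_le.1 hb).2, circlePoint]
  ring

theorem abs_arcsin_le {b : ℝ} (hb : |b| ≤ 1) : |Real.arcsin b| ≤ 2 * |b| := by
  have h1 := Real.mul_abs_le_abs_sin (abs_le.2 ⟨Real.neg_pi_div_two_le_arcsin b,
    Real.arcsin_le_pi_div_two b⟩)
  rw [Real.sin_arcsin (abs_le.1 hb).1 (abs_le.1 hb).2] at h1
  have h2 : 1 / 2 ≤ 2 / Real.pi := by
    rw [div_le_div_iff₀ two_pos Real.pi_pos]
    linarith [Real.pi_le_four]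
  nlinarith [abs_nonneg (Real.arcsin b)]

theorem cubeRoot_mul_conj_re (i j : Fin 3) :
    (cubeRoot i * conj (cubeRoot j)).re = if i = j then 1 else -1 / 2 := by
  have h := Real.mul_self_sqrt (show (0 : ℝ) ≤ 3 by norm_num)
  fin_cases i <;> fin_cases j <;> simp [cubeRoot, primitiveCubeRoot] <;> nlinarith

/-- There is a diffeomorphism of the plane, preserving the distance to the origin, that takes the
three model rays to prescribed curves that are graphs over them in polar coordinates. -/
theorem exists_diffeomorph_rays {b : Fin 3 → ℝ → ℝ} {r₀ r₁ : ℝ} (hr₀ : 0 < r₀) (hr : r₀ < r₁)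
    (hb : ∀ j r, r₀ < r → ContDiffAt ℝ ∞ (b j) r ∧ |b j r| ≤ 1 / 200) :
    ∃ Φ : Diffeomorph 𝓘(ℝ, ℂ) 𝓘(ℝ, ℂ) ℂ ℂ ∞, (∀ x, ‖Φ x‖ = ‖x‖) ∧
      ∀ j (r : ℝ), r₁ ≤ r → Φ ((r : ℂ) * cubeRoot j) =
        (r : ℂ) * (cubeRoot j * circlePoint (b j r)) := by
  set m := (r₀ + r₁) / 2 with hm
  -- The cut-off vanishes up to the midpoint `m`, because `b` is controlled only beyond `r₀` and
  -- polar coordinates are singular at 0; it equals 1 from `r₁` on.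
  set θ : Fin 3 → ℝ → ℝ := fun j r =>
    Real.smoothTransition ((r - m) / (r₁ - m)) * Real.arcsin (b j r) with hθ
  have hm1 : 0 < r₁ - m := by rw [hm]; linarith
  have hm0 : r₀ < m := by rw [hm]; linarith
  have hθ0 : ∀ j r, r ≤ m → θ j r = 0 := fun j r hrm => by
    simp only [hθ]
    rw [Real.smoothTransition.zero_of_nonpos (div_nonpos_of_nonpos_of_nonneg (by linarith) hm1.le),
      zero_mul]
  have hθ1 : ∀ j r, r₁ ≤ r → θ j r = Real.arcsin (b j r) := fun j r hr1 => by
    simp only [hθ]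
    rw [Real.smoothTransition.one_of_one_le ((one_le_div hm1).2 (by linarith)), one_mul]
  have hθb : ∀ j r, |θ j r| ≤ 1 / 100 := fun j r => by
    rcases le_or_gt r m with h | h
    · rw [hθ0 j r h]; norm_num
    · have h1 := (hb j r (hm0.trans h)).2
      have h2 := abs_arcsin_le (h1.trans (by norm_num))
      simp only [hθ]
      rw [abs_mul, abs_of_nonneg (Real.smoothTransition.nonneg _)]
      have h3 := Real.smoothTransition.le_one ((r - m) / (r₁ - m))
      have h4 := Real.smoothTransition.nonneg ((r - m) / (r₁ - m))
      nlinarith [abs_nonneg (Real.arcsin (b j r))]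
  have hθc : ∀ j r, r₀ < r → ContDiffAt ℝ ∞ (θ j) r := fun j r h => by
    have h1 := (hb j r h).2
    have h2 := abs_le.1 h1
    have hlin : ContDiffAt ℝ ∞ (fun r : ℝ => (r - m) / (r₁ - m)) r :=
      (contDiffAt_id.sub contDiffAt_const).div_const _
    refine ContDiffAt.mul (Real.smoothTransition.contDiff.contDiffAt.comp r hlin) ?_
    exact (Real.contDiffAt_arcsin (by linarith) (by linarith)).comp r (hb j r h).1
  -- The weight `(2 cos α + 1)/3`, with `α` the angle from the ray of `cubeRoot j`, is 1 on that ray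
  -- and 0 on the other two, where `cos α = -1/2`.
  set ψ : ℂ → ℝ := fun x => ∑ j, θ j ‖x‖ * ((2 * ((x * conj (cubeRoot j)).re / ‖x‖) + 1) / 3)
    with hψ
  have hψ0 : ∀ x : ℂ, ‖x‖ ≤ m → ψ x = 0 := fun x hx => by
    simp only [hψ]
    exact Finset.sum_eq_zero fun j _ => by rw [hθ0 j _ hx, zero_mul]
  have hψc : ContDiff ℝ ∞ ψ := by
    rw [contDiff_iff_contDiffAt]
    intro x
    rcases lt_or_ge ‖x‖ m with h | h
    · refine (contDiffAt_const (c := (0 : ℝ))).congr_of_eventuallyEq ?_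
      filter_upwards [continuous_norm.continuousAt.eventually_lt continuousAt_const h] with y hy
      exact hψ0 y hy.le
    · have hx0 : x ≠ 0 := by
        rintro rfl; rw [norm_zero] at h; linarith
      have hn : ContDiffAt ℝ ∞ (fun x : ℂ => ‖x‖) x := contDiffAt_norm ℝ hx0
      refine ContDiffAt.sum fun j _ => ?_
      refine ContDiffAt.mul ((hθc j _ (hm0.trans_le h)).comp x hn) ?_
      have hre : ContDiffAt ℝ ∞ (fun x : ℂ => (x * conj (cubeRoot j)).re) x :=
        Complex.reCLM.contDiff.contDiffAt.comp x (contDiffAt_id.mul contDiffAt_const)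
      exact (((contDiffAt_const.mul (hre.div hn (norm_ne_zero_iff.2 hx0))).add
        contDiffAt_const).div_const 3)
  have hlip : ∀ x y : ℂ, ‖x‖ = ‖y‖ → ‖x‖ * |ψ x - ψ y| ≤ 1 / 50 * ‖x - y‖ := by
    intro x y hxy
    by_cases hx : ‖x‖ = 0
    · rw [hx, zero_mul]; positivity
    have hx' : 0 < ‖x‖ := lt_of_le_of_ne (norm_nonneg x) (Ne.symm hx)
    -- On a circle the weights are affine in `x`, so the difference is linear in `x - y`; three
    -- terms of size `1/100 · 2/3` give `1/50`.
    have e : ‖x‖ * (ψ x - ψ y) =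
        ∑ j, θ j ‖x‖ * (2 / 3 * ((x - y) * conj (cubeRoot j)).re) := by
      simp only [hψ]
      rw [← hxy, ← Finset.sum_sub_distrib, Finset.mul_sum]
      refine Finset.sum_congr rfl fun j _ => ?_
      rw [sub_mul, Complex.sub_re]
      field_simp
      ring
    have e' : ‖x‖ * |ψ x - ψ y| = |‖x‖ * (ψ x - ψ y)| := by rw [abs_mul, abs_of_pos hx']
    rw [e', e]
    refine (Finset.abs_sum_le_sum_abs _ _).trans ?_
    have hterm : ∀ j ∈ (Finset.univ : Finset (Fin 3)),
        |θ j ‖x‖ * (2 / 3 * ((x - y) * conj (cubeRoot j)).re)| ≤ 1 / 150 * ‖x - y‖ := by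
      intro j _
      have h1 := Complex.abs_re_le_norm ((x - y) * conj (cubeRoot j))
      rw [norm_mul, Complex.norm_conj, norm_cubeRoot, mul_one] at h1
      rw [abs_mul (θ j ‖x‖), abs_mul (2 / 3 : ℝ), abs_of_pos (show (0 : ℝ) < 2 / 3 by norm_num)]
      calc _ ≤ 1 / 100 * (2 / 3 * ‖x - y‖) := by
            gcongr
            exact hθb j _
        _ = _ := by ring
    refine (Finset.sum_le_sum hterm).trans ?_
    simp
    linarith
  obtain ⟨Φ, hΦ⟩ := exists_diffeomorph_twist hψc (by norm_num) hlip (by norm_num)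
  refine ⟨Φ, fun x => by rw [hΦ, norm_twist], fun j r hr1 => ?_⟩
  have hr0 : 0 < r := by linarith
  have hn : ‖(r : ℂ) * cubeRoot j‖ = r := by
    rw [norm_mul, norm_cubeRoot, mul_one, Complex.norm_real, Real.norm_of_nonneg hr0.le]
  have hψv : ψ ((r : ℂ) * cubeRoot j) = Real.arcsin (b j r) := by
    simp only [hψ]
    rw [hn, ← hθ1 j r hr1]
    have : ∀ i, θ i r * ((2 * (((r : ℂ) * cubeRoot j * conj (cubeRoot i)).re / r) + 1) / 3) =
        if j = i then θ i r else 0 := fun i => by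
      have hre : ((r : ℂ) * cubeRoot j * conj (cubeRoot i)).re =
          r * (cubeRoot j * conj (cubeRoot i)).re := by rw [mul_assoc, Complex.re_ofReal_mul]
      rw [hre, cubeRoot_mul_conj_re]
      split_ifs
      · field_simp; norm_num
      · field_simp; norm_num
    simp only [this]
    simp
  rw [hΦ, twist, hψv, circlePoint_eq_exp (((hb j r (by linarith)).2).trans (by norm_num)), mul_assoc]

end RayStraightening

/-! ### Translation between the Euclidean plane and ℂ. -/

section PlaneTransfer

/-- The standard isometric identification of the complex numbers with the Euclidean plane. -/
noncomputable def planeEquiv : ℂ ≃ₗᵢ[ℝ] Plane := Complex.orthonormalBasisOneI.repr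

@[simp] theorem planeEquiv_apply_zero (z : ℂ) : planeEquiv z 0 = z.re := by
  simp [planeEquiv, Complex.orthonormalBasisOneI]

@[simp] theorem planeEquiv_apply_one (z : ℂ) : planeEquiv z 1 = z.im := by
  simp [planeEquiv, Complex.orthonormalBasisOneI]

theorem inner_planeEquiv (z w : ℂ) :
    inner ℝ (planeEquiv z) (planeEquiv w) = z.re * w.re + z.im * w.im := by
  rw [LinearIsometryEquiv.inner_map_map, Complex.inner]
  simp
  ring

/-- The gradient of a function on the plane, in complex notation. -/
noncomputable def complexGradient (g : Plane → ℝ) (z : ℂ) : ℂ :=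
  (fderiv ℝ g (planeEquiv z) (planeEquiv 1) : ℂ) +
    (fderiv ℝ g (planeEquiv z) (planeEquiv Complex.I) : ℂ) * Complex.I

theorem complexGradient_re (g : Plane → ℝ) (z : ℂ) :
    (complexGradient g z).re = fderiv ℝ g (planeEquiv z) (planeEquiv 1) := by
  simp [complexGradient]

theorem complexGradient_im (g : Plane → ℝ) (z : ℂ) :
    (complexGradient g z).im = fderiv ℝ g (planeEquiv z) (planeEquiv Complex.I) := by
  simp [complexGradient]

variable {f : Plane → ℝ} {ε : ℝ} {x : Plane}

theorem contDiff_complexGradient (hf : ContDiff ℝ ∞ f) : ContDiff ℝ ∞ (complexGradient f) := by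
  have h1 : ContDiff ℝ ∞ fun z => fderiv ℝ f (planeEquiv z) :=
    (hf.fderiv_right (m := ∞) le_rfl).comp planeEquiv.contDiff
  exact (Complex.ofRealCLM.contDiff.comp (h1.clm_apply contDiff_const)).add
    ((Complex.ofRealCLM.contDiff.comp (h1.clm_apply contDiff_const)).mul contDiff_const)

/-- Each of the two components contributes at most `ε / 2`. -/
theorem isSmallField_complexGradient (hf : ContDiff ℝ ∞ f)
    (h1 : ∀ y, ‖iteratedFDeriv ℝ 1 f y‖ ≤ ε / 2) (h2 : ∀ y, ‖iteratedFDeriv ℝ 2 f y‖ ≤ ε / 2) :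
    IsSmallField (complexGradient f) ε := by
  have hn : ∀ a b : ℝ, ‖(a : ℂ) + (b : ℂ) * Complex.I‖ ≤ |a| + |b| := fun a b =>
    (norm_add_le _ _).trans (by simp)
  have hf1 : ∀ y, ‖fderiv ℝ f y‖ ≤ ε / 2 := fun y => by
    have := h1 y
    rwa [← norm_iteratedFDeriv_fderiv (n := 0), norm_iteratedFDeriv_zero] at this
  have hf2 : ∀ y, ‖fderiv ℝ (fderiv ℝ f) y‖ ≤ ε / 2 := fun y => by
    have := h2 y
    rwa [← norm_iteratedFDeriv_fderiv (n := 1), ← norm_iteratedFDeriv_fderiv (n := 0),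
      norm_iteratedFDeriv_zero] at this
  refine ⟨contDiff_complexGradient hf, fun z => (hn _ _).trans ?_, fun z => ?_⟩
  · have ha := (fderiv ℝ f (planeEquiv z)).le_of_opNorm_le (hf1 _) (planeEquiv 1)
    have hb := (fderiv ℝ f (planeEquiv z)).le_of_opNorm_le (hf1 _) (planeEquiv Complex.I)
    simp only [LinearIsometryEquiv.norm_map, norm_one, Complex.norm_I, Real.norm_eq_abs] at ha hb
    linarith
  · set D := fderiv ℝ (fderiv ℝ f) (planeEquiv z) with hD
    have hd : HasFDerivAt (fun z => fderiv ℝ f (planeEquiv z))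
        (D.comp (planeEquiv.toContinuousLinearEquiv : ℂ →L[ℝ] Plane)) z :=
      (((hf.fderiv_right (m := ∞) le_rfl).differentiable (by simp)) _).hasFDerivAt.comp z
        planeEquiv.toContinuousLinearEquiv.hasFDerivAt
    have hv : ∀ v : Plane, HasFDerivAt (fun z => ((fderiv ℝ f (planeEquiv z) v : ℝ) : ℂ))
        (Complex.ofRealCLM.comp (((ContinuousLinearMap.apply ℝ ℝ v)).comp
          (D.comp (planeEquiv.toContinuousLinearEquiv : ℂ →L[ℝ] Plane)))) z := fun v =>
      Complex.ofRealCLM.hasFDerivAt.comp z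
        ((ContinuousLinearMap.apply ℝ ℝ v).hasFDerivAt.comp z hd)
    have h := (hv (planeEquiv 1)).add ((hv (planeEquiv Complex.I)).mul_const Complex.I)
    have h' : fderiv ℝ (complexGradient f) z = _ := h.fderiv
    have hε : 0 ≤ ε / 2 := (norm_nonneg _).trans (h1 0)
    rw [h']
    refine ContinuousLinearMap.opNorm_le_bound _ (by linarith) fun w => ?_
    have e : ‖D (planeEquiv w)‖ ≤ ε / 2 * ‖w‖ := by
      simpa using D.le_of_opNorm_le (hf2 _) (planeEquiv w)
    have ha := (D (planeEquiv w)).le_of_opNorm_le e (planeEquiv 1)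
    have hb := (D (planeEquiv w)).le_of_opNorm_le e (planeEquiv Complex.I)
    simp only [LinearIsometryEquiv.norm_map, norm_one, Complex.norm_I, Real.norm_eq_abs] at ha hb
    have hh := hn (D (planeEquiv w) (planeEquiv 1)) (D (planeEquiv w) (planeEquiv Complex.I))
    refine le_trans (le_of_eq ?_) (hh.trans (by linarith))
    congr 1
    simp [mul_comm]

theorem gradient_tilt (hf : Differentiable ℝ f) (x : Plane) (z : ℂ) :
    gradient (tilt (fun y => ellipticUmbilic y + f y) x) (planeEquiv z) =
      planeEquiv (umbilicField (complexGradient f) (planeEquiv.symm x) z) := by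
  apply HasGradientAt.gradient
  rw [hasGradientAt_iff_hasFDerivAt]
  have hp : ∀ i : Fin 2, HasFDerivAt (fun y : Plane => y i)
      (EuclideanSpace.proj i : Plane →L[ℝ] ℝ) (planeEquiv z) := fun i =>
    (EuclideanSpace.proj i : Plane →L[ℝ] ℝ).hasFDerivAt
  have h1 := ((((hp 0).pow 3).const_mul (1 / 3)).sub ((hp 0).mul ((hp 1).pow 2))).add
    (hf (planeEquiv z)).hasFDerivAt
  have h2 := h1.sub (innerSL ℝ x).hasFDerivAt
  refine h2.congr_fderiv ?_
  ext w
  obtain ⟨w, rfl⟩ := planeEquiv.surjective w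
  obtain ⟨x, rfl⟩ := planeEquiv.surjective x
  have hw : fderiv ℝ f (planeEquiv z) (planeEquiv w) =
      (complexGradient f z).re * w.re + (complexGradient f z).im * w.im := by
    have : planeEquiv w = w.re • planeEquiv 1 + w.im • planeEquiv Complex.I := by
      rw [← map_smul, ← map_smul, ← map_add]
      congr 1
      simp [Complex.re_add_im]
    rw [this, map_add, map_smul, map_smul, complexGradient_re, complexGradient_im]
    simp [mul_comm]
  rw [InnerProductSpace.toDual_apply_apply, inner_planeEquiv]
  simp only [sub_apply, add_apply, smul_apply, innerSL_apply_apply, inner_planeEquiv, hw,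
    LinearIsometryEquiv.symm_apply_apply, umbilicField]
  simp [pow_two]
  ring

theorem fderiv_gradient_tilt (hf : ContDiff ℝ ∞ f) (x : Plane) (z h : ℂ) :
    fderiv ℝ (gradient (tilt (fun y => ellipticUmbilic y + f y) x)) (planeEquiv z) (planeEquiv h) =
      planeEquiv (2 * conj z * conj h + fderiv ℝ (complexGradient f) z h) := by
  have e : gradient (tilt (fun y => ellipticUmbilic y + f y) x) = fun y =>
      planeEquiv (umbilicField (complexGradient f) (planeEquiv.symm x) (planeEquiv.symm y)) := by
    funext y
    rw [← gradient_tilt (hf.differentiable (by simp)), LinearIsometryEquiv.apply_symm_apply]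
  have hc : HasFDerivAt (fun z : ℂ => conj z) (Complex.conjCLE : ℂ →L[ℝ] ℂ) z :=
    Complex.conjCLE.hasFDerivAt
  have hu := ((hc.pow 2).sub_const (planeEquiv.symm x)).add
    ((contDiff_complexGradient hf).differentiable (by simp) z).hasFDerivAt
  have hz : planeEquiv.symm (planeEquiv z) = z := LinearIsometryEquiv.symm_apply_apply _ _
  have h3 := planeEquiv.toContinuousLinearEquiv.hasFDerivAt.comp (planeEquiv z)
    (HasFDerivAt.comp (planeEquiv z) (hz.symm ▸ hu) planeEquiv.symm.toContinuousLinearEquiv.hasFDerivAt)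
  have h4 := h3.fderiv
  rw [e]
  refine (DFunLike.congr_fun h4 (planeEquiv h)).trans ?_
  simp

/-- At a zero, `‖s‖² ≥ ‖x‖ - ε > 4ε²`, so `2 conj s conj h` dominates the derivative of the
perturbation and the Hessian has negative determinant. This is why `IsConnection` asks only for
zeros. -/
theorem isSaddle_of_umbilicField_eq_zero {s : ℂ} (hf : ContDiff ℝ ∞ f)
    (hp : IsSmallField (complexGradient f) ε) (hx : ε + 4 * ε ^ 2 < ‖x‖)
    (hs : umbilicField (complexGradient f) (planeEquiv.symm x) s = 0) :
    IsSaddle (tilt (fun y => ellipticUmbilic y + f y) x) (planeEquiv s) := by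
  have hsn : 4 * ε ^ 2 < ‖s‖ ^ 2 := by
    have h1 : planeEquiv.symm x = conj s ^ 2 + complexGradient f s := by
      unfold umbilicField at hs
      linear_combination -hs
    have h2 : ‖x‖ ≤ ‖s‖ ^ 2 + ε := by
      rw [← planeEquiv.symm.norm_map x, h1]
      refine (norm_add_le _ _).trans ?_
      rw [norm_pow, Complex.norm_conj]
      linarith [hp.norm_le s]
    linarith
  have hε := hp.nonneg
  have hs2 : 2 * ε < ‖s‖ := lt_of_pow_lt_pow_left₀ 2 (norm_nonneg s) (by linarith)
  have hs0 : s ≠ 0 := norm_pos_iff.1 (by linarith)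
  set L : ℂ →ₗ[ℝ] ℂ := (planeEquiv.symm.toLinearEquiv : Plane →ₗ[ℝ] ℂ) ∘ₗ
    ((fderiv ℝ (gradient (tilt (fun y => ellipticUmbilic y + f y) x)) (planeEquiv s) :
      Plane →ₗ[ℝ] Plane) ∘ₗ (planeEquiv.toLinearEquiv : ℂ →ₗ[ℝ] Plane)) with hL
  have hLe : ∀ h, L h = planeEquiv.symm (fderiv ℝ
      (gradient (tilt (fun y => ellipticUmbilic y + f y) x)) (planeEquiv s) (planeEquiv h)) :=
    fun h => rfl
  have hdet : (conj (L 1) * L Complex.I).im < 0 := by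
    refine det_neg_of_near_conj (D := (fderiv ℝ (complexGradient f) s : ℂ →ₗ[ℝ] ℂ))
      (β := 2 * conj s) (k := ε)
      (fun h => ContinuousLinearMap.le_of_opNorm_le _ (hp.norm_fderiv_le s) h) (fun h => ?_) hε ?_ ?_
    · rw [hLe, fderiv_gradient_tilt hf, LinearIsometryEquiv.symm_apply_apply]
      rfl
    · rw [norm_mul, Complex.norm_conj, Complex.norm_ofNat]
      linarith
    · simpa using hs0
  have heig : ∀ a : ℝ, (∃ v ≠ 0, L v = a • v) → Module.End.HasEigenvalue
      (fderiv ℝ (gradient (tilt (fun y => ellipticUmbilic y + f y) x)) (planeEquiv s) :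
        Plane →ₗ[ℝ] Plane) a := by
    rintro a ⟨v, hv, hLv⟩
    refine Module.End.hasEigenvalue_of_hasEigenvector (x := planeEquiv v)
      ⟨Module.End.mem_eigenspace_iff.2 ?_, by simpa using hv⟩
    rw [hLe, LinearIsometryEquiv.symm_apply_eq, map_smul] at hLv
    exact hLv
  obtain ⟨⟨a, ha, hav⟩, b, hb, hbv⟩ := exists_eigenvectors_of_det_neg L hdet
  refine ⟨?_, ⟨a, ha, heig a hav⟩, b, hb, heig b hbv⟩
  rw [gradient_tilt (hf.differentiable (by simp)), hs, map_zero]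

theorem mem_bifurcationLocus_iff (hf : ContDiff ℝ ∞ f)
    (hp : IsSmallField (complexGradient f) ε) (hx : ε + 4 * ε ^ 2 < ‖x‖) :
    x ∈ bifurcationLocus (fun y => ellipticUmbilic y + f y) ↔
      ∃ γ s₁ s₂, IsConnection (complexGradient f) (planeEquiv.symm x) γ s₁ s₂ := by
  have hd := hf.differentiable (by simp)
  have hg : ∀ y, gradient (tilt (fun y => ellipticUmbilic y + f y) x) y = planeEquiv
      (umbilicField (complexGradient f) (planeEquiv.symm x) (planeEquiv.symm y)) := fun y => by
    rw [← gradient_tilt hd, LinearIsometryEquiv.apply_symm_apply]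
  constructor
  · rintro ⟨s₁, s₂, hne, h1, h2, γ, hγ, hb, ht⟩
    refine ⟨fun t => planeEquiv.symm (γ t), planeEquiv.symm s₁, planeEquiv.symm s₂, ?_⟩
    refine ⟨planeEquiv.symm.injective.ne hne, ?_, ?_, fun t => ?_, ?_, ?_⟩
    · simpa [hg] using h1.1
    · simpa [hg] using h2.1
    · have h := planeEquiv.symm.toContinuousLinearEquiv.hasFDerivAt.comp_hasDerivAt t (hγ t)
      refine h.congr_deriv ?_
      simp [hg]
    · exact (planeEquiv.symm.continuous.tendsto _).comp hb
    · exact (planeEquiv.symm.continuous.tendsto _).comp ht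
  · rintro ⟨γ, s₁, s₂, h⟩
    refine ⟨planeEquiv s₁, planeEquiv s₂, planeEquiv.injective.ne h.ne,
      isSaddle_of_umbilicField_eq_zero hf hp hx h.zero_left,
      isSaddle_of_umbilicField_eq_zero hf hp hx h.zero_right,
      fun t => planeEquiv (γ t), fun t => ?_, ?_, ?_⟩
    · have h := planeEquiv.toContinuousLinearEquiv.hasFDerivAt.comp_hasDerivAt t (h.hasDerivAt t)
      refine h.congr_deriv ?_
      simp [gradient_tilt hd]
    · exact (planeEquiv.continuous.tendsto _).comp h.tendsto_atBot
    · exact (planeEquiv.continuous.tendsto _).comp h.tendsto_atTop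

/-- Outside a disc of radius `r₁`, the bifurcation locus of a small perturbation of the elliptic
umbilic is the image of three straight rays under a norm-preserving diffeomorphism. -/
theorem exists_diffeomorph_bifurcationLocus {K r₀ r₁ : ℝ} (hf : ContDiff ℝ ∞ f)
    (hp : IsSmallField (complexGradient f) ε) (hr₀ : 0 < r₀) (hr : r₀ < r₁)
    (hK1 : r₀⁻¹ ≤ K) (hK2 : (√r₀)⁻¹ ≤ K) (hKε : K * ε ≤ 1 / 10 ^ 11) (hε : ε + 4 * ε ^ 2 ≤ r₀) :
    ∃ Φ : Diffeomorph 𝓘(ℝ, ℂ) 𝓘(ℝ, Plane) ℂ Plane ∞, (∀ z, ‖Φ z‖ = ‖z‖) ∧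
      ∀ z, r₁ ≤ ‖z‖ → (Φ z ∈ bifurcationLocus (fun y => ellipticUmbilic y + f y) ↔
        ∃ j, z = ‖z‖ * cubeRoot j) := by
  obtain ⟨b, hb, hiff⟩ := exists_connection_iff hp hr₀ hK1 hK2 hKε
  obtain ⟨Φ, hΦn, hΦ⟩ := exists_diffeomorph_rays hr₀ hr hb
  refine ⟨Φ.trans planeEquiv.toContinuousLinearEquiv.toDiffeomorph, fun z => ?_, fun z hz => ?_⟩
  · change ‖planeEquiv (Φ z)‖ = ‖z‖
    rw [LinearIsometryEquiv.norm_map, hΦn]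
  · change planeEquiv (Φ z) ∈ _ ↔ _
    have hzn : ‖planeEquiv (Φ z)‖ = ‖z‖ := by rw [LinearIsometryEquiv.norm_map, hΦn]
    rw [mem_bifurcationLocus_iff hf hp (by rw [hzn]; linarith),
      LinearIsometryEquiv.symm_apply_apply, hiff _ (by rw [hΦn]; linarith), hΦn]
    refine exists_congr fun j => ?_
    rw [← hΦ j _ hz]
    exact Φ.injective.eq_iff

end PlaneTransfer

/-! ### Choice of constants and conclusion. -/

theorem image_closedBall_of_norm_eq {E F : Type*} [NormedAddCommGroup E] [NormedAddCommGroup F]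
    (Φ : E ≃ F) (h : ∀ x, ‖Φ x‖ = ‖x‖) (R : ℝ) :
    Φ '' Metric.closedBall 0 R = Metric.closedBall 0 R := by
  ext y
  obtain ⟨x, rfl⟩ := Φ.surjective y
  simp [h]

theorem mainTheorem4 (R₀ : ℝ) (hR₀ : 0 < R₀) :
    ∃ (k : ℕ) (ε : ℝ), 0 < ε ∧
      ∀ f' : Plane → ℝ, ContDiff ℝ ∞ f' → HasCompactSupport f' →
        (∀ j : ℕ, j ≤ k → ∀ y : Plane, ‖iteratedFDeriv ℝ j f' y‖ ≤ ε) →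
        ∀ R : ℝ, R₀ ≤ R →
          ∃ Φ : Diffeomorph 𝓘(ℝ, Plane) 𝓘(ℝ, Plane) Plane Plane ∞,
            Φ '' Metric.closedBall (0 : Plane) R = Metric.closedBall (0 : Plane) R ∧
            Φ '' (bifurcationLocus ellipticUmbilic \ Metric.closedBall (0 : Plane) R) =
              bifurcationLocus (fun y => ellipticUmbilic y + f' y) \
                Metric.closedBall (0 : Plane) R := by
  have hr₀ : 0 < R₀ / 2 := by linarith
  -- The curves are described beyond `R₀ / 2`, leaving the annulus up to `R₀` for the cut-off. `K`
  -- bounds the factors by which rescaling to `‖x‖ = 1` enlarges the perturbation and its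
  -- derivative.
  set K : ℝ := max (R₀ / 2)⁻¹ (√(R₀ / 2))⁻¹ with hK
  have hK0 : 0 < K := lt_max_of_lt_left (inv_pos.2 hr₀)
  set η : ℝ := min (1 / 10 ^ 11 / K) (min 1 (R₀ / 10)) with hη
  have hη0 : 0 < η := by positivity
  have hKη : K * η ≤ 1 / 10 ^ 11 := by
    rw [mul_comm, ← le_div_iff₀ hK0]
    exact min_le_left _ _
  have hη1 : η ≤ 1 := (min_le_right _ _).trans (min_le_left _ _)
  have hη2 : η ≤ R₀ / 10 := (min_le_right _ _).trans (min_le_right _ _)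
  have hη3 : η + 4 * η ^ 2 ≤ R₀ / 2 := by nlinarith
  -- C¹ smallness of the gradient of `f'` involves its derivatives of orders 1 and 2 only.
  refine ⟨2, η / 2, by linarith, fun f hf _ hfb R hR => ?_⟩
  have main : ∀ g : Plane → ℝ, ContDiff ℝ ∞ g →
      (∀ j : ℕ, j ≤ 2 → ∀ y : Plane, ‖iteratedFDeriv ℝ j g y‖ ≤ η / 2) →
      ∃ Φ : Diffeomorph 𝓘(ℝ, ℂ) 𝓘(ℝ, Plane) ℂ Plane ∞, (∀ z, ‖Φ z‖ = ‖z‖) ∧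
        ∀ z, R₀ ≤ ‖z‖ → (Φ z ∈ bifurcationLocus (fun y => ellipticUmbilic y + g y) ↔
          ∃ j, z = ‖z‖ * cubeRoot j) := fun g hg hgb =>
    exists_diffeomorph_bifurcationLocus hg
      (isSmallField_complexGradient hg (hgb 1 (by norm_num)) (hgb 2 le_rfl)) hr₀ (by linarith)
      (le_max_left _ _) (le_max_right _ _) hKη hη3
  -- Both loci are images of the same three rays: `Φ` serves the perturbed function and `Ψ` the
  -- unperturbed one, so `Φ ∘ Ψ⁻¹` matches them.
  obtain ⟨Φ, hΦn, hΦ⟩ := main f hf hfb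
  obtain ⟨Ψ, hΨn, hΨ⟩ := main (fun _ => 0) contDiff_const fun j _ y => by
    have : iteratedFDeriv ℝ j (fun _ : Plane => (0 : ℝ)) = 0 := iteratedFDeriv_fun_zero
    rw [this]
    simpa using (half_pos hη0).le
  simp only [add_zero] at hΨ
  have hn : ∀ x, ‖(Ψ.symm.trans Φ) x‖ = ‖x‖ := fun x => by
    change ‖Φ (Ψ.symm x)‖ = _
    rw [hΦn, ← hΨn, Ψ.apply_symm_apply]
  refine ⟨Ψ.symm.trans Φ, image_closedBall_of_norm_eq (Ψ.symm.trans Φ).toEquiv hn R, ?_⟩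
  ext y
  obtain ⟨z, rfl : Φ z = y⟩ := Φ.surjective y
  have hzn : ∀ u : ℂ, R < ‖u‖ → (Ψ u ∈ bifurcationLocus ellipticUmbilic ↔
      Φ u ∈ bifurcationLocus (fun y => ellipticUmbilic y + f y)) := fun u hu =>
    (hΨ u (by linarith)).trans (hΦ u (by linarith)).symm
  constructor
  · rintro ⟨x, ⟨hx, hxR⟩, hxz⟩
    obtain ⟨u, rfl : Ψ u = x⟩ := Ψ.surjective x
    have : Φ (Ψ.symm (Ψ u)) = Φ z := hxz
    rw [Ψ.symm_apply_apply] at this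
    rw [mem_closedBall_zero_iff, not_le, hΨn] at hxR
    rw [← this]
    exact ⟨(hzn u hxR).1 hx, by rwa [mem_closedBall_zero_iff, not_le, hΦn]⟩
  · rintro ⟨hz, hzR⟩
    rw [mem_closedBall_zero_iff, not_le, hΦn] at hzR
    refine ⟨Ψ z, ⟨(hzn z hzR).2 hz, by rwa [mem_closedBall_zero_iff, not_le, hΨn]⟩, ?_⟩
    change Φ (Ψ.symm (Ψ z)) = Φ z
    rw [Ψ.symm_apply_apply]
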